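/- Let $\mathcal K\subset\mathbb R$ be a finite union of compact intervals and let $\mu$ be a finite Borel measure supported in $\mathcal K$, absolutely continuous with density $w\ge 0$ with respect to Lebesgue measure. Let $(p_j)_{j\ge 0}$ be the orthonormal polynomials of $\mu$ ($\deg p_j=j$, $\int p_ip_j\,d\mu=\delta_{ij}$). Assume that for every compact interval $J$ in the interior of $\mathcal K$ there is a constant $C_J>0$ with $$C_J^{-1}\le w(x)\le C_J\ \text{ for almost every } x\in J,\qquad \sup_{j\ge 0}\sup_{x\in J}|p_j(x)|\le C_J .$$ Let $N_0\in\mathbb N$, $\tau>0$, $0<\varepsilon<1$, let $k\ge 1$ be an integer, let $C>0$, and let $I$ be a compact interval in the interior of $\mathcal K$. Then there exist positive constants $C'$ and $c$, depending only on these data (in particular not on $n$), such that the following holds for every $n\ge 1$. Let $(\xi_0,\dots,\xi_n)$ and $(\tilde\xi_0,\dots,\tilde\xi_n)$ be two vectors of real or complex random variables satisfying the following condition: (i) the $\xi_i$ are independent (not necessarily identically distributed, not necessarily centered), with $\mathbb E|\xi_i-\mathbb E\xi_i|^2=1$ and $\mathbb E|\xi_i|^{2+\varepsilon}\le\tau$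 for $0\le i\le n$, and the same holds for the $\tilde\xi_i$; (ii) for all $N_0\le i\le n$ and all $a,b\in\{0,1,2\}$ with $a+b\le 2$, $\ \mathbb E\,\mathrm{Re}(\xi_i)^a\,\mathrm{Im}(\xi_i)^b=\mathbb E\,\mathrm{Re}(\tilde\xi_i)^a\,\mathrm{Im}(\tilde\xi_i)^b$. Put $F_n=\sum_{j=0}^n\xi_jp_j$ and $\tilde F_n=\sum_{j=0}^n\tilde\xi_jp_j$. Let $z_1,\dots,z_k\in I+B(0,c/n)$, where $B(z,r)$ denotes the disc of radius $r$ about $z$ in $\mathbb C$, and let $G:\mathbb C^k\to\mathbb C$ be supported on $\prod_{i=1}^kB(z_i,c/n)$, with continuous (real) derivatives up to order $2k+4$ and $\|\nabla^aG\|_\infty\le Cn^a$ for all $0\le a\le 2k+4$. Then the two sums below are integrable, and $$\Bigl|\mathbb E\sum G(\zeta_{i_1},\dots,\zeta_{i_k})-\mathbb E\sum G(\tilde\zeta_{i_1},\dots,\tilde\zeta_{i_k})\Bigr|\le C'n^{-c},$$ where the first sum runs over all $k$-tuples (repetitions allowed) of the complex roots $\zeta_1,\zeta_2,\dots$ of $F_n$,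 listed with multiplicity, and the second over all $k$-tuples of the complex roots $\tilde\zeta_1,\tilde\zeta_2,\dots$ of $\tilde F_n$. (When a polynomial is identically zero its sum is taken to be $0$.) -/

import Mathlib

open MeasureTheory ProbabilityTheory
open scoped Pointwise Polynomial

universe u v

/-- `p 0, p 1, …` is a system of orthonormal polynomials with respect to `μ`:
`p n` has degree exactly `n` and the `p n` are orthonormal in `L²(μ)`. (This determines each `p n`
up to sign; no choice of sign is imposed.) -/
structure IsOrthonormalPolynomials (μ : Measure ℝ) (p : ℕ → ℝ[X]) : Prop where
  degree_eq : ∀ n, (p n).degree = n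
  orthonormal : ∀ m n, ∫ x, (p m).eval x * (p n).eval x ∂μ = if m = n then 1 else 0

/-- `K` is a finite union of compact intervals of the real line. -/
def IsFiniteUnionOfCompactIntervals (K : Set ℝ) : Prop :=
  ∃ s : Finset (ℝ × ℝ), K = ⋃ q ∈ s, Set.Icc q.1 q.2

/-- The standing hypothesis on the measure `μ`, its density `w`, the set `K` carrying it, and its
orthonormal polynomials `p`: on every compact interval in the interior of `K` the density is
bounded above and below almost everywhere and the orthonormal polynomials are uniformly bounded. -/
structure IsAdmissibleMeasure (K : Set ℝ) (μ : Measure ℝ) (w : ℝ → ℝ) (p : ℕ → ℝ[X]) :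
    Prop where
  finite_union : IsFiniteUnionOfCompactIntervals K
  finite_measure : IsFiniteMeasure μ
  supported : μ Kᶜ = 0
  density_measurable : Measurable w
  density_nonneg : ∀ x, 0 ≤ w x
  eq_withDensity : μ = (volume : Measure ℝ).withDensity (fun x => ENNReal.ofReal (w x))
  orthonormal_polynomials : IsOrthonormalPolynomials μ p
  bounded_on_interior : ∀ a b : ℝ, Set.Icc a b ⊆ interior K → ∃ C : ℝ, 0 < C ∧
    (∀ᵐ x ∂(volume.restrict (Set.Icc a b)), C⁻¹ ≤ w x ∧ w x ≤ C) ∧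
    (∀ n : ℕ, ∀ x ∈ Set.Icc a b, |(p n).eval x| ≤ C)

/-- The complex random variables `ξ 0, …, ξ n` (real ones are a special case) are independent, have
unit variance `𝔼|ξ i - 𝔼 ξ i|² = 1`, and satisfy `𝔼|ξ i|^(2+ε) ≤ τ`. -/
structure HasBoundedMoments {Ω : Type*} [MeasurableSpace Ω] (P : Measure Ω) {n : ℕ}
    (ξ : Fin (n + 1) → Ω → ℂ) (τ ε : ℝ) : Prop where
  measurable : ∀ i, Measurable (ξ i)
  indep : iIndepFun ξ P
  unit_variance : ∀ i, ∫ ω, ‖ξ i ω - ∫ ω', ξ i ω' ∂P‖ ^ 2 ∂P = 1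
  moment_integrable : ∀ i, Integrable (fun ω => ‖ξ i ω‖ ^ (2 + ε)) P
  moment_le : ∀ i, ∫ ω, ‖ξ i ω‖ ^ (2 + ε) ∂P ≤ τ

/-- The moment matching condition with constants `N₀, τ, ε` for the two coefficient vectors
`ξ 0, …, ξ n` and `ξ' 0, …, ξ' n` (which may live on different probability spaces): both have
bounded `2+ε` moments as above, and for `i ≥ N₀` the joint moments of the real and imaginary parts
of `ξ i` and of `ξ' i` agree up to the second order. -/
structure MomentMatching {Ω Ω' : Type*} [MeasurableSpace Ω] [MeasurableSpace Ω']
    (P : Measure Ω) (P' : Measure Ω') {n : ℕ}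
    (ξ : Fin (n + 1) → Ω → ℂ) (ξ' : Fin (n + 1) → Ω' → ℂ) (N₀ : ℕ) (τ ε : ℝ) : Prop where
  left : HasBoundedMoments P ξ τ ε
  right : HasBoundedMoments P' ξ' τ ε
  matching : ∀ i : Fin (n + 1), N₀ ≤ (i : ℕ) → ∀ a b : ℕ, a + b ≤ 2 →
    ∫ ω, (ξ i ω).re ^ a * (ξ i ω).im ^ b ∂P = ∫ ω, (ξ' i ω).re ^ a * (ξ' i ω).im ^ b ∂P'

/-- The polynomial `F_n = ∑_{j=0}^n x_j p_j` with complex coefficients `x_j`. -/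
noncomputable def orthoPoly (p : ℕ → ℝ[X]) {n : ℕ} (x : Fin (n + 1) → ℂ) : ℂ[X] :=
  ∑ j : Fin (n + 1), Polynomial.C (x j) * (p j).map (algebraMap ℝ ℂ)

/-- The sum of `G` over all `k`-tuples of complex roots of `F`. The index type is the multiset of
roots viewed as a type, so roots are repeated according to multiplicity, and the same root may be
used several times in a tuple. The zero polynomial contributes the empty sum. -/
noncomputable def rootTupleSum {k : ℕ} (G : (Fin k → ℂ) → ℂ) (F : ℂ[X]) : ℂ :=
  ∑ t : Fin k → F.roots.ToType, G (fun j => (t j).1)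

/-! ### The logarithmic potential in the plane -/

/-! The sum over root tuples is a statistic of log|F|. Since log|w - ζ| is 2π times the fundamental
solution of the Laplacian in the plane, one variable at a time gives `rootTupleSum_eq_integral`: the
sum is (2π)^(-k) ∫ ∏ log(|F(w_i)|/s) Δ₁⋯Δ_k G(w) dw, for any s > 0 because rescaling F does not move
its roots. The iterated Laplacian of G has size O(n^(2k)) and lives on a product of discs of total
volume O(n^(-2k)). So it suffices to compare, on average over w, the expectations of products of k
logarithms.

The logarithm is too singular for a direct comparison. Put y = F(w)/√n and replace log(|y|/Λ) by
`regLog`, with Λ = n² and δ a small negative power of n. This function is a superposition of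
Gaussians e^(-s|y|²), and each of those is an average over a planar Gaussian g of exp(i Re(√(2s) y
g)). The comparison is thereby reduced to characteristic functions of linear forms ∑ ξ_j b_j, which
factor by independence. The p_j stay bounded at complex distance O(1/n) from the interval
(`norm_eval_le_exp`), so b_j = O(n^(-1/2)). Equal moments up to order two make the factors differ by
O(|b_j|^(2+ε)), which sums to O(n^(-ε/2)); the at most N₀ unmatched factors cost O(n^(-1/2)) each.
The outcome, `exists_regLog_comparison`, loses powers of 1/δ and of log(Λ/δ), which n^(-ε/2) can
absorb.

The cost of the regularization is bounded in
`IsAdmissibleMeasure.exists_norm_integral_log_sub_regLog_le`, separately for each coefficient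
vector. Large |y| is harmless because of second moments. Small |y| needs two facts. The first is a
small ball estimate (`exists_small_ball`). It rests on a lower bound for the variance of y, that is,
on ∑_{j ≤ n} |p_j|² ≥ κn near the interval, which follows from the extremal property of the
Christoffel function tested on a Chebyshev peak polynomial (`IsAdmissibleMeasure.sum_sq_eval_ge`).
The second is an L² bound for log|F| itself outside an event of probability n^(-k-1)
(`IsAdmissibleMeasure.exists_good_event`). A polynomial that is at most e^T on a disc and at least
e^(-T) at its centre has a well controlled logarithm (root counting and Borel–Carathéodory). The
upper bound holds by Markov. The lower bound holds at one of about log n nodes: if F is tiny at M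
nodes then, given the other coefficients, the first M coefficients lie in a small product of discs,
which has probability at most q^M since no ξ_j concentrates. On the exceptional event the
deterministic bound n^k sup|G| is enough. -/

theorem integrableOn_sq_log_norm_ball (ρ : ℝ) :
    IntegrableOn (fun w : ℂ => (Real.log ‖w‖) ^ 2) (Metric.ball 0 ρ) := by
  -- Polar coordinates leave y (log y)². Written as 4(√y log √y)² it is visibly continuous at 0,
  -- because x log x is.
  have hcont : Continuous fun y : ℝ => 4 * (√y * Real.log √y) ^ 2 := by
    have := Real.continuous_mul_log.comp Real.continuous_sqrt
    exact continuous_const.mul (this.pow 2)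
  have h1 : Integrable (fun w : ℂ => (Set.Iio ρ).indicator (fun y => (Real.log y) ^ 2) ‖w‖) := by
    rw [integrable_fun_norm_addHaar (μ := (volume : Measure ℂ))]
    have h2 : IntegrableOn (fun y : ℝ => 4 * (√y * Real.log √y) ^ 2) (Set.Ioo 0 ρ) :=
      (hcont.integrableOn_Icc (a := 0) (b := ρ)).mono_set Set.Ioo_subset_Icc_self
    have h3 : IntegrableOn ((Set.Ioo 0 ρ).indicator fun y : ℝ => 4 * (√y * Real.log √y) ^ 2)
        (Set.Ioi 0) := ((integrable_indicator_iff measurableSet_Ioo).2 h2).integrableOn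
    refine h3.congr_fun ?_ measurableSet_Ioi
    intro y hy
    have hy' : 0 < y := hy
    by_cases hyρ : y < ρ
    · have e1 : √y ^ 2 = y := Real.sq_sqrt hy'.le
      simp [Set.indicator, hy', hyρ, Complex.finrank_real_complex, Real.log_sqrt hy'.le, mul_pow, e1]
      ring
    · simp [Set.indicator, hyρ]
  have h4 := h1.integrableOn (s := Metric.ball 0 ρ)
  refine h4.congr_fun ?_ measurableSet_ball
  intro w hw
  simp only [mem_ball_zero_iff] at hw
  simp [Set.indicator, hw]

theorem integrableOn_log_norm_ball (ρ : ℝ) :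
    IntegrableOn (fun w : ℂ => Real.log ‖w‖) (Metric.ball 0 ρ) := by
  have h : IntegrableOn (fun w : ℂ => 1 + (Real.log ‖w‖) ^ 2) (Metric.ball 0 ρ) := by
    refine Integrable.add ?_ (integrableOn_sq_log_norm_ball ρ)
    exact integrableOn_const (by simp [Complex.volume_ball, ENNReal.mul_eq_top])
  refine h.mono' ?_ (ae_of_all _ fun w => ?_)
  · exact (Real.measurable_log.comp measurable_norm).aestronglyMeasurable
  · rw [Real.norm_eq_abs, abs_le]
    constructor <;> nlinarith [sq_nonneg (Real.log ‖w‖ + 1), sq_nonneg (Real.log ‖w‖ - 1)]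

theorem locallyIntegrable_log_norm_sub (ζ : ℂ) :
    LocallyIntegrable (fun w : ℂ => Real.log ‖w - ζ‖) := by
  have h0 : LocallyIntegrable (fun w : ℂ => Real.log ‖w‖) := by
    rw [locallyIntegrable_iff]
    intro K hK
    obtain ⟨ρ, hρ⟩ := hK.isBounded.subset_ball 0
    exact (integrableOn_log_norm_ball ρ).mono_set hρ
  rw [locallyIntegrable_iff]
  intro K hK
  have hK' : IsCompact ((fun w => w - ζ) '' K) := hK.image (by fun_prop)
  have := (locallyIntegrable_iff.1 h0) _ hK'
  have mp := measurePreserving_sub_right (volume : Measure ℂ) ζ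
  rw [mp.integrableOn_image (MeasurableEquiv.subRight ζ).measurableEmbedding] at this
  exact this

/-- The second-order operator `∂²/∂v₁² + ∂²/∂v₂²`. -/
noncomputable def dirLaplacian {E : Type*} [NormedAddCommGroup E] [NormedSpace ℝ E] (v₁ v₂ : E)
    (G : E → ℂ) (x : E) : ℂ :=
  fderiv ℝ (fun y => fderiv ℝ G y v₁) x v₁ + fderiv ℝ (fun y => fderiv ℝ G y v₂) x v₂

theorem ContDiff.fderiv_const_apply {E F : Type*} [NormedAddCommGroup E] [NormedSpace ℝ E]
    [NormedAddCommGroup F] [NormedSpace ℝ F] {G : E → F} {m : ℕ}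
    (h : ContDiff ℝ ((m + 1 : ℕ) : WithTop ℕ∞) G) (v : E) :
    ContDiff ℝ (m : WithTop ℕ∞) (fun y => fderiv ℝ G y v) :=
  (h.fderiv_right (m := m) (by push_cast; rfl)).clm_apply contDiff_const

theorem ContDiff.dirLaplacian {E : Type*} [NormedAddCommGroup E] [NormedSpace ℝ E] {G : E → ℂ}
    {m : ℕ} (h : ContDiff ℝ ((m + 2 : ℕ) : WithTop ℕ∞) G) (v₁ v₂ : E) :
    ContDiff ℝ (m : WithTop ℕ∞) (dirLaplacian v₁ v₂ G) :=
  ((h.fderiv_const_apply (m := m + 1) v₁).fderiv_const_apply v₁).add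
    ((h.fderiv_const_apply (m := m + 1) v₂).fderiv_const_apply v₂)

theorem tsupport_dirLaplacian_subset {E : Type*} [NormedAddCommGroup E] [NormedSpace ℝ E]
    (v₁ v₂ : E) (G : E → ℂ) : tsupport (dirLaplacian v₁ v₂ G) ⊆ tsupport G := by
  have h (v : E) : tsupport (fun x => fderiv ℝ (fun y => fderiv ℝ G y v) x v) ⊆ tsupport G :=
    (tsupport_fderiv_apply_subset ℝ v).trans (tsupport_fderiv_apply_subset ℝ v)
  refine closure_minimal (fun x hx => ?_) (isClosed_tsupport G)
  by_contra hc
  have h1 := image_eq_zero_of_notMem_tsupport (fun hh => hc (h v₁ hh))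
  have h2 := image_eq_zero_of_notMem_tsupport (fun hh => hc (h v₂ hh))
  exact hx (by simp only [_root_.dirLaplacian]; rw [h1, h2, add_zero])

theorem integral_smul_fderiv_fderiv_of_contDiff {h : ℂ → ℝ} {g : ℂ → ℂ}
    (hh : ContDiff ℝ ((2 : ℕ) : WithTop ℕ∞) h) (hg : ContDiff ℝ ((2 : ℕ) : WithTop ℕ∞) g)
    (hc : HasCompactSupport g) (v : ℂ) :
    ∫ w, h w • fderiv ℝ (fun y => fderiv ℝ g y v) w v =
      ∫ w, fderiv ℝ (fun y => fderiv ℝ h y v) w v • g w := by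
  have hg1 := hg.fderiv_const_apply (m := 1) v
  have hg2 := hg1.fderiv_const_apply (m := 0) v
  have hh1 := hh.fderiv_const_apply (m := 1) v
  have hh2 := hh1.fderiv_const_apply (m := 0) v
  have hc1 : HasCompactSupport fun y => fderiv ℝ g y v := hc.fderiv_apply ℝ v
  have hc2 : HasCompactSupport fun w => fderiv ℝ (fun y => fderiv ℝ g y v) w v :=
    hc1.fderiv_apply ℝ v
  have int {a : ℂ → ℝ} {b : ℂ → ℂ} (ha : Continuous a) (hb : Continuous b)
      (hs : HasCompactSupport b) : Integrable fun w => a w • b w :=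
    (ha.smul hb).integrable_of_hasCompactSupport hs.smul_left
  rw [integral_smul_fderiv_eq_neg_fderiv_smul_of_integrable
    (int hh1.continuous hg1.continuous hc1) (int hh.continuous hg2.continuous hc2)
    (int hh.continuous hg1.continuous hc1)
    (fun x _ => (hh.differentiable (by norm_num)) x)
    (fun x _ => (hg1.differentiable (by norm_num)) x),
    integral_smul_fderiv_eq_neg_fderiv_smul_of_integrable
    (int hh2.continuous hg.continuous hc) (int hh1.continuous hg1.continuous hc1)
    (int hh1.continuous hg.continuous hc)
    (fun x _ => (hh1.differentiable (by norm_num)) x)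
    (fun x _ => (hg.differentiable (by norm_num)) x), neg_neg]

/-- This is the total mass of the Laplacian of ½ log(|w|² + 1), and the source of the constant 2π in
every potential formula below. -/
theorem integral_two_div_one_add_sq_sq :
    ∫ w : ℂ, 2 / (1 + ‖w‖ ^ 2) ^ 2 = 2 * Real.pi ∧
      Integrable fun w : ℂ => 2 / (1 + ‖w‖ ^ 2) ^ 2 := by
  have hd : ∀ x ∈ Set.Ici (0 : ℝ), HasDerivAt (fun y : ℝ => -(1 + y ^ 2)⁻¹)
      (x * (2 / (1 + x ^ 2) ^ 2)) x := by
    intro x _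
    have h1 : HasDerivAt (fun y : ℝ => 1 + y ^ 2) (2 * x) x := by
      simpa using (hasDerivAt_pow 2 x).const_add 1
    exact (h1.fun_inv (by positivity)).fun_neg.congr_deriv (by ring)
  have hpos : ∀ x ∈ Set.Ioi (0 : ℝ), 0 ≤ x * (2 / (1 + x ^ 2) ^ 2) := fun x hx => by
    have : (0 : ℝ) < x := hx
    positivity
  have hlim : Filter.Tendsto (fun y : ℝ => -(1 + y ^ 2)⁻¹) Filter.atTop (nhds 0) := by
    rw [← neg_zero]
    refine (Filter.Tendsto.inv_tendsto_atTop ?_).neg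
    exact Filter.tendsto_atTop_add_const_left _ _ (Filter.tendsto_pow_atTop (by norm_num))
  constructor
  · rw [integral_fun_norm_addHaar (volume : Measure ℂ) (fun r => 2 / (1 + r ^ 2) ^ 2)]
    have := integral_Ioi_of_hasDerivAt_of_nonneg' hd hpos hlim
    simp only [Complex.finrank_real_complex, Nat.add_one_sub_one, pow_one, smul_eq_mul,
      Measure.real, Complex.volume_ball]
    rw [this]
    simp
  · refine (integrable_fun_norm_addHaar (volume : Measure ℂ)
      (f := fun r => 2 / (1 + r ^ 2) ^ 2)).2 ?_
    simpa [Complex.finrank_real_complex] using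
      integrableOn_Ioi_deriv_of_nonneg' hd hpos hlim

theorem contDiff_half_log_normSq_add {δ : ℝ} (hδ : 0 < δ) (m : WithTop ℕ∞) :
    ContDiff ℝ m (fun w : ℂ => (1 / 2 : ℝ) * Real.log (‖w‖ ^ 2 + δ ^ 2)) := by
  have h1 : ContDiff ℝ m (fun w : ℂ => ‖w‖ ^ 2 + δ ^ 2) :=
    (contDiff_norm_sq ℝ).add contDiff_const
  exact contDiff_const.mul (h1.log fun x => by positivity)

theorem laplacian_half_log_normSq_add {δ : ℝ} (hδ : 0 < δ) (w : ℂ) :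
    fderiv ℝ (fun y => fderiv ℝ (fun w : ℂ => (1 / 2 : ℝ) * Real.log (‖w‖ ^ 2 + δ ^ 2)) y 1) w 1 +
    fderiv ℝ (fun y => fderiv ℝ (fun w : ℂ => (1 / 2 : ℝ) * Real.log (‖w‖ ^ 2 + δ ^ 2)) y
      Complex.I) w Complex.I = 2 * δ ^ 2 / (‖w‖ ^ 2 + δ ^ 2) ^ 2 := by
  have hpos : ∀ y : ℂ, 0 < ‖y‖ ^ 2 + δ ^ 2 := fun y => by positivity
  have hd0 : ∀ y : ℂ, HasFDerivAt (fun w : ℂ => ‖w‖ ^ 2 + δ ^ 2) (2 • (innerSL ℝ y)) y := by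
    intro y
    exact ((hasStrictFDerivAt_norm_sq y).hasFDerivAt).add_const (δ ^ 2)
  have hd : ∀ y v : ℂ, fderiv ℝ (fun w : ℂ => (1 / 2 : ℝ) * Real.log (‖w‖ ^ 2 + δ ^ 2)) y v =
      inner ℝ v y / (‖y‖ ^ 2 + δ ^ 2) := by
    intro y v
    have := (((hd0 y).log (hpos y).ne').const_mul (1 / 2 : ℝ)).fderiv
    rw [this]
    simp [real_inner_comm]
    field_simp
  have hd2 : ∀ v : ℂ, fderiv ℝ (fun y : ℂ => inner ℝ v y / (‖y‖ ^ 2 + δ ^ 2)) w v =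
      ((inner ℝ v v) * (‖w‖ ^ 2 + δ ^ 2) - 2 * (inner ℝ v w) ^ 2) / (‖w‖ ^ 2 + δ ^ 2) ^ 2 := by
    intro v
    have h1 : HasFDerivAt (fun y : ℂ => inner ℝ v y) (innerSL ℝ v) w := (innerSL ℝ v).hasFDerivAt
    have := (h1.mul ((hasDerivAt_inv (hpos w).ne').comp_hasFDerivAt w (hd0 w))).fderiv
    simp only [div_eq_mul_inv]
    erw [this]
    simp [real_inner_comm]
    have := (hpos w).ne'
    field_simp
    ring
  simp only [hd, hd2]
  rw [← add_div]
  congr 1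
  simp only [Complex.inner, ← Complex.normSq_eq_norm_sq, Complex.normSq_apply]
  simp
  ring

/-- Regularize log|w| to ½ log(|w|² + δ²) and integrate by parts twice. The Laplacian then falls on
a smooth bump of mass 2π at scale δ, and the substitution w = δu exhibits an approximate identity.
Dominated convergence as δ → 0 on both sides gives the claim. -/
theorem integral_log_norm_smul_dirLaplacian {g : ℂ → ℂ}
    (hg : ContDiff ℝ ((2 : ℕ) : WithTop ℕ∞) g) (hc : HasCompactSupport g) :
    ∫ w, Real.log ‖w‖ • dirLaplacian 1 Complex.I g w = (2 * Real.pi : ℝ) • g 0 := by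
  set L := dirLaplacian 1 Complex.I g with hL
  have hLc : Continuous L := (ContDiff.dirLaplacian (m := 0) hg 1 Complex.I).continuous
  have hLs : HasCompactSupport L := hc.mono' (subset_closure.trans (tsupport_dirLaplacian_subset _ _ g))
  have hg1 (v : ℂ) := hg.fderiv_const_apply (m := 1) v
  have hg2 (v : ℂ) := (hg1 v).fderiv_const_apply (m := 0) v
  -- the regularised identity
  have key : ∀ δ : ℝ, 0 < δ → ∫ w, ((1 / 2 : ℝ) * Real.log (‖w‖ ^ 2 + δ ^ 2)) • L w =
      ∫ u : ℂ, (2 / (1 + ‖u‖ ^ 2) ^ 2) • g (δ • u) := by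
    intro δ hδ
    have hh := contDiff_half_log_normSq_add hδ ((2 : ℕ) : WithTop ℕ∞)
    have hh2 (v : ℂ) := (hh.fderiv_const_apply (m := 1) v).fderiv_const_apply (m := 0) v
    have e1 (v : ℂ) := integral_smul_fderiv_fderiv_of_contDiff hh hg hc v
    have hcs (v : ℂ) : HasCompactSupport fun w => fderiv ℝ (fun y => fderiv ℝ g y v) w v :=
      (hc.fderiv_apply ℝ v).fderiv_apply ℝ v
    have i1 (v : ℂ) : Integrable fun w : ℂ => ((1 / 2 : ℝ) * Real.log (‖w‖ ^ 2 + δ ^ 2)) •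
        fderiv ℝ (fun y => fderiv ℝ g y v) w v :=
      (hh.continuous.smul (hg2 v).continuous).integrable_of_hasCompactSupport (hcs v).smul_left
    have i2 (v : ℂ) : Integrable fun w : ℂ => fderiv ℝ (fun y => fderiv ℝ (fun w : ℂ =>
        (1 / 2 : ℝ) * Real.log (‖w‖ ^ 2 + δ ^ 2)) y v) w v • g w :=
      ((hh2 v).continuous.smul hg.continuous).integrable_of_hasCompactSupport hc.smul_left
    have e2 : ∫ w, ((1 / 2 : ℝ) * Real.log (‖w‖ ^ 2 + δ ^ 2)) • L w =
        ∫ w : ℂ, (2 * δ ^ 2 / (‖w‖ ^ 2 + δ ^ 2) ^ 2) • g w := by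
      simp only [hL, dirLaplacian, smul_add]
      rw [integral_add (i1 1) (i1 Complex.I), e1, e1, ← integral_add (i2 1) (i2 Complex.I)]
      simp only [← add_smul, laplacian_half_log_normSq_add hδ]
    rw [e2]
    have e3 := Measure.integral_comp_smul (volume : Measure ℂ)
      (fun w : ℂ => (2 * δ ^ 2 / (‖w‖ ^ 2 + δ ^ 2) ^ 2) • g w) δ
    rw [Complex.finrank_real_complex, abs_of_pos (by positivity)] at e3
    have e4 : ∀ u : ℂ, (2 * δ ^ 2 / (‖δ • u‖ ^ 2 + δ ^ 2) ^ 2) • g (δ • u) =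
        (δ ^ 2)⁻¹ • ((2 / (1 + ‖u‖ ^ 2) ^ 2) • g (δ • u)) := by
      intro u
      rw [smul_smul, norm_smul, Real.norm_eq_abs, mul_pow, sq_abs]
      congr 1
      have : (1 + ‖u‖ ^ 2) ≠ 0 := by positivity
      have : δ ^ 2 * ‖u‖ ^ 2 + δ ^ 2 = δ ^ 2 * (1 + ‖u‖ ^ 2) := by ring
      rw [this]
      field_simp
    simp only [e4] at e3
    rw [integral_smul] at e3
    exact ((isUnit_iff_ne_zero.2 (by positivity : (δ ^ 2)⁻¹ ≠ 0)).smul_left_cancel.1 e3).symm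
  obtain ⟨B, hB⟩ : ∃ B, ∀ x, ‖g x‖ ≤ B := hc.exists_bound_of_continuous hg.continuous
  obtain ⟨B', hB'⟩ : ∃ B, ∀ x, ‖L x‖ ≤ B := hLs.exists_bound_of_continuous hLc
  obtain ⟨ρ, hρ⟩ := hLs.isCompact.isBounded.subset_ball (0 : ℂ)
  have hseq : Filter.Tendsto (fun n : ℕ => ((n : ℝ) + 1)⁻¹) Filter.atTop (nhds 0) := by
    simpa using tendsto_one_div_add_atTop_nhds_zero_nat (𝕜 := ℝ)
  have hpos : ∀ n : ℕ, 0 < ((n : ℝ) + 1)⁻¹ := fun n => by positivity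
  have lim1 : Filter.Tendsto (fun n : ℕ => ∫ u : ℂ, (2 / (1 + ‖u‖ ^ 2) ^ 2) •
      g (((n : ℝ) + 1)⁻¹ • u)) Filter.atTop (nhds (∫ u : ℂ, (2 / (1 + ‖u‖ ^ 2) ^ 2) • g 0)) := by
    refine tendsto_integral_of_dominated_convergence (fun u : ℂ => 2 / (1 + ‖u‖ ^ 2) ^ 2 * B)
      (fun n => ?_) (integral_two_div_one_add_sq_sq.2.mul_const B) (fun n => ae_of_all _ fun u => ?_)
      (ae_of_all _ fun u => ?_)
    · refine Continuous.aestronglyMeasurable (Continuous.fun_smul ?_ ?_)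
      · exact continuous_const.div (by fun_prop) fun u => by positivity
      · exact hg.continuous.comp (by fun_prop)
    · rw [norm_smul, Real.norm_eq_abs, abs_of_pos (by positivity)]
      gcongr
      exact hB _
    · refine Filter.Tendsto.const_smul ?_ _
      refine (hg.continuous.tendsto 0).comp ?_
      simpa using hseq.smul_const u
  have lim2 : Filter.Tendsto (fun n : ℕ => ∫ w : ℂ, ((1 / 2 : ℝ) *
      Real.log (‖w‖ ^ 2 + (((n : ℝ) + 1)⁻¹) ^ 2)) • L w) Filter.atTop
      (nhds (∫ w, Real.log ‖w‖ • L w)) := by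
    -- Since δ ≤ 1, the regularized logarithm lies between log|w| and ½ log(|w|² + 1) off the
    -- origin. This provides an integrable majorant on a ball containing the support.
    refine tendsto_integral_of_dominated_convergence
      (fun w : ℂ => (Metric.ball (0 : ℂ) ρ).indicator
        (fun w => (|Real.log ‖w‖| + (1 / 2) * Real.log (‖w‖ ^ 2 + 1)) * B') w)
      (fun n => ?_) ?_ (fun n => ?_) ?_
    · exact ((contDiff_half_log_normSq_add (hpos n) 0).continuous.smul hLc).aestronglyMeasurable
    · rw [integrable_indicator_iff measurableSet_ball]
      refine Integrable.mul_const (Integrable.add (integrableOn_log_norm_ball ρ).abs ?_) _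
      have : Continuous fun w : ℂ => (1 / 2 : ℝ) * Real.log (‖w‖ ^ 2 + 1) := by
        simpa using (contDiff_half_log_normSq_add one_pos 0).continuous
      exact (this.locallyIntegrable.integrableOn_isCompact
        (isCompact_closedBall 0 ρ)).mono_set Metric.ball_subset_closedBall
    · filter_upwards [compl_mem_ae_iff.2 (measure_singleton (0 : ℂ))] with w hw
      have hw0 : 0 < ‖w‖ := norm_pos_iff.2 hw
      by_cases hwρ : w ∈ Metric.ball (0 : ℂ) ρ
      · rw [Set.indicator_of_mem hwρ, norm_smul]
        have a3 : 0 ≤ Real.log (‖w‖ ^ 2 + 1) := Real.log_nonneg (by nlinarith)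
        refine mul_le_mul ?_ (hB' w) (norm_nonneg _) (by positivity)
        · rw [Real.norm_eq_abs, abs_le]
          have a1 : Real.log ‖w‖ ≤ (1 / 2 : ℝ) * Real.log (‖w‖ ^ 2 + (((n : ℝ) + 1)⁻¹) ^ 2) := by
            have := Real.log_le_log (by positivity : 0 < ‖w‖ ^ 2)
              (le_add_of_nonneg_right (sq_nonneg (((n : ℝ) + 1)⁻¹)))
            rw [Real.log_pow] at this
            push_cast at this
            linarith
          have a2 : Real.log (‖w‖ ^ 2 + (((n : ℝ) + 1)⁻¹) ^ 2) ≤ Real.log (‖w‖ ^ 2 + 1) := by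
            refine Real.log_le_log (by positivity) ?_
            gcongr
            exact pow_le_one₀ (hpos n).le (inv_le_one_of_one_le₀ (by linarith [n.cast_nonneg (α := ℝ)]))
          constructor
          · linarith [neg_abs_le (Real.log ‖w‖)]
          · linarith [abs_nonneg (Real.log ‖w‖)]
      · have : L w = 0 := image_eq_zero_of_notMem_tsupport fun h => hwρ (hρ h)
        rw [this, smul_zero, norm_zero, Set.indicator_of_notMem hwρ]
    · filter_upwards [compl_mem_ae_iff.2 (measure_singleton (0 : ℂ))] with w hw
      have hw0 : 0 < ‖w‖ := norm_pos_iff.2 hw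
      refine Filter.Tendsto.smul_const ?_ _
      have b1 : Filter.Tendsto (fun n : ℕ => ‖w‖ ^ 2 + (((n : ℝ) + 1)⁻¹) ^ 2) Filter.atTop
          (nhds (‖w‖ ^ 2)) := by
        simpa using (hseq.pow 2).const_add (‖w‖ ^ 2)
      have b2 := (b1.log (by positivity)).const_mul (1 / 2 : ℝ)
      rw [Real.log_pow] at b2
      convert b2 using 2
      push_cast
      ring
  have e5 : ∀ n : ℕ, ∫ w : ℂ, ((1 / 2 : ℝ) * Real.log (‖w‖ ^ 2 + (((n : ℝ) + 1)⁻¹) ^ 2)) • L w =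
      ∫ u : ℂ, (2 / (1 + ‖u‖ ^ 2) ^ 2) • g (((n : ℝ) + 1)⁻¹ • u) := fun n => key _ (hpos n)
  simp only [e5] at lim2
  rw [tendsto_nhds_unique lim2 lim1, integral_smul_const, integral_two_div_one_add_sq_sq.1]

theorem integral_log_norm_sub_smul_dirLaplacian {g : ℂ → ℂ}
    (hg : ContDiff ℝ ((2 : ℕ) : WithTop ℕ∞) g) (hc : HasCompactSupport g) (ζ : ℂ) :
    ∫ w, Real.log ‖w - ζ‖ • dirLaplacian 1 Complex.I g w = (2 * Real.pi : ℝ) • g ζ := by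
  have h1 : ContDiff ℝ ((2 : ℕ) : WithTop ℕ∞) (fun w => g (w + ζ)) :=
    hg.comp (contDiff_id.add contDiff_const)
  have h2 : HasCompactSupport (fun w => g (w + ζ)) :=
    hc.comp_homeomorph (Homeomorph.addRight ζ)
  have h3 := integral_log_norm_smul_dirLaplacian h1 h2
  rw [zero_add] at h3
  rw [← h3, ← integral_add_right_eq_self _ ζ]
  have h4 (v w : ℂ) : fderiv ℝ (fun y => fderiv ℝ g (y + ζ) v) w v =
      fderiv ℝ (fun y => fderiv ℝ g y v) (w + ζ) v :=
    congrArg (fun L : ℂ →L[ℝ] ℂ => L v)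
      (fderiv_comp_add_right (f := fun y => fderiv ℝ g y v) (x := w) ζ)
  simp only [add_sub_cancel_right, dirLaplacian, fderiv_comp_add_right, h4]

theorem integral_dirLaplacian_eq_zero {g : ℂ → ℂ}
    (hg : ContDiff ℝ ((2 : ℕ) : WithTop ℕ∞) g) (hc : HasCompactSupport g) :
    ∫ w, dirLaplacian 1 Complex.I g w = 0 := by
  have h (v : ℂ) := integral_smul_fderiv_fderiv_of_contDiff (h := fun _ => 1) contDiff_const hg hc v
  simp only [one_smul] at h
  have hi (v : ℂ) : Integrable fun w => fderiv ℝ (fun y => fderiv ℝ g y v) w v :=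
    (((hg.fderiv_const_apply (m := 1) v).fderiv_const_apply (m := 0) v).continuous
      ).integrable_of_hasCompactSupport ((hc.fderiv_apply ℝ v).fderiv_apply ℝ v)
  simp only [dirLaplacian]
  rw [integral_add (hi _) (hi _), h, h]
  simp

/-! ### The logarithm of a polynomial as a potential of its roots -/

/-- The identity can fail at the roots, where `Real.log 0 = 0` replaces the value -∞; the roots form
a finite set, hence a null set. -/
theorem log_norm_eval_ae_eq {F : ℂ[X]} (hF : F ≠ 0) :
    ∀ᵐ u : ℂ, Real.log ‖F.eval u‖ =
      Real.log ‖F.leadingCoeff‖ + ∑ t : F.roots.ToType, Real.log ‖u - t.1‖ := by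
  have hfin : (F.roots.toFinset : Set ℂ).Finite := Finset.finite_toSet _
  filter_upwards [compl_mem_ae_iff.2 (hfin.measure_zero volume)] with u hu
  have hu' : ∀ t : F.roots.ToType, ‖u - t.1‖ ≠ 0 := by
    intro t h
    refine hu ?_
    rw [norm_eq_zero, sub_eq_zero] at h
    rw [h]
    simp
  rw [(IsAlgClosed.splits F).eval_eq_prod_roots]
  have : (F.roots.map (fun z => u - z)).prod = ∏ t : F.roots.ToType, (u - t.1) := by
    conv_lhs => rw [← Multiset.map_univ_coe F.roots, Multiset.map_map]
    rfl
  rw [this, norm_mul, norm_prod, Real.log_mul (by simpa using hF)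
    (Finset.prod_ne_zero_iff.2 fun t _ => hu' t), Real.log_prod fun t _ => hu' t]

theorem locallyIntegrable_log_norm_eval (F : ℂ[X]) :
    LocallyIntegrable (fun u : ℂ => Real.log ‖F.eval u‖) := by
  by_cases hF : F = 0
  · simp [hF, locallyIntegrable_zero]
  · have h : LocallyIntegrable (fun u : ℂ => Real.log ‖F.leadingCoeff‖ +
        ∑ t : F.roots.ToType, Real.log ‖u - t.1‖) :=
      (locallyIntegrable_const _).add
        (locallyIntegrable_finsetSum _ fun t _ => locallyIntegrable_log_norm_sub t.1)
    intro x
    obtain ⟨s, hs, hi⟩ := h x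
    exact ⟨s, hs, hi.congr_fun_ae (ae_restrict_of_ae
      ((log_norm_eval_ae_eq hF).mono fun u hu => hu.symm))⟩

/-- Each root contributes its own potential. The leading coefficient contributes nothing because the
Laplacian of a compactly supported function integrates to zero. -/
theorem integral_log_norm_eval_smul_dirLaplacian {F : ℂ[X]} (hF : F ≠ 0) {g : ℂ → ℂ}
    (hg : ContDiff ℝ ((2 : ℕ) : WithTop ℕ∞) g) (hc : HasCompactSupport g) :
    ∫ u, Real.log ‖F.eval u‖ • dirLaplacian 1 Complex.I g u =
      (2 * Real.pi : ℝ) • ∑ t : F.roots.ToType, g t.1 := by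
  have hLc : Continuous (dirLaplacian 1 Complex.I g) :=
    (ContDiff.dirLaplacian (m := 0) hg 1 Complex.I).continuous
  have hLs : HasCompactSupport (dirLaplacian 1 Complex.I g) :=
    hc.mono' (subset_closure.trans (tsupport_dirLaplacian_subset _ _ g))
  have h1 : ∫ u, Real.log ‖F.eval u‖ • dirLaplacian 1 Complex.I g u =
      ∫ u, (Real.log ‖F.leadingCoeff‖ • dirLaplacian 1 Complex.I g u +
        ∑ t : F.roots.ToType, Real.log ‖u - t.1‖ • dirLaplacian 1 Complex.I g u) := by
    refine integral_congr_ae ?_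
    filter_upwards [log_norm_eval_ae_eq hF] with u hu
    rw [hu, add_smul, Finset.sum_smul]
  have hi (t : F.roots.ToType) :
      Integrable fun u => Real.log ‖u - t.1‖ • dirLaplacian 1 Complex.I g u :=
    (locallyIntegrable_log_norm_sub t.1).integrable_smul_right_of_hasCompactSupport hLc hLs
  have h2 := integral_add (f := fun u => Real.log ‖F.leadingCoeff‖ • dirLaplacian 1 Complex.I g u)
    ((hLc.integrable_of_hasCompactSupport hLs).fun_smul _)
    (integrable_finsetSum Finset.univ fun t _ => hi t)
  rw [h1]
  refine h2.trans ?_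
  rw [integral_smul, integral_dirLaplacian_eq_zero hg hc, smul_zero, zero_add,
    integral_finsetSum _ fun t _ => hi t, Finset.smul_sum]
  exact Finset.sum_congr rfl fun t _ => integral_log_norm_sub_smul_dirLaplacian hg hc t.1

/-! ### Iterated Laplacians and the integral formula for tuples of roots -/

theorem dirLaplacian_comp_affine {E E' : Type*} [NormedAddCommGroup E] [NormedSpace ℝ E]
    [NormedAddCommGroup E'] [NormedSpace ℝ E'] {f : E' → ℂ}
    (hf : ContDiff ℝ ((2 : ℕ) : WithTop ℕ∞) f) (L : E →L[ℝ] E') (c : E') (v₁ v₂ y : E) :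
    dirLaplacian v₁ v₂ (fun y => f (c + L y)) y = dirLaplacian (L v₁) (L v₂) f (c + L y) := by
  have h (φ : E' → ℂ) (hφ : Differentiable ℝ φ) (y v : E) :
      fderiv ℝ (fun y => φ (c + L y)) y v = fderiv ℝ φ (c + L y) (L v) := by
    have h1 : HasFDerivAt (fun y => c + L y) L y := L.hasFDerivAt.const_add c
    have := ((hφ (c + L y)).hasFDerivAt.comp y h1).fderiv
    exact congrArg (fun T : E →L[ℝ] ℂ => T v) this
  have hd := hf.differentiable (by norm_num)
  have hd1 (v : E') := (hf.fderiv_const_apply (m := 1) v).differentiable (by norm_num)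
  simp only [dirLaplacian, h f hd]
  rw [h (fun x => fderiv ℝ f x (L v₁)) (hd1 _), h (fun x => fderiv ℝ f x (L v₂)) (hd1 _)]

/-- Apply successively the Laplacians in the complex coordinates listed in `l`. -/
noncomputable def coordLaplacian {k : ℕ} (l : List (Fin k)) (G : (Fin k → ℂ) → ℂ) :
    (Fin k → ℂ) → ℂ :=
  l.foldr (fun i H => dirLaplacian (Pi.single i 1) (Pi.single i Complex.I) H) G

theorem ContDiff.coordLaplacian {k : ℕ} (l : List (Fin k)) {G : (Fin k → ℂ) → ℂ} {m : ℕ}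
    (h : ContDiff ℝ ((m + 2 * l.length : ℕ) : WithTop ℕ∞) G) :
    ContDiff ℝ (m : WithTop ℕ∞) (coordLaplacian l G) := by
  induction l generalizing m with
  | nil => simpa [_root_.coordLaplacian] using h
  | cons i l ih =>
    refine ContDiff.dirLaplacian (m := m) (ih (m := m + 2) ?_) _ _
    have e : m + 2 + 2 * l.length = m + 2 * (i :: l).length := by
      rw [List.length_cons]; ring
    rwa [e]

theorem tsupport_coordLaplacian_subset {k : ℕ} (l : List (Fin k)) (G : (Fin k → ℂ) → ℂ) :
    tsupport (coordLaplacian l G) ⊆ tsupport G := by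
  induction l with
  | nil => exact subset_rfl
  | cons i l ih => exact (tsupport_dirLaplacian_subset _ _ _).trans ih

theorem norm_iteratedFDeriv_fderiv_apply_le {E : Type*} [NormedAddCommGroup E] [NormedSpace ℝ E]
    {G : E → ℂ} {m : ℕ} (h : ContDiff ℝ ((m + 1 : ℕ) : WithTop ℕ∞) G) (v x : E) :
    ‖iteratedFDeriv ℝ m (fun y => fderiv ℝ G y v) x‖ ≤ ‖v‖ * ‖iteratedFDeriv ℝ (m + 1) G x‖ := by
  have h1 := ContinuousLinearMap.norm_iteratedFDeriv_comp_left (𝕜 := ℝ) (n := m)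
    (ContinuousLinearMap.apply ℝ ℂ v) (f := fderiv ℝ G) (x := x)
    ((h.fderiv_right (m := m) (by push_cast; rfl)).contDiffAt) le_rfl
  rw [norm_iteratedFDeriv_fderiv] at h1
  refine h1.trans ?_
  gcongr
  refine ContinuousLinearMap.opNorm_le_bound _ (norm_nonneg _) fun T => ?_
  rw [mul_comm]
  exact T.le_opNorm v

theorem norm_iteratedFDeriv_dirLaplacian_le {E : Type*} [NormedAddCommGroup E] [NormedSpace ℝ E]
    {G : E → ℂ} {m : ℕ} (h : ContDiff ℝ ((m + 2 : ℕ) : WithTop ℕ∞) G) {v₁ v₂ : E}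
    (h₁ : ‖v₁‖ ≤ 1) (h₂ : ‖v₂‖ ≤ 1) (x : E) :
    ‖iteratedFDeriv ℝ m (dirLaplacian v₁ v₂ G) x‖ ≤ 2 * ‖iteratedFDeriv ℝ (m + 2) G x‖ := by
  have hb (v : E) (hv : ‖v‖ ≤ 1) :
      ‖iteratedFDeriv ℝ m (fun x => fderiv ℝ (fun y => fderiv ℝ G y v) x v) x‖ ≤
        ‖iteratedFDeriv ℝ (m + 2) G x‖ := by
    have a1 := norm_iteratedFDeriv_fderiv_apply_le (h.fderiv_const_apply (m := m + 1) v) v x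
    have a2 := norm_iteratedFDeriv_fderiv_apply_le (m := m + 1) h v x
    refine a1.trans ((mul_le_of_le_one_left (norm_nonneg _) hv).trans
      (a2.trans (mul_le_of_le_one_left (norm_nonneg _) hv)))
  have hc (v : E) : ContDiff ℝ (m : WithTop ℕ∞)
      (fun x => fderiv ℝ (fun y => fderiv ℝ G y v) x v) :=
    (h.fderiv_const_apply (m := m + 1) v).fderiv_const_apply v
  have : dirLaplacian v₁ v₂ G = (fun x => fderiv ℝ (fun y => fderiv ℝ G y v₁) x v₁) +
      (fun x => fderiv ℝ (fun y => fderiv ℝ G y v₂) x v₂) := rfl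
  rw [this, iteratedFDeriv_add (hc v₁) (hc v₂)]
  refine (norm_add_le _ _).trans ?_
  linarith [hb v₁ h₁, hb v₂ h₂]

theorem norm_iteratedFDeriv_coordLaplacian_le {k : ℕ} (l : List (Fin k)) {G : (Fin k → ℂ) → ℂ}
    {m : ℕ} (h : ContDiff ℝ ((m + 2 * l.length : ℕ) : WithTop ℕ∞) G) (x : Fin k → ℂ) :
    ‖iteratedFDeriv ℝ m (coordLaplacian l G) x‖ ≤
      2 ^ l.length * ‖iteratedFDeriv ℝ (m + 2 * l.length) G x‖ := by
  induction l generalizing m with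
  | nil => simp [coordLaplacian]
  | cons i l ih =>
    have hm : m + 2 * (i :: l).length = (m + 2) + 2 * l.length := by simp; ring
    rw [hm] at h ⊢
    have h1 := norm_iteratedFDeriv_dirLaplacian_le (m := m) (ContDiff.coordLaplacian (m := m + 2) l h)
      (v₁ := Pi.single i 1) (v₂ := Pi.single i Complex.I) (by simp [Pi.norm_single])
      (by simp [Pi.norm_single]) x
    refine h1.trans ?_
    rw [List.length_cons, pow_succ']
    linarith [ih (m := m + 2) h]

theorem coordLaplacian_map_succ {k : ℕ} (l : List (Fin k)) {G : (Fin (k + 1) → ℂ) → ℂ}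
    (h : ContDiff ℝ ((2 * l.length : ℕ) : WithTop ℕ∞) G) (u : ℂ) (w : Fin k → ℂ) :
    coordLaplacian (l.map Fin.succ) G (Fin.cons u w) =
      coordLaplacian l (fun w => G (Fin.cons u w)) w := by
  let L : (Fin k → ℂ) →L[ℝ] (Fin (k + 1) → ℂ) :=
    ContinuousLinearMap.pi (Fin.cons 0 fun i => ContinuousLinearMap.proj i)
  have hL : ∀ (u : ℂ) (w : Fin k → ℂ), (Fin.cons u w : Fin (k + 1) → ℂ) =
      (Fin.cons u 0 : Fin (k + 1) → ℂ) + L w := by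
    intro u w
    ext i
    refine Fin.cases ?_ (fun i => ?_) i <;> simp [L]
  have hLs (i : Fin k) (a : ℂ) : L (Pi.single i a) = Pi.single i.succ a := by
    ext j
    refine Fin.cases ?_ (fun j => ?_) j
    · simp [L, (Fin.succ_ne_zero i).symm]
    · simp [L, Pi.single_apply]
  induction l generalizing w with
  | nil => rfl
  | cons i l ih =>
    have hl : 2 * (i :: l).length = 2 + 2 * l.length := by simp; ring
    rw [hl] at h
    have h2 : ContDiff ℝ ((2 : ℕ) : WithTop ℕ∞) (coordLaplacian (l.map Fin.succ) G) :=
      ContDiff.coordLaplacian _ (by simpa using h)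
    have h3 : (fun w => coordLaplacian l (fun w => G (Fin.cons u w)) w) =
        fun w => coordLaplacian (l.map Fin.succ) G ((Fin.cons u 0 : Fin (k + 1) → ℂ) + L w) := by
      funext w
      rw [← hL, ih (h.of_le (by norm_cast; omega))]
    change dirLaplacian (Pi.single i.succ 1) (Pi.single i.succ Complex.I)
        (coordLaplacian (l.map Fin.succ) G) (Fin.cons u w) =
      dirLaplacian (Pi.single i 1) (Pi.single i Complex.I)
        (fun w => coordLaplacian l (fun w => G (Fin.cons u w)) w) w
    rw [h3, dirLaplacian_comp_affine h2, hLs, hLs, ← hL]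
theorem MeasureTheory.LocallyIntegrable.integrable_prod_smul {ι : Type*} [Fintype ι]
    {a : ι → ℂ → ℝ} (ha : ∀ i, LocallyIntegrable (a i)) {Ψ : (ι → ℂ) → ℂ} (hΨ : Continuous Ψ)
    (hs : HasCompactSupport Ψ) : Integrable fun w => (∏ i, a i (w i)) • Ψ w := by
  obtain ⟨ρ, hρ⟩ := hs.isCompact.isBounded.subset_closedBall (0 : ι → ℂ)
  obtain ⟨B, hB⟩ := hs.exists_bound_of_continuous hΨ
  have h1 (i : ι) : Integrable ((Metric.closedBall (0 : ℂ) ρ).indicator (a i)) :=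
    (integrable_indicator_iff measurableSet_closedBall).2
      ((ha i).integrableOn_isCompact (isCompact_closedBall 0 ρ))
  have h2 := Integrable.fintype_prod h1
  have h3 : Integrable fun w : ι → ℂ =>
      (∏ i, (Metric.closedBall (0 : ℂ) ρ).indicator (a i) (w i)) • Ψ w :=
    h2.smul_bdd B hΨ.aestronglyMeasurable (ae_of_all _ hB)
  refine h3.congr (ae_of_all _ fun w => ?_)
  by_cases hw : Ψ w = 0
  · simp [hw]
  · have hw' : w ∈ Metric.closedBall (0 : ι → ℂ) ρ := hρ (subset_closure hw)
    have hw2 : ∀ i, w i ∈ Metric.closedBall (0 : ℂ) ρ := by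
      intro i
      rw [mem_closedBall_zero_iff] at hw' ⊢
      exact (norm_le_pi_norm w i).trans hw'
    simp only [Set.indicator_of_mem (hw2 _)]

/-- Induction on k by Fubini. With the other coordinates frozen, integrating out coordinate 0 turns
its logarithm and its Laplacian into a sum over roots t. The induction hypothesis then applies to
each slice G(t, ·), and prefixing t to the shorter tuples yields all longer ones. -/
theorem integral_prod_log_norm_eval_smul_coordLaplacian {F : ℂ[X]} (hF : F ≠ 0) {k : ℕ}
    {G : (Fin k → ℂ) → ℂ} (hG : ContDiff ℝ ((2 * k : ℕ) : WithTop ℕ∞) G)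
    (hc : HasCompactSupport G) :
    ∫ w, (∏ i, Real.log ‖F.eval (w i)‖) • coordLaplacian (List.finRange k) G w =
      ((2 * Real.pi) ^ k : ℝ) • rootTupleSum G F := by
  induction k with
  | zero =>
    have : (default : Fin 0 → ℂ) = fun j => ((default : Fin 0 → F.roots.ToType) j).1 := by
      ext j; exact j.elim0
    rw [Measure.volume_pi_eq_dirac (default : Fin 0 → ℂ)]
    simp [rootTupleSum, coordLaplacian, this]
  | succ k ih =>
    set Ψ := coordLaplacian (List.finRange (k + 1)) G with hΨ
    have hΨc : Continuous Ψ :=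
      (ContDiff.coordLaplacian (m := 0) _ (by simpa using hG)).continuous
    have hΨs : HasCompactSupport Ψ :=
      hc.mono' (subset_closure.trans (tsupport_coordLaplacian_subset _ _))
    have hint := LocallyIntegrable.integrable_prod_smul
      (fun _ : Fin (k + 1) => locallyIntegrable_log_norm_eval F) hΨc hΨs
    have mp := (volume_preserving_piFinSuccAbove (fun _ : Fin (k + 1) => ℂ) 0).symm
    have he : ∀ q : ℂ × (Fin k → ℂ),
        (MeasurableEquiv.piFinSuccAbove (fun _ : Fin (k + 1) => ℂ) 0).symm q =
          (Fin.cons q.1 q.2 : Fin (k + 1) → ℂ) := by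
      intro q
      exact Fin.insertNth_zero' q.1 q.2
    have hint' : Integrable (fun q : ℂ × (Fin k → ℂ) =>
        (∏ i, Real.log ‖F.eval ((Fin.cons q.1 q.2 : Fin (k + 1) → ℂ) i)‖) •
          Ψ (Fin.cons q.1 q.2)) (volume.prod volume) := by
      have := mp.integrable_comp_of_integrable hint
      refine this.congr (ae_of_all _ fun q => ?_)
      simp only [Function.comp_apply, he]
    have e1 : ∫ w, (∏ i, Real.log ‖F.eval (w i)‖) • Ψ w = ∫ q : ℂ × (Fin k → ℂ),
        (∏ i, Real.log ‖F.eval ((Fin.cons q.1 q.2 : Fin (k + 1) → ℂ) i)‖) •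
          Ψ (Fin.cons q.1 q.2) ∂(volume.prod volume) := by
      rw [← mp.integral_comp (MeasurableEquiv.measurableEmbedding _)]
      simp only [he, Measure.volume_eq_prod]
    rw [e1, integral_prod_symm _ hint']
    set D := coordLaplacian ((List.finRange k).map Fin.succ) G with hD
    have hDc : ContDiff ℝ ((2 : ℕ) : WithTop ℕ∞) D := by
      refine ContDiff.coordLaplacian _ ?_
      have e : 2 + 2 * ((List.finRange k).map Fin.succ).length = 2 * (k + 1) := by simp; ring
      rwa [e]
    have hDs : HasCompactSupport D :=
      hc.mono' (subset_closure.trans (tsupport_coordLaplacian_subset _ _))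
    -- The list starts with 0 and `coordLaplacian` is a right fold, so the Laplacian in coordinate 0
    -- is outermost.
    have hΨD : Ψ = dirLaplacian (Pi.single 0 1) (Pi.single 0 Complex.I) D := by
      rw [hΨ, List.finRange_succ]; rfl
    let L : ℂ →L[ℝ] (Fin (k + 1) → ℂ) := ContinuousLinearMap.single ℝ (fun _ => ℂ) 0
    have hL : ∀ (u : ℂ) (w : Fin k → ℂ), (Fin.cons u w : Fin (k + 1) → ℂ) =
        (Fin.cons 0 w : Fin (k + 1) → ℂ) + L u := by
      intro u w
      ext i
      refine Fin.cases ?_ (fun i => ?_) i <;> simp [L]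
    have inner : ∀ w : Fin k → ℂ,
        ∫ u, (∏ i, Real.log ‖F.eval ((Fin.cons u w : Fin (k + 1) → ℂ) i)‖) • Ψ (Fin.cons u w) =
          (2 * Real.pi : ℝ) • ∑ t : F.roots.ToType, (∏ i, Real.log ‖F.eval (w i)‖) •
            coordLaplacian (List.finRange k) (fun w => G (Fin.cons t.1 w)) w := by
      intro w
      have hA : (fun u => D (Fin.cons u w)) =
          fun u => D ((Fin.cons 0 w : Fin (k + 1) → ℂ) + L u) := by
        funext u; rw [hL]
      have hg : ContDiff ℝ ((2 : ℕ) : WithTop ℕ∞) (fun u => D (Fin.cons u w)) := by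
        rw [hA]
        exact hDc.comp (contDiff_const.add L.contDiff)
      have hgs : HasCompactSupport (fun u => D (Fin.cons u w)) :=
        HasCompactSupport.intro (hDs.isCompact.image (continuous_apply 0)) fun u hu =>
          image_eq_zero_of_notMem_tsupport fun h => hu ⟨_, h, by simp⟩
      have h1 := integral_log_norm_eval_smul_dirLaplacian hF hg hgs
      have h2 : ∀ u, dirLaplacian 1 Complex.I (fun u => D (Fin.cons u w)) u =
          Ψ (Fin.cons u w) := by
        intro u
        rw [hA, dirLaplacian_comp_affine hDc, hΨD, ← hL]
        rfl
      simp only [Fin.prod_univ_succ, Fin.cons_zero, Fin.cons_succ]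
      have h3 (u : ℂ) : (Real.log ‖F.eval u‖ * ∏ i, Real.log ‖F.eval (w i)‖) • Ψ (Fin.cons u w) =
          (∏ i, Real.log ‖F.eval (w i)‖) • Real.log ‖F.eval u‖ • Ψ (Fin.cons u w) := by
        rw [smul_smul, mul_comm]
      simp only [h3]
      rw [integral_smul]
      simp only [h2] at h1
      rw [h1, smul_comm, Finset.smul_sum]
      congr 1
      refine Finset.sum_congr rfl fun t _ => ?_
      rw [hD, coordLaplacian_map_succ _ (hG.of_le (by norm_cast; simp))]
    simp only [inner]
    have hGt (u : ℂ) : ContDiff ℝ ((2 * k : ℕ) : WithTop ℕ∞)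
        (fun w : Fin k → ℂ => G (Fin.cons u w)) := by
      refine (hG.of_le (by norm_cast; omega)).comp ?_
      rw [contDiff_pi]
      intro i
      refine Fin.cases ?_ (fun i => ?_) i
      · simpa using contDiff_const
      · simpa using contDiff_apply ℝ ℂ i
    have hGs (u : ℂ) : HasCompactSupport (fun w : Fin k → ℂ => G (Fin.cons u w)) := by
      refine HasCompactSupport.intro (K := (fun w i => w (Fin.succ i)) '' tsupport G)
        (hc.isCompact.image (by fun_prop)) fun w hw =>
          image_eq_zero_of_notMem_tsupport fun h => hw ⟨_, h, by simp⟩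
    rw [integral_smul, integral_finsetSum]
    · simp only [ih (hGt _) (hGs _)]
      rw [← Finset.smul_sum, smul_smul, ← pow_succ']
      congr 1
      simp only [rootTupleSum]
      rw [← Fintype.sum_prod_type', ← (Fin.consEquiv fun _ => F.roots.ToType).sum_comp]
      refine Finset.sum_congr rfl fun q _ => ?_
      congr 1
      ext j
      refine Fin.cases ?_ (fun i => ?_) j <;> simp [Fin.consEquiv]
    · intro t _
      refine LocallyIntegrable.integrable_prod_smul
        (fun _ : Fin k => locallyIntegrable_log_norm_eval F) ?_ ?_
      · exact (ContDiff.coordLaplacian (m := 0) _ (by simpa using hGt t.1)).continuous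
      · exact (hGs t.1).mono' (subset_closure.trans (tsupport_coordLaplacian_subset _ _))

/-- Positivity of k matters: for k = 0 the empty tuple would still contribute. -/
theorem rootTupleSum_zero {k : ℕ} (hk : 0 < k) (G : (Fin k → ℂ) → ℂ) :
    rootTupleSum G 0 = 0 := by
  have : IsEmpty (Fin k → (0 : ℂ[X]).roots.ToType) := by
    rw [isEmpty_pi]
    refine ⟨⟨0, hk⟩, ⟨fun t => ?_⟩⟩
    have := Multiset.coe_mem (x := t)
    simp at this
  simp [rootTupleSum]

theorem rootTupleSum_C_mul {k : ℕ} (G : (Fin k → ℂ) → ℂ) (F : ℂ[X]) {c : ℂ} (hc : c ≠ 0) :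
    rootTupleSum G (Polynomial.C c * F) = rootTupleSum G F := by
  unfold rootTupleSum
  rw [Polynomial.roots_C_mul F hc]

/-- The scale s is free since F and F/s have the same roots. The formula survives for F = 0, where
the convention `Real.log 0 = 0` makes the integral vanish as well. -/
theorem rootTupleSum_eq_integral {k : ℕ} (hk : 0 < k) {G : (Fin k → ℂ) → ℂ}
    (hG : ContDiff ℝ ((2 * k : ℕ) : WithTop ℕ∞) G) (hc : HasCompactSupport G) (F : ℂ[X])
    {s : ℝ} (hs : 0 < s) :
    rootTupleSum G F = ((2 * Real.pi) ^ k : ℝ)⁻¹ •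
      ∫ w, (∏ i, Real.log (‖F.eval (w i)‖ / s)) • coordLaplacian (List.finRange k) G w := by
  by_cases hF : F = 0
  · subst hF
    have : Nonempty (Fin k) := ⟨⟨0, hk⟩⟩
    simp [rootTupleSum_zero hk, Finset.prod_const, hk.ne']
  · have hs' : (s : ℂ)⁻¹ ≠ 0 := inv_ne_zero (by exact_mod_cast hs.ne')
    have hF' : Polynomial.C ((s : ℂ)⁻¹) * F ≠ 0 := mul_ne_zero (by simpa using hs') hF
    have h := integral_prod_log_norm_eval_smul_coordLaplacian hF' hG hc
    rw [rootTupleSum_C_mul G F hs'] at h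
    rw [eq_inv_smul_iff₀ (by positivity), ← h]
    simp [abs_of_pos hs, div_eq_inv_mul]

/-- A deterministic bound by the number of tuples, used on exceptional events and for small n. -/
theorem norm_rootTupleSum_le {k : ℕ} {G : (Fin k → ℂ) → ℂ} {C : ℝ} (hG : ∀ x, ‖G x‖ ≤ C)
    (F : ℂ[X]) : ‖rootTupleSum G F‖ ≤ (F.natDegree : ℝ) ^ k * C := by
  have hC : 0 ≤ C := (norm_nonneg _).trans (hG 0)
  refine (norm_sum_le _ _).trans ((Finset.sum_le_card_nsmul _ _ C fun t _ => hG _).trans ?_)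
  rw [nsmul_eq_mul]
  gcongr
  have h : Fintype.card F.roots.ToType ≤ F.natDegree := by
    rw [Multiset.card_coe]
    exact Polynomial.card_roots' F
  rw [Finset.card_univ, Fintype.card_fun, Fintype.card_fin]
  push_cast
  gcongr

theorem norm_coordLaplacian_finRange_le {k : ℕ} {G : (Fin k → ℂ) → ℂ}
    (hG : ContDiff ℝ ((2 * k : ℕ) : WithTop ℕ∞) G) (x : Fin k → ℂ) :
    ‖coordLaplacian (List.finRange k) G x‖ ≤ 2 ^ k * ‖iteratedFDeriv ℝ (2 * k) G x‖ := by
  have h := norm_iteratedFDeriv_coordLaplacian_le (m := 0) (List.finRange k) (G := G)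
    (by simpa using hG) x
  have e : 0 + 2 * (List.finRange k).length = 2 * k := by simp
  rw [e] at h
  simpa using h

/-! ### Square integrability of the logarithm of a polynomial -/

theorem eval_eq_leadingCoeff_mul_prod_roots (F : ℂ[X]) (u : ℂ) :
    F.eval u = F.leadingCoeff * ∏ t : F.roots.ToType, (u - t.1) := by
  rw [(IsAlgClosed.splits F).eval_eq_prod_roots]
  congr 1
  conv_lhs => rw [← Multiset.map_univ_coe F.roots, Multiset.map_map]
  rfl

/-- A zero-free g is g(0)e^φ with φ(0) = 0, where φ is a primitive of g'/g. The two bounds on g give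
Re φ ≤ 2S, so Borel–Carathéodory yields |φ| ≤ 4S on the half disc. Adding |log|g(0)|| ≤ S gives 5S.
-/
theorem abs_log_norm_le_of_ne_zero {g : ℂ → ℂ} {r S : ℝ} (hr : 0 < r) (hS : 0 < S)
    (hg : Differentiable ℂ g) (h0 : ∀ z ∈ Metric.ball (0 : ℂ) r, g z ≠ 0)
    (hu : ∀ z ∈ Metric.ball (0 : ℂ) r, ‖g z‖ ≤ Real.exp S) (hl : Real.exp (-S) ≤ ‖g 0‖)
    {z : ℂ} (hz : ‖z‖ ≤ r / 2) : |Real.log ‖g z‖| ≤ 5 * S := by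
  have hmem0 : (0 : ℂ) ∈ Metric.ball (0 : ℂ) r := Metric.mem_ball_self hr
  have hd : DifferentiableOn ℂ (fun z => deriv g z / g z) (Metric.ball 0 r) := by
    refine DifferentiableOn.div ?_ hg.differentiableOn h0
    exact (hg.differentiableOn (s := Set.univ)).deriv isOpen_univ |>.mono (Set.subset_univ _)
  obtain ⟨φ, hφ0, hφ⟩ := hd.isExactOn_ball.with_val_at 0 0
  have hc : ∀ w ∈ Metric.ball (0 : ℂ) r, g w * Complex.exp (-φ w) = g 0 := by
    intro w hw
    have hder : ∀ x ∈ Metric.ball (0 : ℂ) r,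
        HasDerivAt (fun w => g w * Complex.exp (-φ w)) 0 x := by
      intro x hx
      have h1 := (hg x).hasDerivAt.mul ((hφ x hx).neg.cexp)
      refine h1.congr_deriv ?_
      have := h0 x hx
      field_simp
      ring
    have hconst := (convex_ball (0 : ℂ) r).is_const_of_fderivWithin_eq_zero (𝕜 := ℂ)
      (f := fun w => g w * Complex.exp (-φ w))
      (fun x hx => (hder x hx).differentiableAt.differentiableWithinAt)
      (fun x hx => by
        rw [fderivWithin_of_isOpen Metric.isOpen_ball hx, (hder x hx).hasFDerivAt.fderiv]
        ext; simp) hw hmem0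
    simpa [hφ0] using hconst
  have hnorm : ∀ w ∈ Metric.ball (0 : ℂ) r, Real.log ‖g w‖ = Real.log ‖g 0‖ + (φ w).re := by
    intro w hw
    have h1 : g w = g 0 * Complex.exp (φ w) := by
      rw [← hc w hw, mul_assoc, ← Complex.exp_add]; simp
    rw [h1, norm_mul, Complex.norm_exp, Real.log_mul (by simpa using h0 0 hmem0)
      (Real.exp_pos _).ne', Real.log_exp]
  have hg0 : 0 < ‖g 0‖ := norm_pos_iff.2 (h0 0 hmem0)
  have hlow : -S ≤ Real.log ‖g 0‖ := by
    rw [Real.le_log_iff_exp_le hg0]; exact hl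
  have hup : ∀ w ∈ Metric.ball (0 : ℂ) r, Real.log ‖g w‖ ≤ S := fun w hw => by
    rw [Real.log_le_iff_le_exp (norm_pos_iff.2 (h0 w hw))]; exact hu w hw
  have hzr : z ∈ Metric.ball (0 : ℂ) r := by
    rw [mem_ball_zero_iff]; linarith
  have hBC := Complex.borelCaratheodory_zero (f := φ) (M := 2 * S) (R := r) (z := z) (by positivity)
    (fun x hx => (hφ x hx).differentiableAt.differentiableWithinAt)
    (fun w hw => by
      have := hnorm w hw
      have := hup w hw
      show (φ w).re ≤ 2 * S
      linarith) hr hzr hφ0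
  have h2 : ‖φ z‖ ≤ 4 * S := by
    refine hBC.trans ?_
    rw [div_le_iff₀ (by linarith)]
    nlinarith
  have h3 := (Complex.abs_re_le_norm (φ z)).trans h2
  rw [hnorm z hzr, abs_le] at *
  have h4 := hup 0 hmem0
  constructor <;> linarith [h3.1, h3.2]

/-- Divide out the roots in the disc of radius 1/8. A Jensen-type comparison of the unit circle with
the centre shows that there are at most 2T of them, and the cofactor g is zero-free on that disc
with size between e^(-3T) at the centre and e^(3T). The zero-free case with S = 3T accounts for 15T.
-/
theorem abs_log_norm_eval_le {F : ℂ[X]} {T : ℝ} (hT : 0 < T)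
    (hu : ∀ z ∈ Metric.closedBall (0 : ℂ) 1, ‖F.eval z‖ ≤ Real.exp T)
    (hl : Real.exp (-T) ≤ ‖F.eval 0‖) :
    ∃ s : Finset F.roots.ToType, (s.card : ℝ) ≤ 2 * T ∧ (∀ t ∈ s, ‖t.1‖ < 1 / 8) ∧
      ∀ z : ℂ, ‖z‖ ≤ 1 / 16 →
        |Real.log ‖F.eval z‖| ≤ ∑ t ∈ s, |Real.log ‖z - t.1‖| + 15 * T := by
  classical
  set s : Finset F.roots.ToType := Finset.univ.filter fun t => ‖t.1‖ < 1 / 8 with hs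
  set P : ℂ → ℂ := fun w => ∏ t ∈ s, (w - t.1) with hP
  set g : ℂ → ℂ := fun w => F.leadingCoeff * ∏ t ∈ Finset.univ.filter
    (fun t : F.roots.ToType => ¬ ‖t.1‖ < 1 / 8), (w - t.1) with hg
  have hgd : Differentiable ℂ g := by
    refine Differentiable.const_mul ?_ _
    exact Differentiable.fun_finsetProd fun t _ => differentiable_id.sub_const _
  have hF : ∀ w, F.eval w = g w * P w := by
    intro w
    rw [eval_eq_leadingCoeff_mul_prod_roots, hg, hP, mul_assoc, hs]
    congr 1
    rw [mul_comm]
    exact (Finset.prod_filter_mul_prod_filter_not _ _ _).symm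
  have hF0 : F ≠ 0 := by
    rintro rfl
    simp at hl
    exact absurd hl (not_le.2 (Real.exp_pos _))
  have hmem : ∀ t ∈ s, ‖t.1‖ < 1 / 8 := fun t ht => (Finset.mem_filter.1 ht).2
  -- bound on the unit circle
  have hgu : ∀ w ∈ Metric.closedBall (0 : ℂ) 1, ‖g w‖ ≤ Real.exp T * (8 / 7) ^ s.card := by
    intro w hw
    rw [← closure_ball (0 : ℂ) one_ne_zero] at hw
    refine Complex.norm_le_of_forall_mem_frontier_norm_le Metric.isBounded_ball
      hgd.diffContOnCl (fun z hz => ?_) hw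
    rw [frontier_ball (0 : ℂ) one_ne_zero, mem_sphere_zero_iff_norm] at hz
    have h1 : (7 / 8 : ℝ) ^ s.card ≤ ‖P z‖ := by
      rw [hP, norm_prod, ← Finset.prod_const]
      refine Finset.prod_le_prod (fun _ _ => by norm_num) fun t ht => ?_
      have := norm_sub_norm_le z t.1
      linarith [hmem t ht]
    have h2 := hu z (by simp [hz])
    rw [hF, norm_mul] at h2
    have h3 : (8 / 7 : ℝ) ^ s.card * (7 / 8) ^ s.card = 1 := by
      rw [← mul_pow]; norm_num
    have h4 : (0 : ℝ) < (8 / 7) ^ s.card := by positivity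
    calc ‖g z‖ = ‖g z‖ * (7 / 8) ^ s.card * (8 / 7) ^ s.card := by
          rw [mul_assoc, mul_comm ((7 / 8 : ℝ) ^ _), h3, mul_one]
      _ ≤ ‖g z‖ * ‖P z‖ * (8 / 7) ^ s.card := by gcongr
      _ ≤ _ := by gcongr
  have hP0 : ‖P 0‖ ≤ (1 / 8) ^ s.card := by
    rw [hP, norm_prod, ← Finset.prod_const]
    refine Finset.prod_le_prod (fun _ _ => norm_nonneg _) fun t ht => ?_
    rw [zero_sub, norm_neg]
    exact (hmem t ht).le
  -- With m roots, the centre gives e^(-T) ≤ e^T (8/7)^m (1/8)^m = e^T 7^(-m), and e ≤ 7.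
  have hcard : (s.card : ℝ) ≤ 2 * T := by
    have h1 : Real.exp (-T) ≤ Real.exp T * (8 / 7) ^ s.card * (1 / 8) ^ s.card := by
      refine hl.trans ?_
      rw [hF, norm_mul]
      exact mul_le_mul (hgu 0 (by simp)) hP0 (norm_nonneg _) (by positivity)
    rw [mul_assoc, ← mul_pow] at h1
    norm_num at h1
    have h2 : (7 : ℝ) ^ s.card ≤ Real.exp (2 * T) := by
      have h5 : (0 : ℝ) < 7 ^ s.card := by positivity
      rw [div_pow, one_pow, Real.exp_neg] at h1
      rw [two_mul, Real.exp_add]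
      have h6 := mul_le_mul_of_nonneg_left h1 (mul_pos (Real.exp_pos T) h5).le
      have h7 := Real.exp_pos T
      field_simp at h6
      nlinarith
    have h3 : Real.exp s.card ≤ (7 : ℝ) ^ s.card := by
      rw [← Real.exp_one_rpow, Real.rpow_natCast]
      gcongr
      linarith [Real.exp_one_lt_d9]
    exact Real.exp_le_exp.1 (h3.trans h2)
  have hgS : ∀ w ∈ Metric.closedBall (0 : ℂ) 1, ‖g w‖ ≤ Real.exp (3 * T) := by
    intro w hw
    refine (hgu w hw).trans ?_
    have h3 : (8 / 7 : ℝ) ^ s.card ≤ Real.exp s.card := by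
      rw [← Real.exp_one_rpow, Real.rpow_natCast]
      gcongr
      linarith [Real.exp_one_gt_d9]
    calc Real.exp T * (8 / 7) ^ s.card ≤ Real.exp T * Real.exp (2 * T) := by
          gcongr
          exact h3.trans (Real.exp_le_exp.2 hcard)
      _ = _ := by rw [← Real.exp_add]; ring_nf
  have hg0 : Real.exp (-(3 * T)) ≤ ‖g 0‖ := by
    have h1 : ‖P 0‖ ≤ 1 := hP0.trans (pow_le_one₀ (by norm_num) (by norm_num))
    rw [hF, norm_mul] at hl
    calc Real.exp (-(3 * T)) ≤ Real.exp (-T) := Real.exp_le_exp.2 (by linarith)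
      _ ≤ ‖g 0‖ * ‖P 0‖ := hl
      _ ≤ ‖g 0‖ := mul_le_of_le_one_right (norm_nonneg _) h1
  have hgne : ∀ z ∈ Metric.ball (0 : ℂ) (1 / 8), g z ≠ 0 := by
    intro z hz
    rw [mem_ball_zero_iff] at hz
    refine mul_ne_zero (by simpa using hF0) (Finset.prod_ne_zero_iff.2 fun t ht h => ?_)
    rw [sub_eq_zero] at h
    exact (Finset.mem_filter.1 ht).2 (h ▸ hz)
  refine ⟨s, hcard, hmem, fun z hz => ?_⟩
  have hlg : |Real.log ‖g z‖| ≤ 15 * T := by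
    have := abs_log_norm_le_of_ne_zero (r := 1 / 8) (S := 3 * T) (by norm_num) (by positivity) hgd
      hgne (fun w hw => hgS w (Metric.ball_subset_closedBall (Metric.ball_subset_ball
        (by norm_num) hw))) hg0 (z := z) (by linarith)
    linarith
  have hsum : 0 ≤ ∑ t ∈ s, |Real.log ‖z - t.1‖| := Finset.sum_nonneg fun _ _ => abs_nonneg _
  by_cases hz0 : F.eval z = 0
  · rw [hz0, norm_zero, Real.log_zero, abs_zero]
    positivity
  · rw [hF] at hz0 ⊢
    rw [norm_mul, Real.log_mul (norm_ne_zero_iff.2 (left_ne_zero_of_mul hz0))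
      (norm_ne_zero_iff.2 (right_ne_zero_of_mul hz0))]
    refine (abs_add_le _ _).trans ?_
    have hPl : |Real.log ‖P z‖| ≤ ∑ t ∈ s, |Real.log ‖z - t.1‖| := by
      have hne := right_ne_zero_of_mul hz0
      rw [hP] at hne ⊢
      rw [norm_prod, Real.log_prod fun t ht => norm_ne_zero_iff.2 (Finset.prod_ne_zero_iff.1 hne t ht)]
      exact Finset.abs_sum_le_sum_abs _ _
    linarith

/-- Square the pointwise bound and apply Cauchy–Schwarz over the at most 2T nearby roots. Each
translated log² is integrated over a subset of the unit disc about its singularity, hence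
contributes at most A. -/
theorem integral_sq_log_norm_eval_le_unit : ∃ B : ℝ, 0 < B ∧ ∀ (F : ℂ[X]) (T : ℝ), 1 ≤ T →
    (∀ z ∈ Metric.closedBall (0 : ℂ) 1, ‖F.eval z‖ ≤ Real.exp T) →
    Real.exp (-T) ≤ ‖F.eval 0‖ →
    IntegrableOn (fun z : ℂ => (Real.log ‖F.eval z‖) ^ 2) (Metric.ball 0 (1 / 16)) ∧
    ∫ z in Metric.ball (0 : ℂ) (1 / 16), (Real.log ‖F.eval z‖) ^ 2 ≤ B * T ^ 2 := by
  set A : ℝ := ∫ w in Metric.ball (0 : ℂ) 1, (Real.log ‖w‖) ^ 2 with hA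
  set V : ℝ := (volume : Measure ℂ).real (Metric.ball (0 : ℂ) (1 / 16)) with hV
  have hA0 : 0 ≤ A := integral_nonneg fun _ => sq_nonneg _
  have hV0 : 0 ≤ V := measureReal_nonneg
  -- Here 8 = 2·2·2 from (x + y)² ≤ 2x² + 2y² and the square of the root count 2T, and 450 = 2·15².
  refine ⟨8 * A + 450 * V + 1, by positivity, fun F T hT hu hl => ?_⟩
  obtain ⟨s, hcard, hmem, hb⟩ := abs_log_norm_eval_le (by linarith) hu hl
  have hmap (t : F.roots.ToType) (ht : t ∈ s) :
      IntegrableOn (fun z : ℂ => (Real.log ‖z - t.1‖) ^ 2) (Metric.ball 0 (1 / 16)) ∧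
      ∫ z in Metric.ball (0 : ℂ) (1 / 16), (Real.log ‖z - t.1‖) ^ 2 ≤ A := by
    have mp := measurePreserving_sub_right (volume : Measure ℂ) t.1
    have emb := (MeasurableEquiv.subRight t.1).measurableEmbedding
    have hsub : Metric.ball (0 : ℂ) (1 / 16) ⊆ (fun z => z - t.1) ⁻¹' Metric.ball (0 : ℂ) 1 := by
      intro z hz
      simp only [Set.mem_preimage, mem_ball_zero_iff] at hz ⊢
      linarith [norm_sub_le z t.1, hmem t ht]
    have h1 : IntegrableOn (fun z : ℂ => (Real.log ‖z - t.1‖) ^ 2)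
        ((fun z => z - t.1) ⁻¹' Metric.ball (0 : ℂ) 1) :=
      (mp.integrableOn_comp_preimage emb).2 (integrableOn_sq_log_norm_ball 1)
    refine ⟨h1.mono_set hsub, ?_⟩
    rw [hA, ← mp.setIntegral_preimage_emb emb (fun w => (Real.log ‖w‖) ^ 2) (Metric.ball 0 1)]
    exact setIntegral_mono_set h1 (ae_of_all _ fun _ => sq_nonneg _) hsub.eventuallyLE
  set D : ℂ → ℝ := fun z => 2 * (s.card * ∑ t ∈ s, (Real.log ‖z - t.1‖) ^ 2) + 450 * T ^ 2 with hD
  have hDi1 : IntegrableOn (fun z : ℂ => 2 * (s.card * ∑ t ∈ s, (Real.log ‖z - t.1‖) ^ 2))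
      (Metric.ball 0 (1 / 16)) :=
    ((integrable_finsetSum _ fun t ht => (hmap t ht).1).const_mul _).const_mul _
  have hDi2 : IntegrableOn (fun _ : ℂ => 450 * T ^ 2) (Metric.ball 0 (1 / 16)) :=
    integrableOn_const (by simp [Complex.volume_ball, ENNReal.mul_eq_top])
  have hDi : IntegrableOn D (Metric.ball 0 (1 / 16)) := hDi1.add hDi2
  have hle : ∀ z ∈ Metric.ball (0 : ℂ) (1 / 16), (Real.log ‖F.eval z‖) ^ 2 ≤ D z := by
    intro z hz
    have h1 := hb z (mem_ball_zero_iff.1 hz).le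
    have h2 : (∑ t ∈ s, |Real.log ‖z - t.1‖|) ^ 2 ≤
        s.card * ∑ t ∈ s, (Real.log ‖z - t.1‖) ^ 2 := by
      have := sq_sum_le_card_mul_sum_sq (s := s) (f := fun t => |Real.log ‖z - t.1‖|)
      simpa [sq_abs] using this
    have h3 : (Real.log ‖F.eval z‖) ^ 2 ≤ (∑ t ∈ s, |Real.log ‖z - t.1‖| + 15 * T) ^ 2 := by
      rw [← sq_abs]
      gcongr
    simp only [hD]
    nlinarith [sq_nonneg (∑ t ∈ s, |Real.log ‖z - t.1‖| - 15 * T)]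
  have hmeas : AEStronglyMeasurable (fun z : ℂ => (Real.log ‖F.eval z‖) ^ 2)
      (volume.restrict (Metric.ball 0 (1 / 16))) :=
    ((Real.measurable_log.comp F.continuous.measurable.norm).pow_const 2).aestronglyMeasurable
  have hint : IntegrableOn (fun z : ℂ => (Real.log ‖F.eval z‖) ^ 2) (Metric.ball 0 (1 / 16)) := by
    refine hDi.mono' hmeas ((ae_restrict_iff' measurableSet_ball).2 (ae_of_all _ fun z hz => ?_))
    rw [Real.norm_eq_abs, abs_of_nonneg (sq_nonneg _)]
    exact hle z hz
  refine ⟨hint, (setIntegral_mono_on hint hDi measurableSet_ball hle).trans ?_⟩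
  rw [integral_add hDi1 hDi2, integral_const_mul, integral_const_mul,
    integral_finsetSum _ fun t ht => (hmap t ht).1, setIntegral_const, ← hV, smul_eq_mul]
  have h5 : ∑ t ∈ s, ∫ z in Metric.ball (0 : ℂ) (1 / 16), (Real.log ‖z - t.1‖) ^ 2 ≤ s.card * A := by
    rw [← nsmul_eq_mul]
    exact Finset.sum_le_card_nsmul _ _ _ fun t ht => (hmap t ht).2
  have h6 : (s.card : ℝ) * ∑ t ∈ s, ∫ z in Metric.ball (0 : ℂ) (1 / 16), (Real.log ‖z - t.1‖) ^ 2 ≤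
      (2 * T) * ((2 * T) * A) := by
    exact mul_le_mul hcard (h5.trans (by gcongr))
      (Finset.sum_nonneg fun t _ => integral_nonneg fun z => sq_nonneg (Real.log ‖z - t.1‖))
      (by linarith)
  nlinarith [sq_nonneg T]

/-- If a polynomial is at most `e^T` on a disc of radius `R` and at least `e^{-T}` at its centre
then the square of its logarithmic modulus has integral `O(T² R²)` over a smaller disc. -/
theorem integral_sq_log_norm_eval_le : ∃ B : ℝ, 0 < B ∧ ∀ (F : ℂ[X]) (T : ℝ), 1 ≤ T →
    ∀ (c : ℂ) (R : ℝ), 0 < R → (∀ z ∈ Metric.closedBall c R, ‖F.eval z‖ ≤ Real.exp T) →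
    Real.exp (-T) ≤ ‖F.eval c‖ →
    IntegrableOn (fun z : ℂ => (Real.log ‖F.eval z‖) ^ 2) (Metric.ball c (R / 16)) ∧
    ∫ z in Metric.ball c (R / 16), (Real.log ‖F.eval z‖) ^ 2 ≤ B * T ^ 2 * R ^ 2 := by
  obtain ⟨B, hB, h⟩ := integral_sq_log_norm_eval_le_unit
  refine ⟨B, hB, fun F T hT c R hR hu hl => ?_⟩
  set F' : ℂ[X] := F.comp (Polynomial.C (R : ℂ) * Polynomial.X + Polynomial.C c) with hF'
  have he : ∀ z, F'.eval z = F.eval (R • z + c) := by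
    intro z
    simp [hF']
  obtain ⟨h1, h2⟩ := h F' T hT
    (fun z hz => by
      rw [he]
      refine hu _ ?_
      rw [mem_closedBall_zero_iff] at hz
      rw [mem_closedBall_iff_norm, add_sub_cancel_right, norm_smul, Real.norm_eq_abs, abs_of_pos hR]
      nlinarith)
    (by rw [he]; simpa using hl)
  simp only [he] at h1 h2
  have mp := measurePreserving_add_right (volume : Measure ℂ) c
  have emb := (MeasurableEquiv.addRight c).measurableEmbedding
  have hball : (fun z => z + c) ⁻¹' Metric.ball c (R / 16) = R • Metric.ball (0 : ℂ) (1 / 16) := by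
    rw [smul_ball hR.ne']
    ext z
    simp [abs_of_pos hR, div_eq_mul_inv]
  constructor
  · rw [← mp.integrableOn_comp_preimage emb, hball]
    rw [← integrable_indicator_iff (measurableSet_ball.const_smul_of_ne_zero hR.ne'),
      ← integrable_comp_smul_iff _ _ hR.ne']
    rw [← integrable_indicator_iff measurableSet_ball] at h1
    refine h1.congr (ae_of_all _ fun z => ?_)
    have hz : R • z ∈ R • Metric.ball (0 : ℂ) (1 / 16) ↔ z ∈ Metric.ball (0 : ℂ) (1 / 16) :=
      Set.smul_mem_smul_set_iff₀ hR.ne' _ _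
    by_cases hm : z ∈ Metric.ball (0 : ℂ) (1 / 16)
    · exact (Set.indicator_of_mem hm _).trans (Set.indicator_of_mem (hz.2 hm)
        ((fun z => (Real.log ‖F.eval z‖) ^ 2) ∘ fun x => x + c)).symm
    · exact (Set.indicator_of_notMem hm _).trans
        (Set.indicator_of_notMem (fun h' => hm (hz.1 h'))
        ((fun z => (Real.log ‖F.eval z‖) ^ 2) ∘ fun x => x + c)).symm
  · have e1 := Measure.setIntegral_comp_smul_of_pos (volume : Measure ℂ)
      (fun z => (Real.log ‖F.eval (z + c)‖) ^ 2) (Metric.ball (0 : ℂ) (1 / 16)) hR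
    rw [e1, Complex.finrank_real_complex, ← hball,
      mp.setIntegral_preimage_emb emb (fun z => (Real.log ‖F.eval z‖) ^ 2), smul_eq_mul] at h2
    have hR2 : 0 < R ^ 2 := by positivity
    rw [inv_mul_le_iff₀ hR2] at h2
    linarith

/-! ### Growth of polynomials off an interval -/

/-- A Bernstein–Walsh inequality by the Joukowski substitution z = (v + v⁻¹)/2. The unit circle maps
to [-1, 1], and v^n P((v + v⁻¹)/2) is a polynomial in v, so the maximum principle bounds it by M on
the unit disc. -/
theorem norm_eval_le_of_norm_eval_le_Icc_neg_one_one {P : ℂ[X]} {n : ℕ} (hn : P.natDegree ≤ n)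
    {M : ℝ} (hM : ∀ t ∈ Set.Icc (-1 : ℝ) 1, ‖P.eval (t : ℂ)‖ ≤ M) (z : ℂ) :
    ‖P.eval z‖ ≤ M * (1 + 2 * ‖z‖) ^ n := by
  set Q : ℂ[X] := ∑ j ∈ Finset.range (n + 1),
    Polynomial.C (P.coeff j / 2 ^ j) * (Polynomial.X ^ 2 + 1) ^ j * Polynomial.X ^ (n - j) with hQ
  have hM0 : 0 ≤ M := (norm_nonneg _).trans (hM 0 (by norm_num))
  have hQe : ∀ v : ℂ, v ≠ 0 → Q.eval v = v ^ n * P.eval ((v + v⁻¹) / 2) := by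
    intro v hv
    rw [hQ, Polynomial.eval_finsetSum, Polynomial.eval_eq_sum_range' (Nat.lt_succ_of_le hn),
      Finset.mul_sum]
    refine Finset.sum_congr rfl fun j hj => ?_
    have hj' : j ≤ n := Nat.lt_succ_iff.1 (Finset.mem_range.1 hj)
    have h1 : (v + v⁻¹) / 2 = (v ^ 2 + 1) / (v * 2) := by field_simp
    have h2 : v ^ n = v ^ (n - j) * v ^ j := by rw [← pow_add, Nat.sub_add_cancel hj']
    simp only [Polynomial.eval_mul, Polynomial.eval_C, Polynomial.eval_pow, Polynomial.eval_add,
      Polynomial.eval_X, Polynomial.eval_one]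
    rw [h1, h2, div_pow, mul_pow]
    field_simp
  have hQb : ∀ v ∈ Metric.closedBall (0 : ℂ) 1, ‖Q.eval v‖ ≤ M := by
    intro v hv
    rw [← closure_ball (0 : ℂ) one_ne_zero] at hv
    refine Complex.norm_le_of_forall_mem_frontier_norm_le Metric.isBounded_ball
      (Q.differentiable.diffContOnCl) (fun u hu => ?_) hv
    rw [frontier_ball (0 : ℂ) one_ne_zero, mem_sphere_zero_iff_norm] at hu
    have hu0 : u ≠ 0 := by rintro rfl; simp at hu
    have hre : (u + u⁻¹) / 2 = (u.re : ℂ) := by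
      rw [Complex.inv_def, Complex.normSq_eq_norm_sq, hu]
      simp [Complex.add_conj]
    rw [hQe u hu0, norm_mul, norm_pow, hu, one_pow, one_mul, hre]
    exact hM _ (abs_le.1 ((Complex.abs_re_le_norm u).trans hu.le))
  obtain ⟨s, hs⟩ := IsAlgClosed.exists_pow_nat_eq (z ^ 2 - 1) (n := 2) (by norm_num)
  -- The two preimages z ± √(z² - 1) of z have product 1, so one of them lies in the closed unit
  -- disc. Its inverse is 2z - v, which is what bounds |v|⁻¹ by 1 + 2|z|.
  obtain ⟨v, hv, hv1⟩ : ∃ v : ℂ, v * (2 * z - v) = 1 ∧ ‖v‖ ≤ 1 := by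
    by_cases h : ‖z + s‖ ≤ 1
    · exact ⟨z + s, by linear_combination -hs, h⟩
    · refine ⟨z - s, by linear_combination -hs, ?_⟩
      have h1 : (z + s) * (z - s) = 1 := by linear_combination -hs
      have h2 := congrArg norm h1
      rw [norm_mul, norm_one] at h2
      by_contra h3
      push Not at h h3
      nlinarith
  have hv0 : v ≠ 0 := left_ne_zero_of_mul_eq_one hv
  have hvi : v⁻¹ = 2 * z - v := inv_eq_of_mul_eq_one_right hv
  have hz : (v + v⁻¹) / 2 = z := by rw [hvi]; ring
  have h1 := hQb v (by simpa using hv1)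
  rw [hQe v hv0, hz, norm_mul, norm_pow] at h1
  have h2 : ‖v‖⁻¹ ≤ 1 + 2 * ‖z‖ := by
    rw [← norm_inv, hvi]
    refine (norm_sub_le _ _).trans ?_
    rw [norm_mul, RCLike.norm_ofNat]
    linarith
  have hvp : 0 < ‖v‖ := norm_pos_iff.2 hv0
  calc ‖P.eval z‖ = ‖v‖ ^ n * ‖P.eval z‖ * ‖v‖⁻¹ ^ n := by
        rw [inv_pow]; field_simp
    _ ≤ M * (1 + 2 * ‖z‖) ^ n := by gcongr

theorem norm_eval_le_of_norm_eval_le_Icc {P : ℂ[X]} {n : ℕ} (hn : P.natDegree ≤ n)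
    {M x d : ℝ} (hd : 0 < d) (hM : ∀ t ∈ Set.Icc (x - d) (x + d), ‖P.eval (t : ℂ)‖ ≤ M)
    (w : ℂ) : ‖P.eval w‖ ≤ M * (1 + 2 * (‖w - x‖ / d)) ^ n := by
  set P' : ℂ[X] := P.comp (Polynomial.C (d : ℂ) * Polynomial.X + Polynomial.C (x : ℂ)) with hP'
  have hdeg : P'.natDegree ≤ n := by
    refine Polynomial.natDegree_comp_le.trans ?_
    have : (Polynomial.C (d : ℂ) * Polynomial.X + Polynomial.C (x : ℂ)).natDegree ≤ 1 :=
      Polynomial.natDegree_linear_le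
    nlinarith
  have he : ∀ z, P'.eval z = P.eval (d * z + x) := fun z => by simp [hP']
  have h1 := norm_eval_le_of_norm_eval_le_Icc_neg_one_one hdeg (M := M) (fun t ht => by
    rw [he]
    have := hM (d * t + x) ⟨by nlinarith [ht.1], by nlinarith [ht.2]⟩
    simpa using this) ((w - x) / d)
  rw [he] at h1
  have hd' : (d : ℂ) ≠ 0 := by exact_mod_cast hd.ne'
  have h2 : (d : ℂ) * ((w - x) / d) + x = w := by field_simp; ring
  rw [h2, norm_div, Complex.norm_real, Real.norm_eq_abs, abs_of_pos hd] at h1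
  exact h1

/-- At distance O(1/n) from the interval the growth factor (1 + 2R/n)^n is bounded independently of
n. This is what makes 1/n the natural scale. -/
theorem norm_eval_le_exp {P : ℂ[X]} {n : ℕ} (hn : P.natDegree ≤ n) (hn0 : 0 < n)
    {M x d R : ℝ} (hd : 0 < d) (hM : ∀ t ∈ Set.Icc (x - d) (x + d), ‖P.eval (t : ℂ)‖ ≤ M)
    {w : ℂ} (hw : ‖w - x‖ ≤ R * d / n) : ‖P.eval w‖ ≤ M * Real.exp (2 * R) := by
  have hM0 : 0 ≤ M := (norm_nonneg _).trans (hM x ⟨by linarith, by linarith⟩)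
  have hn' : (0 : ℝ) < n := by exact_mod_cast hn0
  refine (norm_eval_le_of_norm_eval_le_Icc hn hd hM w).trans ?_
  have h1 : 2 * (‖w - x‖ / d) ≤ 2 * R / n := by
    rw [le_div_iff₀ hn'] at hw ⊢
    have : ‖w - x‖ / d * n ≤ R := by
      rw [div_mul_eq_mul_div, div_le_iff₀ hd]; exact hw
    linarith
  have h2 : (1 + 2 * (‖w - x‖ / d)) ^ n ≤ Real.exp (2 * R) := by
    calc (1 + 2 * (‖w - x‖ / d)) ^ n ≤ Real.exp (2 * R / n) ^ n := by
          have h0 : 0 ≤ ‖w - x‖ / d := by positivity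
          refine pow_le_pow_left₀ (by positivity) ?_ n
          linarith [Real.add_one_le_exp (2 * R / n)]
      _ = Real.exp (2 * R) := by
          rw [← Real.exp_nat_mul]
          congr 1
          field_simp
  gcongr

/-- The Schwarz lemma on the disc of radius d/n, where P is at most e²M ≤ 8M; the oscillation from
P(x) is then at most 9M, rounded up to 10M. -/
theorem norm_eval_sub_eval_le {P : ℂ[X]} {n : ℕ} (hn : P.natDegree ≤ n) (hn0 : 0 < n)
    {M x d : ℝ} (hM0 : 0 < M) (hd : 0 < d)
    (hM : ∀ t ∈ Set.Icc (x - d) (x + d), ‖P.eval (t : ℂ)‖ ≤ M)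
    {w : ℂ} (hw : ‖w - x‖ < d / n) : ‖P.eval w - P.eval (x : ℂ)‖ ≤ 10 * M * n / d * ‖w - x‖ := by
  have hn' : (0 : ℝ) < n := by exact_mod_cast hn0
  have hx := hM x ⟨by linarith, by linarith⟩
  have hexp : Real.exp (2 * 1) ≤ 8 := by
    have := Real.exp_one_lt_d9
    rw [two_mul, Real.exp_add]
    nlinarith [Real.exp_pos 1]
  have h := Complex.dist_le_div_mul_dist_of_mapsTo_ball (f := fun z => P.eval z) (c := (x : ℂ))
    (z := w) (R₁ := d / n) (R₂ := 10 * M) P.differentiable.differentiableOn (fun z hz => by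
      rw [mem_ball_iff_norm] at hz
      have h1 := norm_eval_le_exp (R := 1) hn hn0 hd hM (w := z) (by simpa using hz.le)
      rw [Metric.mem_closedBall, dist_eq_norm]
      refine (norm_sub_le _ _).trans ?_
      nlinarith) (by rwa [mem_ball_iff_norm])
  rw [dist_eq_norm, dist_eq_norm] at h
  refine h.trans (le_of_eq ?_)
  field_simp

/-! ### Orthonormal expansions -/

theorem IsOrthonormalPolynomials.exists_expansion {μ : Measure ℝ} {p : ℕ → ℝ[X]}
    (h : IsOrthonormalPolynomials μ p) (n : ℕ) (q : ℝ[X]) (hq : q.degree < n) :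
    ∃ b : ℕ → ℝ, q = ∑ j ∈ Finset.range n, Polynomial.C (b j) * p j := by
  induction n generalizing q with
  | zero =>
    refine ⟨0, ?_⟩
    simpa using hq
  | succ n ih =>
    have hlead : (p n).coeff n ≠ 0 := Polynomial.coeff_ne_zero_of_eq_degree (h.degree_eq n)
    set c := q.coeff n / (p n).coeff n with hc
    have hdeg : (q - Polynomial.C c * p n).degree < n := by
      rw [Polynomial.degree_lt_iff_coeff_zero]
      intro m hm
      rw [Polynomial.coeff_sub, Polynomial.coeff_C_mul]
      rcases hm.eq_or_lt with rfl | hm'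
      · rw [hc]; field_simp; simp
      · have h1 : q.coeff m = 0 := Polynomial.coeff_eq_zero_of_degree_lt
          (hq.trans_le (by exact_mod_cast hm'))
        have h2 : (p n).coeff m = 0 := Polynomial.coeff_eq_zero_of_degree_lt
          (by rw [h.degree_eq]; exact_mod_cast hm')
        rw [h1, h2]; simp
    obtain ⟨b, hb⟩ := ih _ hdeg
    refine ⟨fun j => if j = n then c else b j, ?_⟩
    rw [Finset.sum_range_succ]
    have : ∑ j ∈ Finset.range n, Polynomial.C (if j = n then c else b j) * p j =
        ∑ j ∈ Finset.range n, Polynomial.C (b j) * p j :=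
      Finset.sum_congr rfl fun j hj => by rw [if_neg (Finset.mem_range.1 hj).ne]
    rw [this, ← hb]
    simp

namespace IsAdmissibleMeasure

variable {K : Set ℝ} {μ : Measure ℝ} {w : ℝ → ℝ} {p : ℕ → ℝ[X]}

theorem exists_subset_closedBall (h : IsAdmissibleMeasure K μ w p) :
    ∃ D : ℝ, 0 < D ∧ ∀ t ∈ K, |t| ≤ D := by
  obtain ⟨s, hs⟩ := h.finite_union
  have : IsCompact K := by
    rw [hs]
    exact s.isCompact_biUnion fun _ _ => isCompact_Icc
  obtain ⟨D, hD⟩ := this.isBounded.exists_norm_le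
  exact ⟨max D 1, by positivity, fun t ht => (hD t ht).trans (le_max_left _ _)⟩

theorem ae_mem (h : IsAdmissibleMeasure K μ w p) : ∀ᵐ t ∂μ, t ∈ K :=
  mem_ae_iff.2 h.supported

theorem integrable_of_continuous (h : IsAdmissibleMeasure K μ w p) {E : Type*}
    [NormedAddCommGroup E] [SecondCountableTopology E] {f : ℝ → E}
    (hf : Continuous f) : Integrable f μ := by
  have := h.finite_measure
  obtain ⟨D, -, hD⟩ := h.exists_subset_closedBall
  obtain ⟨B, hB⟩ := (isCompact_Icc (a := -D) (b := D)).exists_bound_of_continuousOn hf.continuousOn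
  refine Integrable.of_bound hf.aestronglyMeasurable B ?_
  filter_upwards [h.ae_mem] with t ht
  exact hB t (abs_le.1 (hD t ht))

theorem integral_sum_mul {𝕜 : Type*} [RCLike 𝕜] (h : IsAdmissibleMeasure K μ w p) (s : Finset ℕ)
    (c : ℕ → 𝕜) (i : ℕ) :
    ∫ t, (∑ j ∈ s, c j * ((p j).eval t : ℝ)) * ((p i).eval t : ℝ) ∂μ =
      if i ∈ s then c i else 0 := by
  have h1 (j : ℕ) : ∫ t, c j * (((p j).eval t : ℝ) : 𝕜) * ((p i).eval t : ℝ) ∂μ =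
      if j = i then c j else 0 := by
    have : ∀ t, c j * (((p j).eval t : ℝ) : 𝕜) * ((p i).eval t : ℝ) =
        c j * (((p j).eval t * (p i).eval t : ℝ) : 𝕜) := fun t => by push_cast; ring
    simp only [this]
    rw [integral_const_mul, integral_ofReal, h.orthonormal_polynomials.orthonormal]
    split_ifs <;> simp
  simp only [Finset.sum_mul]
  rw [integral_finsetSum]
  · simp [h1]
  · intro j _
    refine h.integrable_of_continuous ?_
    exact (continuous_const.mul (RCLike.continuous_ofReal.comp (p j).continuous)).mul
      (RCLike.continuous_ofReal.comp (p i).continuous)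

/-- Cauchy–Schwarz for the orthonormal expansion of q. This is half of the extremal characterization
of the Christoffel function, and any test polynomial q turns it into a lower bound for the kernel on
the diagonal. -/
theorem sq_eval_le (h : IsAdmissibleMeasure K μ w p) {n : ℕ} {q : ℝ[X]} (hq : q.degree < n)
    (x : ℝ) : (q.eval x) ^ 2 ≤
      (∫ t, (q.eval t) ^ 2 ∂μ) * ∑ j ∈ Finset.range n, ((p j).eval x) ^ 2 := by
  obtain ⟨b, hb⟩ := h.orthonormal_polynomials.exists_expansion n q hq
  have he (t : ℝ) : q.eval t = ∑ j ∈ Finset.range n, b j * (p j).eval t := by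
    conv_lhs => rw [hb]
    simp [Polynomial.eval_finsetSum]
  have h1 : ∫ t, (q.eval t) ^ 2 ∂μ = ∑ j ∈ Finset.range n, (b j) ^ 2 := by
    have h2 : ∀ t, (q.eval t) ^ 2 = ∑ i ∈ Finset.range n,
        b i * ((∑ j ∈ Finset.range n, b j * (p j).eval t) * (p i).eval t) := by
      intro t
      rw [he, sq]
      conv_lhs => rw [Finset.mul_sum]
      exact Finset.sum_congr rfl fun i _ => by ring
    simp only [h2]
    rw [integral_finsetSum]
    · refine Finset.sum_congr rfl fun i hi => ?_
      have h3 := h.integral_sum_mul (𝕜 := ℝ) (Finset.range n) b i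
      simp only [RCLike.ofReal_real_eq_id, id] at h3
      rw [integral_const_mul, h3, if_pos hi, sq]
    · intro i _
      refine h.integrable_of_continuous ?_
      fun_prop
  rw [h1, he]
  exact Finset.sum_mul_sq_le_sq_mul_sq _ _ _

end IsAdmissibleMeasure

/-! ### Lower bound for the Christoffel–Darboux kernel on the diagonal -/

/-- An even polynomial of degree at most `n` with value `±1` at the origin which is
concentrated at scale `1/n`. -/
theorem exists_peak_polynomial (n : ℕ) :
    ∃ q : ℝ[X], q.natDegree ≤ n ∧ |q.eval 0| = 1 ∧ ∀ s : ℝ, |s| ≤ 1 →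
      |q.eval s| ≤ 2 ∧ |q.eval s| * (n * |s|) ≤ 1 := by
  obtain ⟨m, hm⟩ : ∃ m : ℕ, n = 2 * m + 1 ∨ n = 2 * m := by
    rcases Nat.even_or_odd' n with ⟨m, h | h⟩
    · exact ⟨m, Or.inr h⟩
    · exact ⟨m, Or.inl h⟩
  -- The polynomial will be T_N(s)/(Ns) with N the odd number among n and n + 1. Oddness makes T_N
  -- divisible by s, and the quotient has degree N - 1 ≤ n.
  set N : ℕ := 2 * m + 1 with hN
  have hnN : (n : ℝ) ≤ N := by exact_mod_cast (by omega : n ≤ N)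
  have hNpos : (0 : ℝ) < N := by positivity
  have hodd : Odd (N : ℤ) := ⟨m, by push_cast [hN]; ring⟩
  obtain ⟨r, hr⟩ : (Polynomial.X - Polynomial.C 0 : ℝ[X]) ∣ Polynomial.Chebyshev.T ℝ N := by
    rw [Polynomial.dvd_iff_isRoot, Polynomial.IsRoot]
    exact Polynomial.Chebyshev.T_eval_zero_of_odd ℝ hodd
  rw [Polynomial.C_0, sub_zero] at hr
  have hr0 : r ≠ 0 := by
    rintro rfl
    rw [mul_zero] at hr
    exact Polynomial.Chebyshev.T_ne_zero ℝ N hr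
  have heval : ∀ s : ℝ, (Polynomial.Chebyshev.T ℝ N).eval s = s * r.eval s := fun s => by
    rw [hr]; simp
  have hT1 : ∀ s : ℝ, |s| ≤ 1 → |s * r.eval s| ≤ 1 := fun s hs => by
    rw [← heval]; exact Polynomial.Chebyshev.abs_eval_T_real_le_one N hs
  -- Differentiating T_N = s·r at 0 gives r(0) = T_N'(0) = N U_(N-1)(0) = ±N.
  have hr0eval : |r.eval 0| = N := by
    have h1 := congrArg (fun f : ℝ[X] => (Polynomial.derivative f).eval 0) hr
    simp only [Polynomial.Chebyshev.T_derivative_eq_U, Polynomial.derivative_mul,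
      Polynomial.derivative_X, one_mul, Polynomial.eval_add, Polynomial.eval_mul,
      Polynomial.eval_X, zero_mul, add_zero] at h1
    have hev : Even ((N : ℤ) - 1) := ⟨m, by push_cast [hN]; ring⟩
    rw [Polynomial.Chebyshev.U_eval_zero_of_even ℝ hev] at h1
    rw [← h1]
    rcases Int.units_eq_one_or (Int.negOnePow (((N : ℤ) - 1) / 2)) with h | h <;> simp [h]
  refine ⟨Polynomial.C ((N : ℝ)⁻¹) * r, ?_, ?_, fun s hs => ⟨?_, ?_⟩⟩
  · refine (Polynomial.natDegree_C_mul_le _ _).trans ?_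
    have h1 := congrArg Polynomial.natDegree hr
    rw [Polynomial.Chebyshev.natDegree_T, Polynomial.natDegree_X_mul hr0] at h1
    simp only [Int.natAbs_natCast] at h1
    omega
  · rw [Polynomial.eval_mul, Polynomial.eval_C, abs_mul, hr0eval, abs_of_pos (by positivity)]
    exact inv_mul_cancel₀ hNpos.ne'
  · rw [Polynomial.eval_mul, Polynomial.eval_C, abs_mul, abs_of_pos (by positivity),
      inv_mul_le_iff₀ hNpos]
    by_cases hs0 : s = 0
    · rw [hs0, hr0eval]; linarith
    -- Because N is odd, |T_N(s)| = |sin(N arcsin s)|. With |arcsin s| ≤ 2|s| this gives |T_N(s)| ≤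
    -- 2N|s|.
    have h1 : |s * r.eval s| ≤ N * |Real.arcsin s| := by
      rw [← heval]
      have hcos : s = Real.cos (Real.pi / 2 - Real.arcsin s) := by
        rw [Real.cos_pi_div_two_sub, Real.sin_arcsin (abs_le.1 hs).1 (abs_le.1 hs).2]
      have h2 : (Polynomial.Chebyshev.T ℝ N).eval s =
          Real.cos (N * (Real.pi / 2 - Real.arcsin s)) := by
        conv_lhs => rw [hcos]
        rw [Polynomial.Chebyshev.T_real_cos]
        push_cast
        rfl
      have h3 : N * (Real.pi / 2 - Real.arcsin s) = (Real.pi / 2 - N * Real.arcsin s) + m * Real.pi := by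
        push_cast [hN]; ring
      rw [h2, h3, Real.cos_add_nat_mul_pi, Real.cos_pi_div_two_sub, abs_mul, abs_pow, abs_neg,
        abs_one, one_pow, one_mul]
      refine Real.abs_sin_le_abs.trans ?_
      rw [abs_mul, abs_of_pos hNpos]
    have h2 : |Real.arcsin s| ≤ 2 * |s| := by
      have hpi := Real.pi_lt_four
      have hpi0 := Real.pi_pos
      rcases le_total 0 s with h | h
      · have h0 := Real.arcsin_nonneg.2 h
        have := Real.mul_le_sin h0 (Real.arcsin_le_pi_div_two s)
        rw [Real.sin_arcsin (abs_le.1 hs).1 (abs_le.1 hs).2] at this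
        rw [abs_of_nonneg h0, abs_of_nonneg h]
        rw [div_mul_eq_mul_div, div_le_iff₀ hpi0] at this
        nlinarith
      · have h0 := Real.arcsin_nonneg.2 (neg_nonneg.2 h)
        have := Real.mul_le_sin h0 (Real.arcsin_le_pi_div_two _)
        rw [Real.sin_arcsin (by linarith [(abs_le.1 hs).2]) (by linarith [(abs_le.1 hs).1])] at this
        rw [Real.arcsin_neg] at this h0
        rw [abs_of_nonpos (by linarith), abs_of_nonpos h]
        rw [div_mul_eq_mul_div, div_le_iff₀ hpi0] at this
        nlinarith
    have hspos : 0 < |s| := abs_pos.2 hs0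
    rw [abs_mul] at h1
    have h3 : |s| * |r.eval s| ≤ |s| * (N * 2) := by
      calc _ ≤ _ := h1
        _ ≤ N * (2 * |s|) := by gcongr
        _ = _ := by ring
    exact le_of_mul_le_mul_left h3 hspos
  · rw [Polynomial.eval_mul, Polynomial.eval_C, abs_mul, abs_of_pos (by positivity)]
    have h1 := hT1 s hs
    rw [abs_mul] at h1
    calc (N : ℝ)⁻¹ * |r.eval s| * (n * |s|) ≤ (N : ℝ)⁻¹ * |r.eval s| * (N * |s|) := by gcongr
      _ = |s| * |r.eval s| := by field_simp
      _ ≤ 1 := h1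

namespace IsAdmissibleMeasure

variable {K : Set ℝ} {μ : Measure ℝ} {w : ℝ → ℝ} {p : ℕ → ℝ[X]}

theorem restrict_le (h : IsAdmissibleMeasure K μ w p) {C : ℝ} {J : Set ℝ} (hJ : MeasurableSet J)
    (hC : ∀ᵐ x ∂(volume.restrict J), w x ≤ C) :
    μ.restrict J ≤ ENNReal.ofReal C • (volume : Measure ℝ) := by
  rw [h.eq_withDensity, restrict_withDensity hJ]
  calc (volume.restrict J).withDensity (fun x => ENNReal.ofReal (w x))
      ≤ (volume.restrict J).withDensity (fun _ => ENNReal.ofReal C) :=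
        withDensity_mono (hC.mono fun x hx => ENNReal.ofReal_le_ofReal hx)
    _ = ENNReal.ofReal C • volume.restrict J := withDensity_const _
    _ ≤ ENNReal.ofReal C • (volume : Measure ℝ) := by
        gcongr
        exact Measure.restrict_le_self

/-- Near x the density is at most C and the squared peak is below a Cauchy profile of width D/n,
whose integral is O(1/n). Away from x the peak is at most D/(nd), and its square is integrated
against the finite total mass. -/
theorem integral_peak_le (h : IsAdmissibleMeasure K μ w p) {D d C x : ℝ} (hD : 0 < D)
    (hDK : ∀ t ∈ K, |t - x| ≤ D) (hd : 0 < d) (hC : 0 < C)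
    (hwC : ∀ᵐ t ∂(volume.restrict (Set.Icc (x - d) (x + d))), w t ≤ C)
    {n : ℕ} (hn : 0 < n) {q : ℝ[X]} (hq : ∀ s : ℝ, |s| ≤ 1 →
      |q.eval s| ≤ 2 ∧ |q.eval s| * (n * |s|) ≤ 1) :
    ∫ t, (q.eval ((t - x) / D)) ^ 2 ∂μ ≤
      (C * (5 * Real.pi * D) + D ^ 2 / d ^ 2 * μ.real Set.univ) / n := by
  have := h.finite_measure
  have hn' : (0 : ℝ) < n := by exact_mod_cast hn
  have hn1 : (1 : ℝ) ≤ n := by exact_mod_cast hn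
  set J := Set.Icc (x - d) (x + d) with hJ
  have hcont : Continuous fun t => (q.eval ((t - x) / D)) ^ 2 := by fun_prop
  have hint := h.integrable_of_continuous hcont
  -- The factor 5 is 4 + 1, from |q|² ≤ 4 and (|q| n|s|)² ≤ 1.
  set b : ℝ → ℝ := fun t => 5 * (1 + ((n / D) * (t - x)) ^ 2)⁻¹ with hb
  have hbint0 : Integrable fun u : ℝ => (1 + u ^ 2)⁻¹ := integrable_inv_one_add_sq
  have hnD : (n : ℝ) / D ≠ 0 := by positivity
  have hbint : Integrable b := ((hbint0.comp_mul_left' hnD).comp_sub_right x).const_mul 5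
  have hbval : ∫ t, b t = 5 * Real.pi * D / n := by
    rw [hb, integral_const_mul, integral_sub_right_eq_self (fun t => (1 + (n / D * t) ^ 2)⁻¹) x,
      Measure.integral_comp_mul_left (fun u => (1 + u ^ 2)⁻¹), integral_univ_inv_one_add_sq,
      abs_of_pos (by positivity), smul_eq_mul]
    field_simp
  have hs : ∀ t ∈ K, |(t - x) / D| ≤ 1 := fun t ht => by
    rw [abs_div, abs_of_pos hD, div_le_one hD]; exact hDK t ht
  have hqb : ∀ t ∈ K, (q.eval ((t - x) / D)) ^ 2 ≤ b t := by
    intro t ht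
    obtain ⟨h1, h2⟩ := hq _ (hs t ht)
    have h3 : n / D * (t - x) = n * ((t - x) / D) := by ring
    rw [hb]
    simp only
    rw [h3, ← div_eq_mul_inv, le_div_iff₀ (by positivity)]
    set u := (t - x) / D
    rw [← sq_abs (q.eval u), mul_pow, ← sq_abs u]
    have h4 : 0 ≤ |q.eval u| * (n * |u|) := by positivity
    nlinarith [abs_nonneg (q.eval u), abs_nonneg u]
  rw [← integral_add_compl (measurableSet_Icc : MeasurableSet J) hint, add_div]
  refine add_le_add ?_ ?_
  · have hbint' : Integrable b (ENNReal.ofReal C • (volume : Measure ℝ)) :=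
      hbint.smul_measure ENNReal.ofReal_ne_top
    have hb0 : ∀ t, 0 ≤ b t := fun t => by positivity
    calc ∫ t in J, (q.eval ((t - x) / D)) ^ 2 ∂μ ≤ ∫ t in J, b t ∂μ := by
          refine integral_mono_ae hint.integrableOn
            (hbint'.mono_measure (h.restrict_le measurableSet_Icc hwC)) ?_
          exact ae_restrict_of_ae (h.ae_mem.mono hqb)
      _ ≤ ∫ t, b t ∂(ENNReal.ofReal C • (volume : Measure ℝ)) :=
          integral_mono_measure (h.restrict_le measurableSet_Icc hwC) (ae_of_all _ hb0) hbint'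
      _ = C * (5 * Real.pi * D) / n := by
          rw [integral_smul_measure, hbval, ENNReal.toReal_ofReal hC.le, smul_eq_mul]
          ring
  · have hle : ∀ᵐ t ∂(μ.restrict Jᶜ), (q.eval ((t - x) / D)) ^ 2 ≤ D ^ 2 / d ^ 2 / n := by
      filter_upwards [ae_restrict_of_ae h.ae_mem, ae_restrict_mem measurableSet_Icc.compl]
        with t ht htJ
      obtain ⟨-, h2⟩ := hq _ (hs t ht)
      have h3 : d ≤ |t - x| := by
        by_contra hc
        push Not at hc
        rw [abs_lt] at hc
        exact htJ ⟨by linarith [hc.1], by linarith [hc.2]⟩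
      rw [abs_div, abs_of_pos hD] at h2
      set y := |q.eval ((t - x) / D)| with hy
      have hy0 : 0 ≤ y := abs_nonneg _
      have h4 : y * (n * d) ≤ D := by
        calc y * (n * d) ≤ y * (n * |t - x|) := by gcongr
          _ = y * (n * (|t - x| / D)) * D := by field_simp
          _ ≤ 1 * D := by gcongr
          _ = D := one_mul D
      rw [← sq_abs, ← hy, div_div, le_div_iff₀ (by positivity)]
      have h5 : 0 ≤ y * (n * d) := by positivity
      have h6 : (y * (n * d)) ^ 2 ≤ D ^ 2 := by gcongr
      have h7 : y ^ 2 * (d ^ 2 * n) ≤ (y * (n * d)) ^ 2 := by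
        have : (n : ℝ) ≤ n ^ 2 := by nlinarith
        calc y ^ 2 * (d ^ 2 * n) ≤ y ^ 2 * (d ^ 2 * n ^ 2) := by gcongr
          _ = _ := by ring
      linarith
    calc ∫ t in Jᶜ, (q.eval ((t - x) / D)) ^ 2 ∂μ ≤ ∫ _ in Jᶜ, D ^ 2 / d ^ 2 / n ∂μ :=
          integral_mono_ae hint.integrableOn (integrable_const _) hle
      _ = D ^ 2 / d ^ 2 / n * μ.real Jᶜ := by
          rw [setIntegral_const, smul_eq_mul, mul_comm]
      _ ≤ D ^ 2 / d ^ 2 / n * μ.real Set.univ :=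
          mul_le_mul_of_nonneg_left (measureReal_mono (Set.subset_univ _)) (by positivity)
      _ = _ := by ring

/-- The peak polynomial centred at x has modulus 1 there and squared L²(μ) norm O(1/n); the extremal
inequality converts this into a kernel of order at least n. -/
theorem sum_sq_eval_ge (h : IsAdmissibleMeasure K μ w p) {D d C x : ℝ} (hD : 0 < D)
    (hDK : ∀ t ∈ K, |t - x| ≤ D) (hd : 0 < d) (hC : 0 < C)
    (hwC : ∀ᵐ t ∂(volume.restrict (Set.Icc (x - d) (x + d))), w t ≤ C)
    {n : ℕ} (hn : 0 < n) :
    (n : ℝ) ≤ (C * (5 * Real.pi * D) + D ^ 2 / d ^ 2 * μ.real Set.univ) *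
      ∑ j ∈ Finset.range (n + 1), ((p j).eval x) ^ 2 := by
  obtain ⟨q, hqd, hq0, hq⟩ := exists_peak_polynomial n
  have hn' : (0 : ℝ) < n := by exact_mod_cast hn
  set q' : ℝ[X] := q.comp (Polynomial.C D⁻¹ * Polynomial.X + Polynomial.C (-(x / D))) with hq'
  have he : ∀ t, q'.eval t = q.eval ((t - x) / D) := fun t => by
    simp [hq']; congr 1; ring
  have hdeg : q'.degree < (n + 1 : ℕ) := by
    have h1 : q'.natDegree ≤ n := by
      refine Polynomial.natDegree_comp_le.trans ?_
      have : (Polynomial.C D⁻¹ * Polynomial.X + Polynomial.C (-(x / D))).natDegree ≤ 1 :=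
        Polynomial.natDegree_linear_le
      nlinarith
    exact Polynomial.degree_le_natDegree.trans_lt (by exact_mod_cast Nat.lt_succ_of_le h1)
  have h1 := h.sq_eval_le hdeg x
  have h2 := h.integral_peak_le hD hDK hd hC hwC hn hq
  simp only [he] at h1
  rw [sub_self, zero_div, ← sq_abs, hq0, one_pow] at h1
  have hS : 0 ≤ ∑ j ∈ Finset.range (n + 1), ((p j).eval x) ^ 2 :=
    Finset.sum_nonneg fun _ _ => sq_nonneg _
  have h3 := h1.trans (mul_le_mul_of_nonneg_right h2 hS)
  rw [div_mul_eq_mul_div, le_div_iff₀ hn', one_mul] at h3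
  exact h3

/-! ### Recovering coefficients from values -/

/-- Lagrange interpolation at M equally spaced nodes bounds the polynomial on all of K: each basis
polynomial is at most (D/ρ)^M. The coefficients are then recovered as integrals against the p_i. -/
theorem norm_coeff_le_of_norm_sum_le (h : IsAdmissibleMeasure K μ w p) {D η ρ x : ℝ} (hρ : 0 < ρ)
    {M : ℕ} (hDK : ∀ t ∈ K, ∀ l < M, |t - (x + l * ρ)| ≤ D) (hDρ : ρ ≤ D) (c : ℕ → ℂ)
    (hη : ∀ l < M, ‖∑ j ∈ Finset.range M, c j * ((p j).eval (x + l * ρ) : ℝ)‖ ≤ η)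
    {i : ℕ} (hi : i < M) : ‖c i‖ ≤ M * η * (D / ρ) ^ M * (μ.real Set.univ + 1) := by
  classical
  have := h.finite_measure
  have hη0 : 0 ≤ η := (norm_nonneg _).trans (hη i hi)
  have hr1 : 1 ≤ D / ρ := (one_le_div hρ).2 hDρ
  set f : ℂ[X] := ∑ j ∈ Finset.range M, Polynomial.C (c j) * (p j).map (algebraMap ℝ ℂ) with hf
  have hfe : ∀ t : ℝ, f.eval (t : ℂ) = ∑ j ∈ Finset.range M, c j * ((p j).eval t : ℝ) := by
    intro t
    rw [hf, Polynomial.eval_finsetSum]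
    refine Finset.sum_congr rfl fun j _ => ?_
    rw [Polynomial.eval_mul, Polynomial.eval_C]
    congr 1
    exact Polynomial.eval_map_algebraMap (p j) _ |>.trans (Polynomial.aeval_ofReal _ _)
  set v : ℕ → ℂ := fun l => ((x + l * ρ : ℝ) : ℂ) with hv
  have hvinj : Set.InjOn v (Finset.range M : Set ℕ) := by
    intro l _ m _ hlm
    simp only [hv, Complex.ofReal_inj, add_right_inj] at hlm
    exact_mod_cast mul_right_cancel₀ hρ.ne' hlm
  have hfd : f.degree < (Finset.range M).card := by
    rw [Finset.card_range, ← Polynomial.mem_degreeLT]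
    refine Submodule.sum_mem _ fun j hj => Polynomial.mem_degreeLT.2 ?_
    refine (Polynomial.degree_mul_le _ _).trans_lt ?_
    have h1 : ((p j).map (algebraMap ℝ ℂ)).degree = j := by
      rw [Polynomial.degree_map, h.orthonormal_polynomials.degree_eq]
    have h2 : (Polynomial.C (c j)).degree ≤ 0 := Polynomial.degree_C_le
    rw [h1]
    refine (add_le_add_left h2 _).trans_lt ?_
    rw [zero_add]
    exact_mod_cast Finset.mem_range.1 hj
  have hfb : ∀ t ∈ K, ‖f.eval (t : ℂ)‖ ≤ M * η * (D / ρ) ^ M := by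
    intro t ht
    rw [Lagrange.eq_interpolate hvinj hfd, Lagrange.interpolate_apply, Polynomial.eval_finsetSum]
    refine (norm_sum_le _ _).trans ((Finset.sum_le_card_nsmul _ _ (η * (D / ρ) ^ M) ?_).trans ?_)
    · intro l hl
      rw [Polynomial.eval_mul, Polynomial.eval_C, norm_mul]
      have h1 : ‖f.eval (v l)‖ ≤ η := by
        rw [hv, hfe]
        exact hη l (Finset.mem_range.1 hl)
      refine mul_le_mul h1 ?_ (norm_nonneg _) hη0
      rw [Lagrange.basis, Polynomial.eval_prod, norm_prod]
      calc ∏ m ∈ (Finset.range M).erase l, ‖(Lagrange.basisDivisor (v l) (v m)).eval (t : ℂ)‖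
          ≤ ∏ m ∈ (Finset.range M).erase l, (D / ρ) := by
            refine Finset.prod_le_prod (fun _ _ => norm_nonneg _) fun m hm => ?_
            have hml : m ≠ l := (Finset.mem_erase.1 hm).1
            have hmM : m < M := Finset.mem_range.1 (Finset.mem_erase.1 hm).2
            have h2 : ρ ≤ ‖v l - v m‖ := by
              have : v l - v m = (((l : ℝ) - m) * ρ : ℝ) := by simp only [hv]; push_cast; ring
              rw [this, Complex.norm_real, Real.norm_eq_abs, abs_mul, abs_of_pos hρ]
              have h3 : (1 : ℝ) ≤ |(l : ℝ) - m| := by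
                have : (1 : ℤ) ≤ |(l : ℤ) - m| := Int.one_le_abs (by omega)
                exact_mod_cast this
              nlinarith
            have h4 : ‖(t : ℂ) - v m‖ ≤ D := by
              simp only [hv]
              rw [← Complex.ofReal_sub, Complex.norm_real]
              exact hDK t ht m hmM
            simp only [Lagrange.basisDivisor, Polynomial.eval_mul, Polynomial.eval_C,
              Polynomial.eval_sub, Polynomial.eval_X, norm_mul, norm_inv]
            rw [inv_mul_eq_div]
            have hD0 : 0 ≤ D := hρ.le.trans hDρ
            gcongr
        _ = (D / ρ) ^ ((Finset.range M).erase l).card := Finset.prod_const _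
        _ ≤ (D / ρ) ^ M := by
            refine pow_le_pow_right₀ hr1 ?_
            exact (Finset.card_le_card (Finset.erase_subset _ _)).trans (Finset.card_range M).le
    · rw [Finset.card_range, nsmul_eq_mul, mul_assoc]
  have hci : c i = ∫ t, f.eval (t : ℂ) * ((p i).eval t : ℝ) ∂μ := by
    have := h.integral_sum_mul (𝕜 := ℂ) (Finset.range M) c i
    rw [if_pos (Finset.mem_range.2 hi)] at this
    rw [← this]
    simp only [hfe]
    rfl
  -- From |x| ≤ 1 + x² and the normalization ∫ p_i² dμ = 1.
  have hp1 : ∫ t, |(p i).eval t| ∂μ ≤ μ.real Set.univ + 1 := by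
    have hsq : Integrable (fun t => (p i).eval t * (p i).eval t) μ :=
      h.integrable_of_continuous (by fun_prop)
    calc ∫ t, |(p i).eval t| ∂μ ≤ ∫ t, (1 + (p i).eval t * (p i).eval t) ∂μ := by
          refine integral_mono (h.integrable_of_continuous (by fun_prop))
            ((integrable_const _).add hsq) fun t => ?_
          change |(p i).eval t| ≤ 1 + (p i).eval t * (p i).eval t
          rw [← abs_mul_abs_self ((p i).eval t)]
          nlinarith [sq_nonneg (|(p i).eval t| - 1), abs_nonneg ((p i).eval t)]
      _ = μ.real Set.univ + 1 := by
          rw [integral_add (integrable_const _) hsq, h.orthonormal_polynomials.orthonormal]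
          simp
  rw [hci]
  calc ‖∫ t, f.eval (t : ℂ) * ((p i).eval t : ℝ) ∂μ‖
      ≤ ∫ t, M * η * (D / ρ) ^ M * |(p i).eval t| ∂μ := by
        refine norm_integral_le_of_norm_le ?_ ?_
        · exact (h.integrable_of_continuous (by fun_prop)).const_mul _
        · filter_upwards [h.ae_mem] with t ht
          rw [norm_mul, Complex.norm_real, Real.norm_eq_abs]
          gcongr
          exact hfb t ht
    _ = M * η * (D / ρ) ^ M * ∫ t, |(p i).eval t| ∂μ := integral_const_mul _ _
    _ ≤ _ := by gcongr

end IsAdmissibleMeasure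

/-! ### Uniform bounds for the orthonormal polynomials at complex points near the interval -/

theorem aeval_complex_ofReal (q : ℝ[X]) (x : ℝ) :
    Polynomial.aeval (x : ℂ) q = ((q.eval x : ℝ) : ℂ) :=
  Polynomial.aeval_ofReal _ _

theorem eval_orthoPoly (p : ℕ → ℝ[X]) {n : ℕ} (x : Fin (n + 1) → ℂ) (z : ℂ) :
    (orthoPoly p x).eval z = ∑ j : Fin (n + 1), x j * Polynomial.aeval z (p j) := by
  rw [orthoPoly, Polynomial.eval_finsetSum]
  refine Finset.sum_congr rfl fun j _ => ?_
  rw [Polynomial.eval_mul, Polynomial.eval_C, Polynomial.eval_map_algebraMap]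

theorem exists_Icc_subset_interior {K : Set ℝ} {a b : ℝ} (hab : a ≤ b)
    (hI : Set.Icc a b ⊆ interior K) :
    ∃ d : ℝ, 0 < d ∧ Set.Icc (a - d) (b + d) ⊆ interior K := by
  obtain ⟨r, hr, hra⟩ := Metric.isOpen_iff.1 isOpen_interior a (hI ⟨le_rfl, hab⟩)
  obtain ⟨s, hs, hsb⟩ := Metric.isOpen_iff.1 isOpen_interior b (hI ⟨hab, le_rfl⟩)
  refine ⟨min r s / 2, by positivity, fun t ht => ?_⟩
  have h1 := min_le_left r s
  have h2 := min_le_right r s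
  have h3 : 0 < min r s := lt_min hr hs
  rcases lt_or_ge t a with h | h
  · refine hra ?_
    rw [Metric.mem_ball, Real.dist_eq, abs_lt]
    constructor <;> linarith [ht.1]
  rcases le_or_gt t b with h' | h'
  · exact hI ⟨h, h'⟩
  · refine hsb ?_
    rw [Metric.mem_ball, Real.dist_eq, abs_lt]
    constructor <;> linarith [ht.2]

/-- Uniform local information on the orthonormal polynomials near `[a, b]`: an upper bound at
complex points at distance `O(1/n)`, and a lower bound for the sum of squares. -/
structure LocalBounds (p : ℕ → ℝ[X]) (a b d C₀ κ c₁ : ℝ) : Prop where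
  d_pos : 0 < d
  C₀_pos : 0 < C₀
  κ_pos : 0 < κ
  c₁_pos : 0 < c₁
  upper : ∀ n : ℕ, 0 < n → ∀ j ≤ n, ∀ x ∈ Set.Icc a b, ∀ (R : ℝ) (z : ℂ),
    ‖z - x‖ ≤ R * d / n → ‖Polynomial.aeval z (p j)‖ ≤ C₀ * Real.exp (2 * R)
  lower : ∀ n : ℕ, 0 < n → ∀ x ∈ Set.Icc a b, ∀ z : ℂ, ‖z - x‖ ≤ c₁ / n →
    κ * n ≤ ∑ j ∈ Finset.range (n + 1), ‖Polynomial.aeval z (p j)‖ ^ 2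

/-- The interval is enlarged by d inside the interior so that the hypothesis on p_j is available
around every x. The upper bound is then Bernstein–Walsh. The lower bound holds at real points by the
Christoffel estimate and moves to nearby complex z by the Lipschitz bound at scale 1/n. -/
theorem IsAdmissibleMeasure.exists_localBounds {K : Set ℝ} {μ : Measure ℝ} {w : ℝ → ℝ}
    {p : ℕ → ℝ[X]} (h : IsAdmissibleMeasure K μ w p) {a b : ℝ} (hab : a ≤ b)
    (hI : Set.Icc a b ⊆ interior K) : ∃ d C₀ κ c₁ : ℝ, LocalBounds p a b d C₀ κ c₁ := by
  have := h.finite_measure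
  obtain ⟨d, hd, hdI⟩ := exists_Icc_subset_interior hab hI
  obtain ⟨C, hC, hw, hp⟩ := h.bounded_on_interior _ _ hdI
  obtain ⟨D, hD, hDK⟩ := h.exists_subset_closedBall
  have hsub : ∀ x ∈ Set.Icc a b, Set.Icc (x - d) (x + d) ⊆ Set.Icc (a - d) (b + d) :=
    fun x hx => Set.Icc_subset_Icc (by linarith [hx.1]) (by linarith [hx.2])
  have hdeg : ∀ {n j : ℕ}, j ≤ n → ((p j).map (algebraMap ℝ ℂ)).natDegree ≤ n := by
    intro n j hj
    refine Polynomial.natDegree_map_le.trans ?_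
    rwa [Polynomial.natDegree_eq_of_degree_eq_some (h.orthonormal_polynomials.degree_eq j)]
  have hpb : ∀ j, ∀ x ∈ Set.Icc a b, ∀ t ∈ Set.Icc (x - d) (x + d),
      ‖((p j).map (algebraMap ℝ ℂ)).eval (t : ℂ)‖ ≤ C := by
    intro j x hx t ht
    have : ((p j).map (algebraMap ℝ ℂ)).eval (t : ℂ) = ((p j).eval t : ℝ) :=
      (Polynomial.eval_map_algebraMap _ _).trans (Polynomial.aeval_ofReal _ _)
    rw [this, Complex.norm_real]
    exact hp j t (hsub x hx ht)
  set Q : ℝ := C * (5 * Real.pi * (2 * D)) + (2 * D) ^ 2 / d ^ 2 * μ.real Set.univ with hQ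
  have hQpos : 0 < Q := by positivity
  -- Chosen so that |p_j(z) - p_j(x)|² ≤ 1/(8Q). Summed over j ≤ n this costs (n + 1)/4 ≤ n/2 in the
  -- inequality multiplied by Q, which leaves κ = 1/(4Q).
  set c₁ : ℝ := min (d / 2) (d / (10 * C * √(8 * Q))) with hc₁
  have hc₁pos : 0 < c₁ := by positivity
  refine ⟨d, C, 1 / (4 * Q), c₁, hd, hC, by positivity, hc₁pos, ?_, ?_⟩
  · intro n hn j hj x hx R z hz
    have := norm_eval_le_exp (hdeg hj) hn hd (hpb j x hx) hz
    rwa [Polynomial.eval_map_algebraMap] at this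
  · intro n hn x hx z hz
    have hn' : (0 : ℝ) < n := by exact_mod_cast hn
    have hn1 : (1 : ℝ) ≤ n := by exact_mod_cast hn
    have hxK : x ∈ K := interior_subset (hI hx)
    have h1 := h.sum_sq_eval_ge (D := 2 * D) (d := d) (C := C) (x := x) (by positivity)
      (fun t ht => by
        have := abs_sub t x
        linarith [hDK t ht, hDK x hxK]) hd hC
      ((ae_restrict_of_ae_restrict_of_subset (hsub x hx) hw).mono fun t ht => ht.2) hn
    rw [← hQ] at h1
    set S := ∑ j ∈ Finset.range (n + 1), ‖Polynomial.aeval z (p j)‖ ^ 2 with hS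
    have hstep : ∀ j ∈ Finset.range (n + 1), ((p j).eval x) ^ 2 ≤
        2 * ‖Polynomial.aeval z (p j)‖ ^ 2 + 1 / (4 * Q) := by
      intro j hj
      have hj' : j ≤ n := Nat.lt_succ_iff.1 (Finset.mem_range.1 hj)
      have hzd : ‖z - x‖ < d / n := by
        refine hz.trans_lt ?_
        gcongr
        exact (min_le_left _ _).trans_lt (by linarith)
      have h2 := norm_eval_sub_eval_le (hdeg hj') hn hC hd (hpb j x hx) hzd
      rw [Polynomial.eval_map_algebraMap, Polynomial.eval_map_algebraMap,
        aeval_complex_ofReal] at h2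
      have h3 : 10 * C * n / d * ‖z - x‖ ≤ 1 / √(8 * Q) := by
        calc 10 * C * n / d * ‖z - x‖ ≤ 10 * C * n / d * (d / (10 * C * √(8 * Q)) / n) := by
              gcongr
              refine hz.trans ?_
              gcongr
              exact min_le_right _ _
          _ = 1 / √(8 * Q) := by
              have : √(8 * Q) ≠ 0 := by positivity
              field_simp
      have h4 : ‖Polynomial.aeval z (p j) - ((p j).eval x : ℝ)‖ ^ 2 ≤ 1 / (8 * Q) := by
        calc _ ≤ (1 / √(8 * Q)) ^ 2 := by
              gcongr
              exact h2.trans h3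
          _ = 1 / (8 * Q) := by rw [div_pow, Real.sq_sqrt (by positivity), one_pow]
      have h5 : |(p j).eval x| ≤ ‖Polynomial.aeval z (p j)‖ +
          ‖Polynomial.aeval z (p j) - ((p j).eval x : ℝ)‖ := by
        have := norm_sub_norm_le (((p j).eval x : ℝ) : ℂ) (Polynomial.aeval z (p j))
        rw [norm_sub_rev, Complex.norm_real, Real.norm_eq_abs] at this
        linarith
      have h6 : 1 / (4 * Q) = 2 * (1 / (8 * Q)) := by field_simp; norm_num
      rw [h6, ← sq_abs]
      have h7 := norm_nonneg (Polynomial.aeval z (p j))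
      have h8 := norm_nonneg (Polynomial.aeval z (p j) - ((p j).eval x : ℝ))
      nlinarith [abs_nonneg ((p j).eval x), sq_nonneg (‖Polynomial.aeval z (p j)‖ -
        ‖Polynomial.aeval z (p j) - ((p j).eval x : ℝ)‖)]
    have h9 := Finset.sum_le_sum hstep
    rw [Finset.sum_add_distrib, ← Finset.mul_sum, ← hS, Finset.sum_const, Finset.card_range,
      nsmul_eq_mul] at h9
    have h10 : (n : ℝ) ≤ Q * (2 * S + (n + 1 : ℕ) * (1 / (4 * Q))) :=
      h1.trans (by gcongr)
    have h11 : Q * (2 * S + (n + 1 : ℕ) * (1 / (4 * Q))) = 2 * Q * S + (n + 1) / 4 := by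
      push_cast; field_simp
    rw [h11] at h10
    rw [div_mul_eq_mul_div, one_mul, div_le_iff₀ (by positivity)]
    nlinarith

/-! ### Characteristic functions of variables with bounded `2 + ε` moments -/

/-- The remainder is O(|u|³) for |u| ≤ 1 and O(u²) for |u| > 1; the exponent 2 + ε lies between 2
and 3 and covers both regimes. -/
theorem norm_exp_mul_I_sub_taylor_le (u ε : ℝ) (hε₀ : 0 < ε) (hε₁ : ε < 1) :
    ‖Complex.exp (u * Complex.I) - (1 + u * Complex.I - u ^ 2 / 2)‖ ≤ 4 * |u| ^ (2 + ε) := by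
  rcases le_or_gt |u| 1 with hu | hu
  · have h1 := Complex.exp_bound (x := u * Complex.I) (by simpa using hu) (n := 3) (by norm_num)
    have h2 : ∑ m ∈ Finset.range 3, ((u : ℂ) * Complex.I) ^ m / (m.factorial : ℂ) =
        1 + u * Complex.I - u ^ 2 / 2 := by
      simp [Finset.sum_range_succ, mul_pow, Nat.factorial]
      ring
    rw [h2, norm_mul, Complex.norm_I, mul_one, Complex.norm_real, Real.norm_eq_abs] at h1
    refine h1.trans ?_
    have h3 : |u| ^ 3 ≤ |u| ^ (2 + ε) := by
      rcases (abs_nonneg u).eq_or_lt with h | h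
      · rw [← h, Real.zero_rpow (by linarith)]; norm_num
      · rw [← Real.rpow_natCast]
        exact Real.rpow_le_rpow_of_exponent_ge h hu (by push_cast; linarith)
    have h4 : ((Nat.succ 3 : ℕ) : ℝ) * ((Nat.factorial 3 : ℕ) * (3 : ℕ) : ℝ)⁻¹ ≤ 4 := by
      norm_num [Nat.factorial]
    have h5 : 0 ≤ |u| ^ 3 := by positivity
    nlinarith
  · have h1 : ‖Complex.exp (u * Complex.I)‖ = 1 := Complex.norm_exp_ofReal_mul_I u
    have h2 : ‖(1 : ℂ) + u * Complex.I - u ^ 2 / 2‖ ≤ 1 + |u| + |u| ^ 2 / 2 := by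
      refine (norm_sub_le _ _).trans (add_le_add ((norm_add_le _ _).trans ?_) ?_)
      · simp
      · simp
    have h3 : |u| ^ 2 ≤ |u| ^ (2 + ε) := by
      rw [← Real.rpow_natCast]
      exact Real.rpow_le_rpow_of_exponent_le hu.le (by push_cast; linarith)
    refine (norm_sub_le _ _).trans ?_
    nlinarith

theorem sq_le_one_add_rpow {x ε : ℝ} (hx : 0 ≤ x) (hε₀ : 0 < ε) : x ^ 2 ≤ 1 + x ^ (2 + ε) := by
  have h0 : 0 ≤ x ^ (2 + ε) := Real.rpow_nonneg hx _
  rcases le_total x 1 with h | h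
  · nlinarith
  · have : x ^ 2 ≤ x ^ (2 + ε) := by
      rw [← Real.rpow_natCast]
      exact Real.rpow_le_rpow_of_exponent_le h (by push_cast; linarith)
    linarith

theorem add_rpow_le_eight {x y ε : ℝ} (hx : 0 ≤ x) (hy : 0 ≤ y) (hε₀ : 0 < ε) (hε₁ : ε < 1) :
    (x + y) ^ (2 + ε) ≤ 8 * (x ^ (2 + ε) + y ^ (2 + ε)) := by
  have key : ∀ {u v : ℝ}, 0 ≤ u → 0 ≤ v → u ≤ v → (u + v) ^ (2 + ε) ≤
      8 * (u ^ (2 + ε) + v ^ (2 + ε)) := by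
    intro u v hu hv huv
    calc (u + v) ^ (2 + ε) ≤ (2 * v) ^ (2 + ε) :=
          Real.rpow_le_rpow (by positivity) (by linarith) (by linarith)
      _ = 2 ^ (2 + ε) * v ^ (2 + ε) := Real.mul_rpow (by norm_num) hv
      _ ≤ 8 * v ^ (2 + ε) := by
          have : (2 : ℝ) ^ (2 + ε) ≤ 2 ^ (3 : ℝ) :=
            Real.rpow_le_rpow_of_exponent_le (by norm_num) (by linarith)
          have h8 : (2 : ℝ) ^ (3 : ℝ) = 8 := by norm_num
          rw [h8] at this
          gcongr
      _ ≤ _ := by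
          have := Real.rpow_nonneg hu (2 + ε)
          linarith
  rcases le_total x y with h | h
  · exact key hx hy h
  · rw [add_comm x, add_comm (x ^ _)]
    exact key hy hx h

theorem abs_re_mul_rpow_le (x b : ℂ) {r : ℝ} (hr : 0 ≤ r) :
    |(x * b).re| ^ r ≤ ‖b‖ ^ r * ‖x‖ ^ r := by
  rw [← Real.mul_rpow (norm_nonneg _) (norm_nonneg _)]
  refine Real.rpow_le_rpow (abs_nonneg _) ?_ hr
  rw [mul_comm ‖b‖, ← norm_mul]
  exact Complex.abs_re_le_norm _

section Single

variable {Ω : Type*} [MeasurableSpace Ω] {P : Measure Ω} [IsProbabilityMeasure P] {X : Ω → ℂ}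
  {τ ε : ℝ}

theorem memLp_two_of_moment (hX : Measurable X) (hε₀ : 0 < ε)
    (hi : Integrable (fun ω => ‖X ω‖ ^ (2 + ε)) P) : MemLp X 2 P := by
  rw [memLp_two_iff_integrable_sq_norm hX.aestronglyMeasurable]
  refine ((integrable_const (1 : ℝ)).add hi).mono' (hX.norm.pow_const 2).aestronglyMeasurable
    (ae_of_all _ fun ω => ?_)
  rw [Real.norm_eq_abs, abs_of_nonneg (by positivity)]
  exact sq_le_one_add_rpow (norm_nonneg _) hε₀

theorem integral_sq_norm_le_of_moment (hX : Measurable X) (hε₀ : 0 < ε)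
    (hi : Integrable (fun ω => ‖X ω‖ ^ (2 + ε)) P) (hτ : ∫ ω, ‖X ω‖ ^ (2 + ε) ∂P ≤ τ) :
    ∫ ω, ‖X ω‖ ^ 2 ∂P ≤ 1 + τ := by
  have h2 := (memLp_two_iff_integrable_sq_norm hX.aestronglyMeasurable).1
    (memLp_two_of_moment hX hε₀ hi)
  calc ∫ ω, ‖X ω‖ ^ 2 ∂P ≤ ∫ ω, (1 + ‖X ω‖ ^ (2 + ε)) ∂P :=
        integral_mono h2 ((integrable_const (1 : ℝ)).add hi) fun ω =>
          sq_le_one_add_rpow (norm_nonneg _) hε₀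
    _ = 1 + ∫ ω, ‖X ω‖ ^ (2 + ε) ∂P := by
        rw [integral_add (integrable_const _) hi]; simp
    _ ≤ _ := by linarith

theorem integral_norm_le_of_moment (hX : Measurable X) (hε₀ : 0 < ε)
    (hi : Integrable (fun ω => ‖X ω‖ ^ (2 + ε)) P) (hτ : ∫ ω, ‖X ω‖ ^ (2 + ε) ∂P ≤ τ) :
    ∫ ω, ‖X ω‖ ∂P ≤ 2 + τ := by
  have hL := memLp_two_of_moment hX hε₀ hi
  have h2 := (memLp_two_iff_integrable_sq_norm hX.aestronglyMeasurable).1 hL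
  calc ∫ ω, ‖X ω‖ ∂P ≤ ∫ ω, (1 + ‖X ω‖ ^ 2) ∂P :=
        integral_mono (hL.integrable (by norm_num)).norm ((integrable_const (1 : ℝ)).add h2)
          fun ω => by
            change ‖X ω‖ ≤ 1 + ‖X ω‖ ^ 2
            nlinarith [sq_nonneg (‖X ω‖ - 1), norm_nonneg (X ω)]
    _ = 1 + ∫ ω, ‖X ω‖ ^ 2 ∂P := by
        rw [integral_add (integrable_const _) h2]; simp
    _ ≤ _ := by linarith [integral_sq_norm_le_of_moment hX hε₀ hi hτ]

theorem integrable_exp_re_mul_I (hX : Measurable X) (b : ℂ) :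
    Integrable (fun ω => Complex.exp (((X ω * b).re : ℝ) * Complex.I)) P := by
  refine Integrable.of_bound ?_ 1 (ae_of_all _ fun ω => ?_)
  · exact (Complex.measurable_exp.comp ((Complex.measurable_ofReal.comp
      (Complex.measurable_re.comp (hX.mul_const b))).mul_const _)).aestronglyMeasurable
  · rw [Complex.norm_exp_ofReal_mul_I]

/-- Second-order expansion of the characteristic function. -/
theorem norm_integral_exp_sub_taylor_le (hX : Measurable X) (hε₀ : 0 < ε) (hε₁ : ε < 1)
    (hi : Integrable (fun ω => ‖X ω‖ ^ (2 + ε)) P) (hτ : ∫ ω, ‖X ω‖ ^ (2 + ε) ∂P ≤ τ) (b : ℂ) :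
    ‖∫ ω, Complex.exp (((X ω * b).re : ℝ) * Complex.I) ∂P -
      (1 + (∫ ω, (X ω * b).re ∂P : ℝ) * Complex.I - (∫ ω, (X ω * b).re ^ 2 ∂P : ℝ) / 2)‖ ≤
      4 * τ * ‖b‖ ^ (2 + ε) := by
  have hL := memLp_two_of_moment hX hε₀ hi
  have hXb : MemLp (fun ω => (X ω * b).re) 2 P := (hL.mul_const b).re
  have i1 : Integrable (fun ω => (X ω * b).re) P := hXb.integrable (by norm_num)
  have i2 : Integrable (fun ω => (X ω * b).re ^ 2) P := hXb.integrable_sq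
  have i1' : Integrable (fun ω => (((X ω * b).re : ℝ) : ℂ) * Complex.I) P := i1.ofReal.mul_const _
  have i2' : Integrable (fun ω => (((X ω * b).re : ℝ) : ℂ) ^ 2 / 2) P := by
    have := i2.ofReal (𝕜 := ℂ)
    refine (this.div_const 2).congr (ae_of_all _ fun ω => ?_)
    simp
  have i3 : Integrable (fun ω => 1 + (((X ω * b).re : ℝ) : ℂ) * Complex.I) P :=
    (integrable_const _).add i1'
  have i4 : Integrable (fun ω => 1 + (((X ω * b).re : ℝ) : ℂ) * Complex.I -
      (((X ω * b).re : ℝ) : ℂ) ^ 2 / 2) P := i3.sub i2'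
  have e1 : (1 + (∫ ω, (X ω * b).re ∂P : ℝ) * Complex.I - (∫ ω, (X ω * b).re ^ 2 ∂P : ℝ) / 2) =
      ∫ ω, (1 + (((X ω * b).re : ℝ) : ℂ) * Complex.I - (((X ω * b).re : ℝ) : ℂ) ^ 2 / 2) ∂P := by
    rw [integral_sub i3 i2', integral_add (integrable_const _) i1',
      integral_mul_const, integral_div, integral_complex_ofReal]
    have : ∫ ω, (((X ω * b).re : ℝ) : ℂ) ^ 2 ∂P = ((∫ ω, (X ω * b).re ^ 2 ∂P : ℝ) : ℂ) := by
      rw [← integral_complex_ofReal]; push_cast; rfl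
    rw [this]
    simp
  rw [e1, ← integral_sub (integrable_exp_re_mul_I hX b) i4]
  calc _ ≤ ∫ ω, 4 * (‖b‖ ^ (2 + ε) * ‖X ω‖ ^ (2 + ε)) ∂P := by
        refine norm_integral_le_of_norm_le ((hi.const_mul _).const_mul _) (ae_of_all _ fun ω => ?_)
        refine (norm_exp_mul_I_sub_taylor_le _ ε hε₀ hε₁).trans ?_
        gcongr
        exact abs_re_mul_rpow_le _ _ (by linarith)
    _ = 4 * ‖b‖ ^ (2 + ε) * ∫ ω, ‖X ω‖ ^ (2 + ε) ∂P := by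
        rw [integral_const_mul, integral_const_mul, mul_assoc]
    _ ≤ 4 * ‖b‖ ^ (2 + ε) * τ := by gcongr
    _ = _ := by ring

/-- A first-order bound that needs no moment matching, for the indices below N₀. -/
theorem norm_integral_exp_sub_one_le (hX : Measurable X) (hε₀ : 0 < ε)
    (hi : Integrable (fun ω => ‖X ω‖ ^ (2 + ε)) P) (hτ : ∫ ω, ‖X ω‖ ^ (2 + ε) ∂P ≤ τ) (b : ℂ) :
    ‖∫ ω, Complex.exp (((X ω * b).re : ℝ) * Complex.I) ∂P - 1‖ ≤ (2 + τ) * ‖b‖ := by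
  have hL := memLp_two_of_moment hX hε₀ hi
  have e1 : (1 : ℂ) = ∫ _, (1 : ℂ) ∂P := by simp
  rw [e1, ← integral_sub (integrable_exp_re_mul_I hX b) (integrable_const _)]
  calc _ ≤ ∫ ω, ‖X ω‖ * ‖b‖ ∂P := by
        refine norm_integral_le_of_norm_le ((hL.integrable (by norm_num)).norm.mul_const _)
          (ae_of_all _ fun ω => ?_)
        have := Real.norm_exp_I_mul_ofReal_sub_one_le (x := (X ω * b).re)
        rw [mul_comm Complex.I] at this
        refine this.trans ?_
        rw [Real.norm_eq_abs, ← norm_mul]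
        exact Complex.abs_re_le_norm _
    _ = (∫ ω, ‖X ω‖ ∂P) * ‖b‖ := integral_mul_const _ _
    _ ≤ _ := by
        gcongr
        exact integral_norm_le_of_moment hX hε₀ hi hτ

/-- The centred variable has a controlled `2 + ε` moment. -/
theorem moment_sub_mean (hX : Measurable X) (hε₀ : 0 < ε) (hε₁ : ε < 1)
    (hi : Integrable (fun ω => ‖X ω‖ ^ (2 + ε)) P) (hτ : ∫ ω, ‖X ω‖ ^ (2 + ε) ∂P ≤ τ) :
    Integrable (fun ω => ‖X ω - ∫ ω', X ω' ∂P‖ ^ (2 + ε)) P ∧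
    ∫ ω, ‖X ω - ∫ ω', X ω' ∂P‖ ^ (2 + ε) ∂P ≤ 8 * (τ + (2 + τ) ^ 3) := by
  set m := ∫ ω', X ω' ∂P with hm
  have hm1 : ‖m‖ ≤ 2 + τ := (norm_integral_le_integral_norm _).trans
    (integral_norm_le_of_moment hX hε₀ hi hτ)
  have hτ0 : 0 ≤ τ := (integral_nonneg fun ω => Real.rpow_nonneg (norm_nonneg _) _).trans hτ
  have hm2 : ‖m‖ ^ (2 + ε) ≤ (2 + τ) ^ 3 := by
    calc ‖m‖ ^ (2 + ε) ≤ (2 + τ) ^ (2 + ε) := Real.rpow_le_rpow (norm_nonneg _) hm1 (by linarith)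
      _ ≤ (2 + τ) ^ (3 : ℝ) := Real.rpow_le_rpow_of_exponent_le (by linarith) (by linarith)
      _ = (2 + τ) ^ 3 := by norm_cast
  have hb : ∀ ω, ‖X ω - m‖ ^ (2 + ε) ≤ 8 * (‖X ω‖ ^ (2 + ε) + (2 + τ) ^ 3) := by
    intro ω
    refine (Real.rpow_le_rpow (norm_nonneg _) (norm_sub_le _ _) (by linarith)).trans ?_
    refine (add_rpow_le_eight (norm_nonneg _) (norm_nonneg _) hε₀ hε₁).trans ?_
    linarith
  have hbi : Integrable (fun ω => 8 * (‖X ω‖ ^ (2 + ε) + (2 + τ) ^ 3)) P :=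
    (hi.add (integrable_const _)).const_mul 8
  have hint : Integrable (fun ω => ‖X ω - m‖ ^ (2 + ε)) P := by
    refine hbi.mono' ((hX.sub_const m).norm.pow_const _).aestronglyMeasurable
      (ae_of_all _ fun ω => ?_)
    rw [Real.norm_eq_abs, abs_of_nonneg (Real.rpow_nonneg (norm_nonneg _) _)]
    exact hb ω
  refine ⟨hint, (integral_mono hint hbi hb).trans ?_⟩
  rw [integral_const_mul, integral_add hi (integrable_const _)]
  simp
  linarith

theorem abs_exp_neg_half_sub_le {v t ε : ℝ} (hv : 0 ≤ v) (ht : 0 ≤ t) (hvt : v ≤ t ^ 2)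
    (hε₀ : 0 < ε) (hε₁ : ε < 1) :
    |Real.exp (-v / 2) - (1 - v / 2)| ≤ t ^ (2 + ε) := by
  have h1 := Real.add_one_le_exp (-v / 2)
  rw [abs_of_nonneg (by linarith)]
  rcases le_total t 1 with h | h
  · have h2 : Real.exp (-v / 2) ≤ 1 - v / 2 + v ^ 2 := by
      have hv1 : v ≤ 1 := hvt.trans (by nlinarith)
      have := Real.abs_exp_sub_one_sub_id_le (x := -v / 2) (by rw [abs_le]; constructor <;> linarith)
      nlinarith [le_abs_self (Real.exp (-v / 2) - 1 - -v / 2)]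
    have h3 : v ^ 2 ≤ t ^ 3 := by
      calc v ^ 2 ≤ (t ^ 2) ^ 2 := by gcongr
        _ = t ^ 3 * t := by ring
        _ ≤ t ^ 3 * 1 := by gcongr
        _ = t ^ 3 := mul_one _
    have h4 : t ^ 3 ≤ t ^ (2 + ε) := by
      rcases ht.eq_or_lt with h' | h'
      · rw [← h', Real.zero_rpow (by linarith)]; norm_num
      · rw [← Real.rpow_natCast]
        exact Real.rpow_le_rpow_of_exponent_ge h' h (by push_cast; linarith)
    linarith
  · have h2 : Real.exp (-v / 2) ≤ 1 := Real.exp_le_one_iff.2 (by linarith)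
    have h3 : t ^ 2 ≤ t ^ (2 + ε) := by
      rw [← Real.rpow_natCast]
      exact Real.rpow_le_rpow_of_exponent_le h (by push_cast; linarith)
    linarith

/-- The characteristic function of a centred variable of variance at most one is close to the
Gaussian one. -/
theorem norm_integral_exp_sub_gaussian_le (hX : Measurable X) (hε₀ : 0 < ε) (hε₁ : ε < 1)
    (hi : Integrable (fun ω => ‖X ω‖ ^ (2 + ε)) P) (hτ : ∫ ω, ‖X ω‖ ^ (2 + ε) ∂P ≤ τ)
    (h0 : ∫ ω, X ω ∂P = 0) (h1 : ∫ ω, ‖X ω‖ ^ 2 ∂P = 1) (b : ℂ) :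
    ‖∫ ω, Complex.exp (((X ω * b).re : ℝ) * Complex.I) ∂P -
      Real.exp (-(∫ ω, (X ω * b).re ^ 2 ∂P) / 2)‖ ≤ (4 * τ + 1) * ‖b‖ ^ (2 + ε) := by
  have hL := memLp_two_of_moment hX hε₀ hi
  have hT := norm_integral_exp_sub_taylor_le hX hε₀ hε₁ hi hτ b
  have hmean : ∫ ω, (X ω * b).re ∂P = 0 := by
    have h2 : Integrable (fun ω => X ω * b) P := (hL.integrable (by norm_num)).mul_const b
    have h3 := integral_re h2
    rw [integral_mul_const, h0, zero_mul] at h3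
    simpa using h3
  rw [hmean] at hT
  set v := ∫ ω, (X ω * b).re ^ 2 ∂P with hv
  have hv0 : 0 ≤ v := integral_nonneg fun _ => sq_nonneg _
  have hvb : v ≤ ‖b‖ ^ 2 := by
    have h2 := (memLp_two_iff_integrable_sq_norm hX.aestronglyMeasurable).1 hL
    calc v ≤ ∫ ω, ‖b‖ ^ 2 * ‖X ω‖ ^ 2 ∂P := by
          refine integral_mono ((hL.mul_const b).re.integrable_sq) (h2.const_mul _) fun ω => ?_
          change (X ω * b).re ^ 2 ≤ ‖b‖ ^ 2 * ‖X ω‖ ^ 2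
          rw [← mul_pow, mul_comm ‖b‖, ← norm_mul, ← sq_abs]
          gcongr
          exact Complex.abs_re_le_norm _
      _ = ‖b‖ ^ 2 := by rw [integral_const_mul, h1, mul_one]
  have hG := abs_exp_neg_half_sub_le hv0 (norm_nonneg b) hvb hε₀ hε₁
  set φ := ∫ ω, Complex.exp (((X ω * b).re : ℝ) * Complex.I) ∂P
  have e1 : φ - Real.exp (-v / 2) = (φ - (1 + ((0 : ℝ) : ℂ) * Complex.I - (v : ℂ) / 2)) -
      ((Real.exp (-v / 2) - (1 - v / 2) : ℝ) : ℂ) := by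
    push_cast; ring
  rw [e1]
  refine (norm_sub_le _ _).trans ?_
  rw [Complex.norm_real, Real.norm_eq_abs]
  linarith

end Single

section SecondMoments

variable {Ω : Type*} [MeasurableSpace Ω] {P : Measure Ω} {X : Ω → ℂ}

/-- The trivial powers are kept so that the moments appear exactly in the form of
`MomentMatching.matching`; the same holds for the second-order version below. -/
theorem integral_re_mul_eq [IsProbabilityMeasure P] (hL : MemLp X 2 P) (b : ℂ) :
    ∫ ω, (X ω * b).re ∂P = (∫ ω, (X ω).re ^ 1 * (X ω).im ^ 0 ∂P) * b.re -
      (∫ ω, (X ω).re ^ 0 * (X ω).im ^ 1 ∂P) * b.im := by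
  have i1 : Integrable (fun ω => (X ω).re * b.re) P :=
    (hL.re.integrable (by norm_num)).mul_const _
  have i2 : Integrable (fun ω => (X ω).im * b.im) P :=
    (hL.im.integrable (by norm_num)).mul_const _
  simp only [Complex.mul_re, pow_one, pow_zero, mul_one, one_mul]
  rw [integral_sub i1 i2, integral_mul_const, integral_mul_const]

theorem integral_sq_re_mul_eq (hL : MemLp X 2 P) (b : ℂ) :
    ∫ ω, (X ω * b).re ^ 2 ∂P = (∫ ω, (X ω).re ^ 2 * (X ω).im ^ 0 ∂P) * b.re ^ 2 -
      (∫ ω, (X ω).re ^ 1 * (X ω).im ^ 1 ∂P) * (2 * b.re * b.im) +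
      (∫ ω, (X ω).re ^ 0 * (X ω).im ^ 2 ∂P) * b.im ^ 2 := by
  have i1 : Integrable (fun ω => (X ω).re ^ 2 * b.re ^ 2) P := hL.re.integrable_sq.mul_const _
  have i2 : Integrable (fun ω => (X ω).re * (X ω).im * (2 * b.re * b.im)) P :=
    (hL.re.integrable_mul hL.im).mul_const _
  have i3 : Integrable (fun ω => (X ω).im ^ 2 * b.im ^ 2) P := hL.im.integrable_sq.mul_const _
  have i4 : Integrable (fun ω => (X ω).re ^ 2 * b.re ^ 2 -
      (X ω).re * (X ω).im * (2 * b.re * b.im)) P := i1.sub i2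
  simp only [pow_one, pow_zero, mul_one, one_mul]
  rw [← integral_mul_const, ← integral_mul_const, ← integral_mul_const, ← integral_sub i1 i2,
    ← integral_add i4 i3]
  refine integral_congr_ae (ae_of_all _ fun ω => ?_)
  simp only [Complex.mul_re]
  ring

end SecondMoments

/-- Equal moments make the second-order Taylor polynomials of the two characteristic functions
identical, so only the two remainders are left. -/
theorem norm_integral_exp_sub_integral_exp_le {Ω Ω' : Type*} [MeasurableSpace Ω]
    [MeasurableSpace Ω'] {P : Measure Ω} {P' : Measure Ω'} [IsProbabilityMeasure P]
    [IsProbabilityMeasure P'] {X : Ω → ℂ} {X' : Ω' → ℂ} {τ ε : ℝ} (hε₀ : 0 < ε) (hε₁ : ε < 1)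
    (hX : Measurable X) (hi : Integrable (fun ω => ‖X ω‖ ^ (2 + ε)) P)
    (hτ : ∫ ω, ‖X ω‖ ^ (2 + ε) ∂P ≤ τ)
    (hX' : Measurable X') (hi' : Integrable (fun ω => ‖X' ω‖ ^ (2 + ε)) P')
    (hτ' : ∫ ω, ‖X' ω‖ ^ (2 + ε) ∂P' ≤ τ)
    (hm : ∀ a b : ℕ, a + b ≤ 2 →
      ∫ ω, (X ω).re ^ a * (X ω).im ^ b ∂P = ∫ ω, (X' ω).re ^ a * (X' ω).im ^ b ∂P') (b : ℂ) :
    ‖∫ ω, Complex.exp (((X ω * b).re : ℝ) * Complex.I) ∂P -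
      ∫ ω, Complex.exp (((X' ω * b).re : ℝ) * Complex.I) ∂P'‖ ≤ 8 * τ * ‖b‖ ^ (2 + ε) := by
  have hL := memLp_two_of_moment hX hε₀ hi
  have hL' := memLp_two_of_moment hX' hε₀ hi'
  have h1 := norm_integral_exp_sub_taylor_le hX hε₀ hε₁ hi hτ b
  have h2 := norm_integral_exp_sub_taylor_le hX' hε₀ hε₁ hi' hτ' b
  have e1 : ∫ ω, (X ω * b).re ∂P = ∫ ω, (X' ω * b).re ∂P' := by
    rw [integral_re_mul_eq hL, integral_re_mul_eq hL', hm 1 0 (by norm_num), hm 0 1 (by norm_num)]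
  have e2 : ∫ ω, (X ω * b).re ^ 2 ∂P = ∫ ω, (X' ω * b).re ^ 2 ∂P' := by
    rw [integral_sq_re_mul_eq hL, integral_sq_re_mul_eq hL', hm 2 0 (by norm_num),
      hm 1 1 (by norm_num), hm 0 2 (by norm_num)]
  rw [e1, e2] at h1
  rw [norm_sub_rev] at h2
  refine (norm_sub_le_norm_sub_add_norm_sub _ _ _).trans ((add_le_add h1 h2).trans ?_)
  apply le_of_eq
  ring

/-! ### Characteristic functions of linear forms in the coefficients -/

theorem norm_prod_sub_prod_le {ι : Type*} (s : Finset ι) (f g : ι → ℂ)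
    (hf : ∀ i ∈ s, ‖f i‖ ≤ 1) (hg : ∀ i ∈ s, ‖g i‖ ≤ 1) :
    ‖∏ i ∈ s, f i - ∏ i ∈ s, g i‖ ≤ ∑ i ∈ s, ‖f i - g i‖ := by
  classical
  induction s using Finset.induction_on with
  | empty => simp
  | insert a s ha ih =>
    rw [Finset.prod_insert ha, Finset.prod_insert ha, Finset.sum_insert ha]
    have h1 : f a * ∏ i ∈ s, f i - g a * ∏ i ∈ s, g i =
        (f a - g a) * ∏ i ∈ s, f i + g a * (∏ i ∈ s, f i - ∏ i ∈ s, g i) := by ring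
    rw [h1]
    refine (norm_add_le _ _).trans (add_le_add ?_ ?_)
    · rw [norm_mul]
      refine mul_le_of_le_one_right (norm_nonneg _) ?_
      rw [norm_prod]
      exact Finset.prod_le_one (fun _ _ => norm_nonneg _)
        fun i hi => hf i (Finset.mem_insert_of_mem hi)
    · rw [norm_mul]
      refine (mul_le_of_le_one_left (norm_nonneg _) (hg a (Finset.mem_insert_self _ _))).trans ?_
      exact ih (fun i hi => hf i (Finset.mem_insert_of_mem hi))
        fun i hi => hg i (Finset.mem_insert_of_mem hi)

theorem norm_integral_exp_le_one {Ω : Type*} [MeasurableSpace Ω] {P : Measure Ω}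
    [IsProbabilityMeasure P] (u : Ω → ℝ) : ‖∫ ω, Complex.exp (u ω * Complex.I) ∂P‖ ≤ 1 := by
  refine (norm_integral_le_of_norm_le_const (C := 1) (ae_of_all _ fun ω => ?_)).trans (by simp)
  rw [Complex.norm_exp_ofReal_mul_I]

theorem integral_exp_re_sum_eq_prod {Ω ι : Type*} [Fintype ι] [MeasurableSpace Ω] {P : Measure Ω}
    {ξ : ι → Ω → ℂ} (hm : ∀ i, Measurable (ξ i)) (hind : iIndepFun ξ P) (b : ι → ℂ) :
    ∫ ω, Complex.exp (((∑ j, ξ j ω * b j).re : ℝ) * Complex.I) ∂P =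
      ∏ j, ∫ ω, Complex.exp (((ξ j ω * b j).re : ℝ) * Complex.I) ∂P := by
  rw [← hind.integral_fun_prod_comp (f := fun j z => Complex.exp (((z * b j).re : ℝ) * Complex.I))
    (fun i => (hm i).aemeasurable)]
  · refine integral_congr_ae (ae_of_all _ fun ω => ?_)
    simp only
    rw [← Complex.exp_sum, Complex.re_sum, Complex.ofReal_sum, Finset.sum_mul]
  · intro i
    exact (Complex.measurable_exp.comp ((Complex.measurable_ofReal.comp
      (Complex.measurable_re.comp (measurable_id.mul_const (b i)))).mul_const _)).aestronglyMeasurable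

/-- The gain is (n + 1) n^(-1-ε/2) ≤ 2n^(-ε/2). Replacing Y^(2+ε) by 1 + Y⁴ means that only fourth
moments of the auxiliary Gaussians will be needed. -/
theorem sum_rpow_div_sqrt_le {n : ℕ} (hn : 0 < n) {ε Y : ℝ} (hε₀ : 0 < ε) (hε₁ : ε < 1)
    (hY : 0 ≤ Y) :
    ∑ _j : Fin (n + 1), (Y / √n) ^ (2 + ε) ≤ 2 * (n : ℝ) ^ (-(ε / 2)) * (1 + Y ^ 4) := by
  have hn0 : (0 : ℝ) < n := by exact_mod_cast hn
  have hn1 : (1 : ℝ) ≤ n := by exact_mod_cast hn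
  have h1 : (Y / √n) ^ (2 + ε) = Y ^ (2 + ε) * (n : ℝ) ^ (-(ε / 2)) * (n : ℝ)⁻¹ := by
    rw [Real.div_rpow hY (Real.sqrt_nonneg _), Real.sqrt_eq_rpow, ← Real.rpow_mul hn0.le,
      div_eq_mul_inv, ← Real.rpow_neg hn0.le, mul_assoc, ← Real.rpow_neg_one,
      ← Real.rpow_add hn0]
    congr 2
    ring
  have h2 : Y ^ (2 + ε) ≤ 1 + Y ^ 4 := by
    rcases le_total Y 1 with h | h
    · have : Y ^ (2 + ε) ≤ 1 := Real.rpow_le_one hY h (by linarith)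
      nlinarith [pow_nonneg hY 4]
    · have : Y ^ (2 + ε) ≤ Y ^ 4 := by
        rw [← Real.rpow_natCast]
        exact Real.rpow_le_rpow_of_exponent_le h (by push_cast; linarith)
      linarith
  have h3 : ((n : ℝ) + 1) * (n : ℝ)⁻¹ ≤ 2 := by
    rw [← div_eq_mul_inv, div_le_iff₀ hn0]; linarith
  have h4 : 0 ≤ (n : ℝ) ^ (-(ε / 2)) := Real.rpow_nonneg hn0.le _
  rw [Finset.sum_const, Finset.card_univ, Fintype.card_fin, nsmul_eq_mul, h1]
  push_cast
  calc ((n : ℝ) + 1) * (Y ^ (2 + ε) * (n : ℝ) ^ (-(ε / 2)) * (n : ℝ)⁻¹) =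
      (((n : ℝ) + 1) * (n : ℝ)⁻¹) * (n : ℝ) ^ (-(ε / 2)) * Y ^ (2 + ε) := by ring
    _ ≤ 2 * (n : ℝ) ^ (-(ε / 2)) * (1 + Y ^ 4) := by
      have h5 : 0 ≤ Y ^ (2 + ε) := Real.rpow_nonneg hY _
      exact mul_le_mul (mul_le_mul_of_nonneg_right h3 h4) h2 h5 (by positivity)

/-- By independence both sides are products of factors of modulus at most one, so the difference
telescopes. The at most N₀ unmatched indices cost O(Y n^(-1/2)) each, the others O((Y
n^(-1/2))^(2+ε)). -/
theorem norm_integral_exp_re_sum_sub_le {Ω Ω' : Type*} [MeasurableSpace Ω]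
    [MeasurableSpace Ω'] {P : Measure Ω} {P' : Measure Ω'} [IsProbabilityMeasure P]
    [IsProbabilityMeasure P'] {n : ℕ} (hn : 0 < n) {ξ : Fin (n + 1) → Ω → ℂ}
    {ξ' : Fin (n + 1) → Ω' → ℂ} {N₀ : ℕ} {τ ε : ℝ} (hε₀ : 0 < ε) (hε₁ : ε < 1) (hτ : 0 < τ)
    (h : MomentMatching P P' ξ ξ' N₀ τ ε) (b : Fin (n + 1) → ℂ) {Y : ℝ} (hY : 0 ≤ Y)
    (hb : ∀ j, ‖b j‖ ≤ Y / √n) :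
    ‖∫ ω, Complex.exp (((∑ j, ξ j ω * b j).re : ℝ) * Complex.I) ∂P -
      ∫ ω, Complex.exp (((∑ j, ξ' j ω * b j).re : ℝ) * Complex.I) ∂P'‖ ≤
      (2 * N₀ * (2 + τ) + 16 * τ) * ((n : ℝ) ^ (-(ε / 2)) * (1 + Y ^ 4)) := by
  have hn0 : (0 : ℝ) < n := by exact_mod_cast hn
  have hn1 : (1 : ℝ) ≤ n := by exact_mod_cast hn
  have hpow : 0 ≤ (n : ℝ) ^ (-(ε / 2)) := Real.rpow_nonneg hn0.le _
  rw [integral_exp_re_sum_eq_prod h.left.measurable h.left.indep,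
    integral_exp_re_sum_eq_prod h.right.measurable h.right.indep]
  refine (norm_prod_sub_prod_le _ _ _ (fun _ _ => norm_integral_exp_le_one _)
    fun _ _ => norm_integral_exp_le_one _).trans ?_
  have hYn : 0 ≤ Y / √n := by positivity
  have hterm : ∀ j : Fin (n + 1),
      ‖∫ ω, Complex.exp (((ξ j ω * b j).re : ℝ) * Complex.I) ∂P -
        ∫ ω, Complex.exp (((ξ' j ω * b j).re : ℝ) * Complex.I) ∂P'‖ ≤
      (if (j : ℕ) < N₀ then 2 * (2 + τ) * (Y / √n) else 0) + 8 * τ * (Y / √n) ^ (2 + ε) := by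
    intro j
    split_ifs with hj
    · have h1 := norm_integral_exp_sub_one_le (h.left.measurable j) hε₀
        (h.left.moment_integrable j) (h.left.moment_le j) (b j)
      have h2 := norm_integral_exp_sub_one_le (h.right.measurable j) hε₀
        (h.right.moment_integrable j) (h.right.moment_le j) (b j)
      rw [norm_sub_rev] at h2
      refine (norm_sub_le_norm_sub_add_norm_sub _ 1 _).trans ((add_le_add h1 h2).trans ?_)
      have h3 : (2 + τ) * ‖b j‖ ≤ (2 + τ) * (Y / √n) :=
        mul_le_mul_of_nonneg_left (hb j) (by linarith)
      have h4 : 0 ≤ 8 * τ * (Y / √n) ^ (2 + ε) := by positivity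
      linarith
    · rw [zero_add]
      refine (norm_integral_exp_sub_integral_exp_le hε₀ hε₁ (h.left.measurable j)
        (h.left.moment_integrable j) (h.left.moment_le j) (h.right.measurable j)
        (h.right.moment_integrable j) (h.right.moment_le j)
        (fun a b hab => h.matching j (not_lt.1 hj) a b hab) (b j)).trans ?_
      have := Real.rpow_le_rpow (norm_nonneg _) (hb j) (by linarith : (0 : ℝ) ≤ 2 + ε)
      exact mul_le_mul_of_nonneg_left this (by linarith)
  refine (Finset.sum_le_sum fun j _ => hterm j).trans ?_
  rw [Finset.sum_add_distrib, ← Finset.mul_sum]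
  have hS1 : ∑ j : Fin (n + 1), (if (j : ℕ) < N₀ then 2 * (2 + τ) * (Y / √n) else 0) ≤
      2 * N₀ * (2 + τ) * ((n : ℝ) ^ (-(ε / 2)) * (1 + Y ^ 4)) := by
    rw [← Finset.sum_filter, Finset.sum_const, nsmul_eq_mul]
    have hcard : ((Finset.univ.filter fun j : Fin (n + 1) => (j : ℕ) < N₀).card : ℝ) ≤ N₀ := by
      have := Finset.card_le_card_of_injOn (s := Finset.univ.filter fun j : Fin (n + 1) =>
        (j : ℕ) < N₀) (t := Finset.range N₀) (fun j => (j : ℕ)) (by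
          intro j hj
          simpa using hj) (Fin.val_injective.injOn)
      rw [Finset.card_range] at this
      exact_mod_cast this
    have hYle : Y / √n ≤ (n : ℝ) ^ (-(ε / 2)) * (1 + Y ^ 4) := by
      have e1 : Y / √n = (n : ℝ) ^ (-(1 / 2 : ℝ)) * Y := by
        rw [Real.rpow_neg hn0.le, ← Real.sqrt_eq_rpow, div_eq_inv_mul]
      rw [e1]
      refine mul_le_mul (Real.rpow_le_rpow_of_exponent_le hn1 (by linarith)) ?_ hY hpow
      nlinarith [sq_nonneg (Y ^ 2 - 1), sq_nonneg (Y - 1)]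
    calc _ ≤ (N₀ : ℝ) * (2 * (2 + τ) * ((n : ℝ) ^ (-(ε / 2)) * (1 + Y ^ 4))) :=
          mul_le_mul hcard (mul_le_mul_of_nonneg_left hYle (by linarith)) (by positivity)
            (Nat.cast_nonneg _)
      _ = _ := by ring
  have hS2 := mul_le_mul_of_nonneg_left (sum_rpow_div_sqrt_le hn hε₀ hε₁ hY)
    (by positivity : 0 ≤ 8 * τ)
  refine (add_le_add hS1 hS2).trans (le_of_eq ?_)
  ring

/-! ### Gaussian linearisation and the comparison of Laplace transforms -/

/-- The standard Gaussian measure on the plane. -/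
noncomputable def gaussianPlane : Measure (ℝ × ℝ) := (gaussianReal 0 1).prod (gaussianReal 0 1)

instance : IsProbabilityMeasure gaussianPlane := by
  unfold gaussianPlane; infer_instance

/-- The identification of the plane with `ℂ` sending `g` to `g.1 - i g.2`. -/
noncomputable def planeToComplex (g : ℝ × ℝ) : ℂ := g.1 - g.2 * Complex.I

@[fun_prop]
theorem continuous_planeToComplex : Continuous planeToComplex := by
  unfold planeToComplex; fun_prop

@[fun_prop]
theorem measurable_planeToComplex : Measurable planeToComplex :=
  continuous_planeToComplex.measurable

theorem re_mul_planeToComplex (y : ℂ) (g : ℝ × ℝ) :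
    (y * planeToComplex g).re = y.re * g.1 + y.im * g.2 := by
  simp [planeToComplex]

theorem norm_planeToComplex_sq (g : ℝ × ℝ) : ‖planeToComplex g‖ ^ 2 = g.1 ^ 2 + g.2 ^ 2 := by
  rw [← Complex.normSq_eq_norm_sq, Complex.normSq_apply]
  simp [planeToComplex]
  ring

theorem integral_exp_mul_I_gaussianReal (t : ℝ) :
    ∫ g, Complex.exp (((t * g : ℝ) : ℂ) * Complex.I) ∂(gaussianReal 0 1) =
      Complex.exp (-(t ^ 2 / 2 : ℝ)) := by
  have := charFun_gaussianReal (μ := 0) (v := 1) t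
  rw [charFun_apply_real] at this
  simp only [Complex.ofReal_zero, mul_zero, zero_mul, NNReal.coe_one, Complex.ofReal_one,
    one_mul, zero_sub] at this
  push_cast
  exact this

/-- The linearization identity: a Gaussian in |y| is an average of characters that are linear in y,
at variance 2s. -/
theorem integral_exp_re_gaussianPlane (y : ℂ) {s : ℝ} (hs : 0 ≤ s) :
    ∫ g, Complex.exp (((y * (√(2 * s) * planeToComplex g)).re : ℝ) * Complex.I) ∂gaussianPlane =
      Complex.exp (-(s * ‖y‖ ^ 2 : ℝ)) := by
  have h1 : ∀ g : ℝ × ℝ, Complex.exp (((y * (√(2 * s) * planeToComplex g)).re : ℝ) * Complex.I) =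
      Complex.exp (((√(2 * s) * y.re * g.1 : ℝ) : ℂ) * Complex.I) *
      Complex.exp (((√(2 * s) * y.im * g.2 : ℝ) : ℂ) * Complex.I) := by
    intro g
    have : y * (√(2 * s) * planeToComplex g) = ((√(2 * s) : ℝ) : ℂ) * (y * planeToComplex g) := by
      ring
    rw [← Complex.exp_add, this, Complex.re_ofReal_mul, re_mul_planeToComplex]
    push_cast
    ring_nf
  simp_rw [h1]
  rw [gaussianPlane, integral_prod_mul
    (fun g : ℝ => Complex.exp (((√(2 * s) * y.re * g : ℝ) : ℂ) * Complex.I))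
    (fun g : ℝ => Complex.exp (((√(2 * s) * y.im * g : ℝ) : ℂ) * Complex.I)),
    integral_exp_mul_I_gaussianReal, integral_exp_mul_I_gaussianReal, ← Complex.exp_add]
  congr 1
  have h2 : √(2 * s) ^ 2 = 2 * s := Real.sq_sqrt (by positivity)
  rw [← Complex.normSq_eq_norm_sq, Complex.normSq_apply, mul_pow, mul_pow, h2]
  push_cast
  ring

theorem integrable_pow_gaussianReal (m : ℕ) :
    Integrable (fun g : ℝ => g ^ m) (gaussianReal 0 1) := by
  have := (memLp_id_gaussianReal (μ := 0) (v := 1) m).integrable_norm_pow'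
  refine this.mono' (by fun_prop) (ae_of_all _ fun g => ?_)
  simp

theorem integrable_norm_planeToComplex_pow_four :
    Integrable (fun g => ‖planeToComplex g‖ ^ 4) gaussianPlane := by
  have h1 : Integrable (fun g : ℝ × ℝ => 2 * g.1 ^ 4 + 2 * g.2 ^ 4) gaussianPlane :=
    (((integrable_pow_gaussianReal 4).comp_fst _).const_mul 2).add
      (((integrable_pow_gaussianReal 4).comp_snd _).const_mul 2)
  refine h1.mono' (by fun_prop) (ae_of_all _ fun g => ?_)
  rw [Real.norm_eq_abs, abs_of_nonneg (by positivity)]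
  have : ‖planeToComplex g‖ ^ 4 = (‖planeToComplex g‖ ^ 2) ^ 2 := by ring
  rw [this, norm_planeToComplex_sq]
  nlinarith [sq_nonneg (g.1 ^ 2 - g.2 ^ 2)]

theorem integral_exp_re_sum_gaussianPlane {ι : Type*} [Fintype ι] (y : ι → ℂ) {s : ι → ℝ}
    (hs : ∀ i, 0 ≤ s i) :
    ∫ g, Complex.exp (((∑ i, y i * (√(2 * s i) * planeToComplex (g i))).re : ℝ) * Complex.I)
      ∂(Measure.pi fun _ : ι => gaussianPlane) =
      ((Real.exp (-∑ i, s i * ‖y i‖ ^ 2) : ℝ) : ℂ) := by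
  have h1 : ∀ g : ι → ℝ × ℝ,
      Complex.exp (((∑ i, y i * (√(2 * s i) * planeToComplex (g i))).re : ℝ) * Complex.I) =
      ∏ i, Complex.exp (((y i * (√(2 * s i) * planeToComplex (g i))).re : ℝ) * Complex.I) := by
    intro g
    rw [← Complex.exp_sum, Complex.re_sum, Complex.ofReal_sum, Finset.sum_mul]
  simp_rw [h1]
  rw [integral_fintype_prod_eq_prod (fun i (g : ℝ × ℝ) =>
    Complex.exp (((y i * (√(2 * s i) * planeToComplex g)).re : ℝ) * Complex.I))]
  simp_rw [integral_exp_re_gaussianPlane _ (hs _)]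
  rw [← Complex.exp_sum, Complex.ofReal_exp, Complex.ofReal_neg, Complex.ofReal_sum,
    Finset.sum_neg_distrib]

/-- The fourth moment of the total length of the Gaussian directions. -/
theorem integral_one_add_sum_pow_four_le {ι : Type*} [Fintype ι] [Nonempty ι] (L : ℝ)
    {s : ι → ℝ} (hs : ∀ i, 0 ≤ s i) :
    Integrable (fun g : ι → ℝ × ℝ => 1 + (L * ∑ i, √(2 * s i) * ‖planeToComplex (g i)‖) ^ 4)
      (Measure.pi fun _ : ι => gaussianPlane) ∧
    ∫ g, (1 + (L * ∑ i, √(2 * s i) * ‖planeToComplex (g i)‖) ^ 4)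
      ∂(Measure.pi fun _ : ι => gaussianPlane) ≤
      (1 + L ^ 4 * (Fintype.card ι) ^ 4 * (4 * ∫ g, ‖planeToComplex g‖ ^ 4 ∂gaussianPlane)) *
        ∏ i, (1 + s i) ^ 2 := by
  set m := ∫ g, ‖planeToComplex g‖ ^ 4 ∂gaussianPlane with hm
  have hm0 : 0 ≤ m := integral_nonneg fun _ => by positivity
  set N : ℝ := ((Fintype.card ι : ℕ) : ℝ)
  have hN : 0 < N := by
    have := Fintype.card_pos (α := ι)
    exact Nat.cast_pos.2 this
  have hpt : ∀ g : ι → ℝ × ℝ, 1 + (L * ∑ i, √(2 * s i) * ‖planeToComplex (g i)‖) ^ 4 ≤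
      1 + L ^ 4 * N ^ 3 * ∑ i, 4 * s i ^ 2 * ‖planeToComplex (g i)‖ ^ 4 := by
    intro g
    have h1 := pow_sum_div_card_le_sum_pow (s := Finset.univ)
      (f := fun i => √(2 * s i) * ‖planeToComplex (g i)‖) (fun i _ => by positivity) 3
    rw [div_le_iff₀ (by rw [Finset.card_univ]; positivity), Finset.card_univ] at h1
    have h2 : ∀ i, (√(2 * s i) * ‖planeToComplex (g i)‖) ^ (3 + 1) =
        4 * s i ^ 2 * ‖planeToComplex (g i)‖ ^ 4 := by
      intro i
      have : √(2 * s i) ^ 4 = (√(2 * s i) ^ 2) ^ 2 := by ring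
      rw [mul_pow, this, Real.sq_sqrt (by have := hs i; positivity)]
      ring
    simp_rw [h2] at h1
    rw [mul_pow]
    have h3 : 0 ≤ L ^ 4 := by positivity
    have := mul_le_mul_of_nonneg_left h1 h3
    refine add_le_add le_rfl (this.trans (le_of_eq ?_))
    ring
  have hint : ∀ i, Integrable (fun g : ι → ℝ × ℝ => 4 * s i ^ 2 * ‖planeToComplex (g i)‖ ^ 4)
      (Measure.pi fun _ : ι => gaussianPlane) := fun i =>
    (integrable_comp_eval (μ := fun _ : ι => gaussianPlane) (i := i)
      integrable_norm_planeToComplex_pow_four).const_mul _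
  have hint2 : Integrable (fun g : ι → ℝ × ℝ =>
      L ^ 4 * N ^ 3 * ∑ i, 4 * s i ^ 2 * ‖planeToComplex (g i)‖ ^ 4)
      (Measure.pi fun _ : ι => gaussianPlane) :=
    (integrable_finsetSum _ fun i _ => hint i).const_mul _
  have hint3 : Integrable (fun g : ι → ℝ × ℝ =>
      1 + L ^ 4 * N ^ 3 * ∑ i, 4 * s i ^ 2 * ‖planeToComplex (g i)‖ ^ 4)
      (Measure.pi fun _ : ι => gaussianPlane) := (integrable_const _).add hint2
  have hint4 : Integrable (fun g : ι → ℝ × ℝ =>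
      1 + (L * ∑ i, √(2 * s i) * ‖planeToComplex (g i)‖) ^ 4)
      (Measure.pi fun _ : ι => gaussianPlane) := by
    refine hint3.mono' (Measurable.aestronglyMeasurable (by fun_prop)) (ae_of_all _ fun g => ?_)
    rw [Real.norm_eq_abs, abs_of_nonneg (by positivity)]
    exact hpt g
  refine ⟨hint4, (integral_mono hint4 hint3 hpt).trans ?_⟩
  rw [integral_add (integrable_const _) hint2, integral_const_mul,
    integral_finsetSum _ fun i _ => hint i]
  have hval : ∀ i, ∫ g : ι → ℝ × ℝ, 4 * s i ^ 2 * ‖planeToComplex (g i)‖ ^ 4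
      ∂(Measure.pi fun _ : ι => gaussianPlane) = 4 * s i ^ 2 * m := by
    intro i
    rw [integral_const_mul, hm]
    congr 1
    exact integral_comp_eval (μ := fun _ : ι => gaussianPlane) (i := i)
      (f := fun g => ‖planeToComplex g‖ ^ 4) (by fun_prop)
  simp_rw [hval]
  have hfac : ∀ i, (1 : ℝ) ≤ (1 + s i) ^ 2 := fun i => by nlinarith [hs i]
  have hprod1 : (1 : ℝ) ≤ ∏ i, (1 + s i) ^ 2 :=
    Finset.prod_induction _ (fun x : ℝ => 1 ≤ x) (fun _ _ => one_le_mul_of_one_le_of_one_le) le_rfl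
      fun i _ => hfac i
  -- Only a sum of the s_i² is needed, but the product form lets the later integration over the
  -- parameters s_i factor.
  have hsi : ∀ i, s i ^ 2 ≤ ∏ i, (1 + s i) ^ 2 := by
    intro i
    classical
    rw [← Finset.mul_prod_erase _ _ (Finset.mem_univ i)]
    have h6 : (1 : ℝ) ≤ ∏ j ∈ Finset.univ.erase i, (1 + s j) ^ 2 :=
      Finset.prod_induction _ (fun x : ℝ => 1 ≤ x)
        (fun _ _ => one_le_mul_of_one_le_of_one_le) le_rfl fun i _ => hfac i
    nlinarith [hs i, hfac i]
  have hsum : ∑ i, 4 * s i ^ 2 * m ≤ N * (4 * (∏ i, (1 + s i) ^ 2) * m) := by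
    have := Finset.sum_le_card_nsmul Finset.univ (fun i => 4 * s i ^ 2 * m)
      (4 * (∏ i, (1 + s i) ^ 2) * m) (fun i _ => by
        have := hsi i
        gcongr)
    rwa [nsmul_eq_mul] at this
  have h5 := mul_le_mul_of_nonneg_left hsum (by positivity : 0 ≤ L ^ 4 * N ^ 3)
  simp only [integral_const, probReal_univ, smul_eq_mul, mul_one]
  nlinarith

theorem integral_exp_neg_sum_eq {ι Ω : Type*} [Fintype ι] [MeasurableSpace Ω] (P : Measure Ω)
    [IsProbabilityMeasure P] {n : ℕ} {η : Fin n → Ω → ℂ} (hη : ∀ i, Measurable (η i))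
    (A : ι → Fin n → ℂ) {s : ι → ℝ} (hs : ∀ i, 0 ≤ s i) :
    ((∫ ω, Real.exp (-∑ i, s i * ‖∑ j, η j ω * A i j‖ ^ 2) ∂P : ℝ) : ℂ) =
      ∫ g, ∫ ω, Complex.exp (((∑ j, η j ω *
        (∑ i, A i j * (√(2 * s i) * planeToComplex (g i)))).re : ℝ) * Complex.I) ∂P
        ∂(Measure.pi fun _ : ι => gaussianPlane) := by
  rw [integral_integral_swap, ← integral_complex_ofReal]
  · refine integral_congr_ae (ae_of_all _ fun ω => ?_)
    simp only
    rw [← integral_exp_re_sum_gaussianPlane _ hs]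
    refine integral_congr_ae (ae_of_all _ fun g => ?_)
    simp only
    congr 4
    simp_rw [Finset.sum_mul, Finset.mul_sum]
    rw [Finset.sum_comm]
    refine Finset.sum_congr rfl fun _ _ => Finset.sum_congr rfl fun _ _ => ?_
    ring
  · refine Integrable.of_bound (Measurable.aestronglyMeasurable ?_) 1 (ae_of_all _ fun q => ?_)
    · simp only [Function.uncurry_def]
      fun_prop
    · simp only [Function.uncurry]
      rw [Complex.norm_exp_ofReal_mul_I]

theorem integrable_integral_exp_re {ι Ω : Type*} [Fintype ι] [MeasurableSpace Ω] (P : Measure Ω)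
    [IsProbabilityMeasure P] {n : ℕ} {η : Fin n → Ω → ℂ} (hη : ∀ i, Measurable (η i))
    (A : ι → Fin n → ℂ) (s : ι → ℝ) :
    Integrable (fun g => ∫ ω, Complex.exp (((∑ j, η j ω *
      (∑ i, A i j * (√(2 * s i) * planeToComplex (g i)))).re : ℝ) * Complex.I) ∂P)
      (Measure.pi fun _ : ι => gaussianPlane) := by
  refine Integrable.of_bound ?_ 1 (ae_of_all _ fun g => norm_integral_exp_le_one _)
  refine (StronglyMeasurable.integral_prod_right (f := fun (g : ι → ℝ × ℝ) ω =>
    Complex.exp (((∑ j, η j ω *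
      (∑ i, A i j * (√(2 * s i) * planeToComplex (g i)))).re : ℝ) * Complex.I))
    (Measurable.stronglyMeasurable ?_)).aestronglyMeasurable
  simp only [Function.uncurry_def]
  fun_prop

/-- Under moment matching the joint Laplace transforms of `|y_i|²` are close. -/
theorem exists_laplace_comparison (ι : Type*) [Fintype ι] [Nonempty ι] (N₀ : ℕ) {τ ε L : ℝ}
    (hτ : 0 < τ) (hε₀ : 0 < ε) (hε₁ : ε < 1) (hL : 0 < L) :
    ∃ B : ℝ, 0 < B ∧ ∀ (n : ℕ), 0 < n → ∀ (Ω : Type u) (Ω' : Type v) [MeasurableSpace Ω]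
      [MeasurableSpace Ω'] (P : Measure Ω) (P' : Measure Ω') [IsProbabilityMeasure P]
      [IsProbabilityMeasure P'] (ξ : Fin (n + 1) → Ω → ℂ) (ξ' : Fin (n + 1) → Ω' → ℂ),
      MomentMatching P P' ξ ξ' N₀ τ ε → ∀ A : ι → Fin (n + 1) → ℂ, (∀ i j, ‖A i j‖ ≤ L / √n) →
      ∀ s : ι → ℝ, (∀ i, 0 ≤ s i) →
      |∫ ω, Real.exp (-∑ i, s i * ‖∑ j, ξ j ω * A i j‖ ^ 2) ∂P -
        ∫ ω, Real.exp (-∑ i, s i * ‖∑ j, ξ' j ω * A i j‖ ^ 2) ∂P'| ≤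
        B * (n : ℝ) ^ (-(ε / 2)) * ∏ i, (1 + s i) ^ 2 := by
  set m := ∫ g, ‖planeToComplex g‖ ^ 4 ∂gaussianPlane with hm
  have hm0 : 0 ≤ m := integral_nonneg fun _ => by positivity
  refine ⟨(2 * N₀ * (2 + τ) + 16 * τ) * (1 + L ^ 4 * (Fintype.card ι) ^ 4 * (4 * m)),
    by positivity, ?_⟩
  intro n hn Ω Ω' _ _ P P' _ _ ξ ξ' h A hA s hs
  set Γ := Measure.pi fun _ : ι => gaussianPlane
  have hbound : ∀ g : ι → ℝ × ℝ, ∀ j : Fin (n + 1),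
      ‖∑ i, A i j * (√(2 * s i) * planeToComplex (g i))‖ ≤
        (L * ∑ i, √(2 * s i) * ‖planeToComplex (g i)‖) / √n := by
    intro g j
    refine (norm_sum_le _ _).trans ?_
    rw [mul_div_right_comm, Finset.mul_sum]
    refine Finset.sum_le_sum fun i _ => ?_
    rw [norm_mul, norm_mul, Complex.norm_real, Real.norm_eq_abs, abs_of_nonneg (Real.sqrt_nonneg _)]
    exact mul_le_mul_of_nonneg_right (hA i j) (by positivity)
  obtain ⟨hi, hle⟩ := integral_one_add_sum_pow_four_le L hs
  have hi1 : Integrable (fun g => ∫ ω, Complex.exp (((∑ j, ξ j ω *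
      (∑ i, A i j * (√(2 * s i) * planeToComplex (g i)))).re : ℝ) * Complex.I) ∂P) Γ :=
    integrable_integral_exp_re P h.left.measurable A s
  have hi2 : Integrable (fun g => ∫ ω, Complex.exp (((∑ j, ξ' j ω *
      (∑ i, A i j * (√(2 * s i) * planeToComplex (g i)))).re : ℝ) * Complex.I) ∂P') Γ :=
    integrable_integral_exp_re P' h.right.measurable A s
  rw [← Real.norm_eq_abs, ← Complex.norm_real, Complex.ofReal_sub,
    integral_exp_neg_sum_eq P h.left.measurable A hs,
    integral_exp_neg_sum_eq P' h.right.measurable A hs, ← integral_sub hi1 hi2]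
  refine (norm_integral_le_of_norm_le (hi.const_mul ((2 * N₀ * (2 + τ) + 16 * τ) *
    (n : ℝ) ^ (-(ε / 2)))) (ae_of_all _ fun g => ?_)).trans ?_
  · rw [mul_assoc]
    exact norm_integral_exp_re_sum_sub_le hn hε₀ hε₁ hτ h _ (by positivity) (hbound g)
  · rw [integral_const_mul]
    have hn0 : 0 ≤ (n : ℝ) ^ (-(ε / 2)) := Real.rpow_nonneg (Nat.cast_nonneg _) _
    refine (mul_le_mul_of_nonneg_left hle (by positivity)).trans (le_of_eq ?_)
    ring

/-! ### Small ball estimates -/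

theorem integral_exp_neg_mul_sq_gaussianReal_le {a : ℝ} (ha : 0 < a) :
    ∫ g, Real.exp (-a * g ^ 2) ∂(gaussianReal 0 1) ≤ √(Real.pi / a) := by
  rw [integral_gaussianReal_eq_integral_smul one_ne_zero, ← integral_gaussian]
  have hpdf : ∀ x, gaussianPDFReal 0 1 x ≤ 1 := by
    intro x
    rw [gaussianPDFReal_def]
    have h1 : Real.exp (-(x - 0) ^ 2 / (2 * ((1 : NNReal) : ℝ))) ≤ 1 := by
      rw [Real.exp_le_one_iff]
      have : 0 ≤ (x - 0) ^ 2 / (2 * ((1 : NNReal) : ℝ)) := by positivity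
      rw [neg_div]; linarith
    have h2 : (√(2 * Real.pi * ((1 : NNReal) : ℝ)))⁻¹ ≤ 1 := by
      refine inv_le_one_of_one_le₀ ?_
      rw [Real.one_le_sqrt]
      have := Real.pi_gt_three
      simp
      linarith
    exact mul_le_one₀ h2 (Real.exp_nonneg _) h1
  refine integral_mono_of_nonneg (ae_of_all _ fun x => ?_) (integrable_exp_neg_mul_sq ha)
    (ae_of_all _ fun x => ?_)
  · exact mul_nonneg (gaussianPDFReal_nonneg _ _ _) (Real.exp_nonneg _)
  · exact mul_le_of_le_one_left (Real.exp_nonneg _) (hpdf x)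

section Center

variable {Ω : Type*} [MeasurableSpace Ω] {P : Measure Ω} [IsProbabilityMeasure P] {X : Ω → ℂ}
  {τ ε : ℝ}

/-- Modulus of a characteristic function, compared with the Gaussian one. -/
theorem exists_norm_integral_exp_le (hX : Measurable X) (hε₀ : 0 < ε) (hε₁ : ε < 1)
    (hi : Integrable (fun ω => ‖X ω‖ ^ (2 + ε)) P) (hτ : ∫ ω, ‖X ω‖ ^ (2 + ε) ∂P ≤ τ)
    (hv : ∫ ω, ‖X ω - ∫ ω', X ω' ∂P‖ ^ 2 ∂P = 1) (b : ℂ) :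
    ∃ ψ : ℂ, ‖ψ‖ = ‖∫ ω, Complex.exp (((X ω * b).re : ℝ) * Complex.I) ∂P‖ ∧ ‖ψ‖ ≤ 1 ∧
      ‖ψ - Real.exp (-(∫ ω, ((X ω - ∫ ω', X ω' ∂P) * b).re ^ 2 ∂P) / 2)‖ ≤
        (32 * (τ + (2 + τ) ^ 3) + 1) * ‖b‖ ^ (2 + ε) := by
  set m := ∫ ω', X ω' ∂P with hm
  have hL := memLp_two_of_moment hX hε₀ hi
  obtain ⟨hi2, hτ2⟩ := moment_sub_mean hX hε₀ hε₁ hi hτ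
  have h0 : ∫ ω, (X ω - m) ∂P = 0 := by
    rw [integral_sub (hL.integrable (by norm_num)) (integrable_const _)]
    simp [hm]
  have hX' : Measurable fun ω => X ω - m := hX.sub_const m
  -- Centring multiplies the characteristic function by a unimodular constant, so moduli can be
  -- compared although the means are not zero.
  refine ⟨∫ ω, Complex.exp ((((X ω - m) * b).re : ℝ) * Complex.I) ∂P, ?_,
    norm_integral_exp_le_one _, ?_⟩
  · have h1 : ∀ ω, Complex.exp (((X ω * b).re : ℝ) * Complex.I) =
        Complex.exp (((m * b).re : ℝ) * Complex.I) *
          Complex.exp ((((X ω - m) * b).re : ℝ) * Complex.I) := by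
      intro ω
      rw [← Complex.exp_add, ← add_mul, ← Complex.ofReal_add, ← Complex.add_re]
      congr 4
      ring
    simp_rw [h1]
    rw [integral_const_mul, norm_mul, Complex.norm_exp_ofReal_mul_I, one_mul]
  · refine (norm_integral_exp_sub_gaussian_le hX' hε₀ hε₁ hi2 hτ2 h0 hv b).trans (le_of_eq ?_)
    ring

end Center

/-- One of the two directions carries half of the variance. -/
theorem integral_sq_re_add_integral_sq_re {Ω : Type*} [MeasurableSpace Ω] {P : Measure Ω}
    {X : Ω → ℂ} (hL : MemLp X 2 P) (hv : ∫ ω, ‖X ω‖ ^ 2 ∂P = 1) (b : ℂ) :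
    ∫ ω, (X ω * (b * 1)).re ^ 2 ∂P + ∫ ω, (X ω * (b * (-Complex.I))).re ^ 2 ∂P = ‖b‖ ^ 2 := by
  have i1 : Integrable (fun ω => (X ω * (b * 1)).re ^ 2) P := (hL.mul_const _).re.integrable_sq
  have i2 : Integrable (fun ω => (X ω * (b * (-Complex.I))).re ^ 2) P :=
    (hL.mul_const _).re.integrable_sq
  rw [← integral_add i1 i2]
  have : ∀ ω, (X ω * (b * 1)).re ^ 2 + (X ω * (b * (-Complex.I))).re ^ 2 =
      ‖X ω‖ ^ 2 * ‖b‖ ^ 2 := by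
    intro ω
    rw [← mul_pow, ← norm_mul, ← Complex.normSq_eq_norm_sq, Complex.normSq_apply]
    have : X ω * (b * (-Complex.I)) = -(X ω * b * Complex.I) := by ring
    rw [this, mul_one, Complex.neg_re, Complex.mul_I_re]
    ring
  refine (integral_congr_ae (ae_of_all _ this)).trans ?_
  rw [integral_mul_const, hv, one_mul]

theorem integral_exp_neg_mul_sq_eq {Ω : Type*} [MeasurableSpace Ω] {P : Measure Ω}
    [IsProbabilityMeasure P] {u : Ω → ℝ} (hu : Measurable u) {s : ℝ} (hs : 0 ≤ s) :
    ((∫ ω, Real.exp (-(s * u ω ^ 2)) ∂P : ℝ) : ℂ) =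
      ∫ g, ∫ ω, Complex.exp (((√(2 * s) * g * u ω : ℝ) : ℂ) * Complex.I) ∂P
        ∂(gaussianReal 0 1) := by
  rw [integral_integral_swap, ← integral_complex_ofReal]
  · refine integral_congr_ae (ae_of_all _ fun ω => ?_)
    have h1 := integral_exp_mul_I_gaussianReal (√(2 * s) * u ω)
    have h2 : √(2 * s) ^ 2 = 2 * s := Real.sq_sqrt (by positivity)
    have h3 : ((√(2 * s) * u ω) ^ 2 / 2 : ℝ) = s * u ω ^ 2 := by rw [mul_pow, h2]; ring
    rw [h3] at h1
    simp only [Complex.ofReal_exp, Complex.ofReal_neg]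
    rw [← h1]
    refine integral_congr_ae (ae_of_all _ fun g => ?_)
    simp only
    rw [mul_right_comm]
  · refine Integrable.of_bound (Measurable.aestronglyMeasurable ?_) 1 (ae_of_all _ fun q => ?_)
    · simp only [Function.uncurry_def]
      fun_prop
    · simp only [Function.uncurry]
      rw [Complex.norm_exp_ofReal_mul_I]

/-- Keep only the real part of the sum in a direction of large variance and average over a real
Gaussian g of variance 2s. The characteristic function is e^(-sκg²/2) up to n^(-ε/2)(1 + s²g⁴). The
Gaussian main term integrates to O(s^(-1/2)), the error to O(s² n^(-ε/2)). -/
theorem exists_small_ball {τ ε L κ : ℝ} (hτ : 0 < τ) (hε₀ : 0 < ε) (hε₁ : ε < 1)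
    (hL : 0 < L) (hκ : 0 < κ) :
    ∃ B : ℝ, 0 < B ∧ ∀ (n : ℕ), 0 < n → ∀ (Ω : Type u) [MeasurableSpace Ω]
      (P : Measure Ω) [IsProbabilityMeasure P] (ξ : Fin (n + 1) → Ω → ℂ),
      HasBoundedMoments P ξ τ ε → ∀ A : Fin (n + 1) → ℂ, (∀ j, ‖A j‖ ≤ L / √n) →
      κ ≤ ∑ j, ‖A j‖ ^ 2 → ∀ s : ℝ, 1 ≤ s →
      ∫ ω, Real.exp (-(s * ‖∑ j, ξ j ω * A j‖ ^ 2)) ∂P ≤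
        B * ((√s)⁻¹ + s ^ 2 * (n : ℝ) ^ (-(ε / 2))) := by
  set m := ∫ g, g ^ 4 ∂(gaussianReal 0 1) with hm
  have hm0 : 0 ≤ m := integral_nonneg fun _ => by positivity
  set D := 32 * (τ + (2 + τ) ^ 3) + 1 with hD
  have hD0 : 0 < D := by positivity
  refine ⟨√(2 * Real.pi / κ) + 2 * D * (1 + 4 * L ^ 4 * m), by positivity, ?_⟩
  intro n hn Ω _ P _ ξ h A hA hAκ s hs
  have hn0 : (0 : ℝ) < n := by exact_mod_cast hn
  have hs0 : 0 < s := by linarith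
  set X : Fin (n + 1) → Ω → ℂ := fun j ω => ξ j ω - ∫ ω', ξ j ω' ∂P with hX
  have hXL : ∀ j, MemLp (X j) 2 P := fun j =>
    (memLp_two_of_moment (h.measurable j) hε₀ (h.moment_integrable j)).sub (memLp_const _)
  -- The ξ_j may be degenerate in some direction, for instance real. The directions 1 and -i
  -- together carry ∑|A_j|² ≥ κ, so one of them carries at least κ/2.
  obtain ⟨θ, hθ, hV⟩ : ∃ θ : ℂ, ‖θ‖ = 1 ∧
      κ / 2 ≤ ∑ j, ∫ ω, (X j ω * (A j * θ)).re ^ 2 ∂P := by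
    have h1 : ∑ j, ∫ ω, (X j ω * (A j * 1)).re ^ 2 ∂P +
        ∑ j, ∫ ω, (X j ω * (A j * (-Complex.I))).re ^ 2 ∂P = ∑ j, ‖A j‖ ^ 2 := by
      rw [← Finset.sum_add_distrib]
      exact Finset.sum_congr rfl fun j _ =>
        integral_sq_re_add_integral_sq_re (hXL j) (h.unit_variance j) (A j)
    by_cases hc : κ / 2 ≤ ∑ j, ∫ ω, (X j ω * (A j * 1)).re ^ 2 ∂P
    · exact ⟨1, by simp, hc⟩
    · exact ⟨-Complex.I, by simp, by push Not at hc; linarith⟩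
  set V := ∑ j, ∫ ω, (X j ω * (A j * θ)).re ^ 2 ∂P with hVdef
  have hmeas : ∀ j, Measurable (ξ j) := h.measurable
  have hstep1 : ∫ ω, Real.exp (-(s * ‖∑ j, ξ j ω * A j‖ ^ 2)) ∂P ≤
      ∫ ω, Real.exp (-(s * (∑ j, ξ j ω * (A j * θ)).re ^ 2)) ∂P := by
    have hb : ∀ u : Ω → ℝ, Measurable u → Integrable (fun ω => Real.exp (-(s * u ω ^ 2))) P := by
      intro u hu
      refine Integrable.of_bound (by fun_prop) 1 (ae_of_all _ fun ω => ?_)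
      rw [Real.norm_eq_abs, abs_of_nonneg (Real.exp_nonneg _), Real.exp_le_one_iff]
      have : 0 ≤ s * u ω ^ 2 := by positivity
      linarith
    refine integral_mono (hb _ (by fun_prop)) (hb _ (by fun_prop)) fun ω => ?_
    simp only
    rw [Real.exp_le_exp, neg_le_neg_iff]
    refine mul_le_mul_of_nonneg_left ?_ hs0.le
    have h2 : ∑ j, ξ j ω * (A j * θ) = (∑ j, ξ j ω * A j) * θ := by
      rw [Finset.sum_mul]
      exact Finset.sum_congr rfl fun _ _ => by ring
    have h3 := Complex.abs_re_le_norm ((∑ j, ξ j ω * A j) * θ)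
    rw [norm_mul, hθ, mul_one] at h3
    rw [h2, ← sq_abs]
    gcongr
  refine hstep1.trans ?_
  have hrep := integral_exp_neg_mul_sq_eq (P := P) (u := fun ω => (∑ j, ξ j ω * (A j * θ)).re)
    (by fun_prop) hs0.le
  set b : ℝ → Fin (n + 1) → ℂ := fun g j => ((√(2 * s) * g : ℝ) : ℂ) * (A j * θ) with hb
  have hbb : ∀ g j, ‖b g j‖ ≤ (L * √(2 * s) * |g|) / √n := by
    intro g j
    rw [hb]
    simp only
    rw [norm_mul, norm_mul, hθ, mul_one, Complex.norm_real, Real.norm_eq_abs, abs_mul,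
      abs_of_nonneg (Real.sqrt_nonneg _)]
    calc √(2 * s) * |g| * ‖A j‖ ≤ √(2 * s) * |g| * (L / √n) := by
          exact mul_le_mul_of_nonneg_left (hA j) (by positivity)
      _ = _ := by ring
  have hpt : ∀ g : ℝ, ‖∫ ω, Complex.exp (((√(2 * s) * g * (∑ j, ξ j ω * (A j * θ)).re : ℝ) : ℂ) *
      Complex.I) ∂P‖ ≤ Real.exp (-(s * (κ / 2)) * g ^ 2) +
        2 * D * (n : ℝ) ^ (-(ε / 2)) * (1 + 4 * L ^ 4 * s ^ 2 * g ^ 4) := by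
    intro g
    have e1 : ∀ ω, (√(2 * s) * g * (∑ j, ξ j ω * (A j * θ)).re : ℝ) = (∑ j, ξ j ω * b g j).re := by
      intro ω
      rw [← Complex.re_ofReal_mul, Finset.mul_sum]
      congr 1
      exact Finset.sum_congr rfl fun j _ => by rw [hb]; ring
    simp_rw [e1]
    rw [integral_exp_re_sum_eq_prod h.measurable h.indep, norm_prod]
    choose ψ hψ1 hψ2 hψ3 using fun j => exists_norm_integral_exp_le (h.measurable j) hε₀ hε₁
      (h.moment_integrable j) (h.moment_le j) (h.unit_variance j) (b g j)
    simp_rw [← hψ1]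
    have hv : ∀ j, ∫ ω, (X j ω * b g j).re ^ 2 ∂P =
        2 * s * g ^ 2 * ∫ ω, (X j ω * (A j * θ)).re ^ 2 ∂P := by
      intro j
      rw [← integral_const_mul]
      refine integral_congr_ae (ae_of_all _ fun ω => ?_)
      simp only [hb]
      have h1 : X j ω * (((√(2 * s) * g : ℝ) : ℂ) * (A j * θ)) =
        ((√(2 * s) * g : ℝ) : ℂ) * (X j ω * (A j * θ)) := by ring
      have h2 : √(2 * s) ^ 2 = 2 * s := Real.sq_sqrt (by positivity)
      rw [h1, Complex.re_ofReal_mul, mul_pow, mul_pow, h2]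
    have htel := norm_prod_sub_prod_le Finset.univ ψ
      (fun j => ((Real.exp (-(∫ ω, (X j ω * b g j).re ^ 2 ∂P) / 2) : ℝ) : ℂ))
      (fun j _ => hψ2 j) (fun j _ => by
        rw [Complex.norm_real, Real.norm_eq_abs, abs_of_nonneg (Real.exp_nonneg _),
          Real.exp_le_one_iff]
        have : 0 ≤ ∫ ω, (X j ω * b g j).re ^ 2 ∂P := integral_nonneg fun _ => sq_nonneg _
        linarith)
    have hsum : ∑ j, ‖ψ j - ((Real.exp (-(∫ ω, (X j ω * b g j).re ^ 2 ∂P) / 2) : ℝ) : ℂ)‖ ≤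
        D * (2 * (n : ℝ) ^ (-(ε / 2)) * (1 + (L * √(2 * s) * |g|) ^ 4)) := by
      refine (Finset.sum_le_sum fun j _ => (hψ3 j).trans (mul_le_mul_of_nonneg_left
        (Real.rpow_le_rpow (norm_nonneg _) (hbb g j) (by linarith)) hD0.le)).trans ?_
      rw [← Finset.mul_sum]
      exact mul_le_mul_of_nonneg_left (sum_rpow_div_sqrt_le hn hε₀ hε₁ (by positivity)) hD0.le
    have hprod : ‖∏ j, ((Real.exp (-(∫ ω, (X j ω * b g j).re ^ 2 ∂P) / 2) : ℝ) : ℂ)‖ ≤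
        Real.exp (-(s * (κ / 2)) * g ^ 2) := by
      rw [← Complex.ofReal_prod, Complex.norm_real, ← Real.exp_sum, Real.norm_eq_abs,
        abs_of_nonneg (Real.exp_nonneg _), Real.exp_le_exp]
      simp_rw [hv]
      rw [← Finset.sum_div, Finset.sum_neg_distrib, ← Finset.mul_sum, ← hVdef]
      have : s * g ^ 2 * (κ / 2) ≤ s * g ^ 2 * V := mul_le_mul_of_nonneg_left hV (by positivity)
      linarith
    have h4 : (L * √(2 * s) * |g|) ^ 4 = 4 * L ^ 4 * s ^ 2 * g ^ 4 := by
      have h5 : √(2 * s) ^ 4 = (√(2 * s) ^ 2) ^ 2 := by ring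
      have h6 : |g| ^ 4 = (|g| ^ 2) ^ 2 := by ring
      rw [mul_pow, mul_pow, h5, Real.sq_sqrt (by positivity), h6, sq_abs]
      ring
    rw [h4] at hsum
    rw [← norm_prod]
    have h7 := norm_le_norm_add_norm_sub' (∏ j, ψ j)
      (∏ j, ((Real.exp (-(∫ ω, (X j ω * b g j).re ^ 2 ∂P) / 2) : ℝ) : ℂ))
    linarith
  have hi1 : Integrable (fun g : ℝ => Real.exp (-(s * (κ / 2)) * g ^ 2)) (gaussianReal 0 1) := by
    refine Integrable.of_bound (by fun_prop) 1 (ae_of_all _ fun g => ?_)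
    rw [Real.norm_eq_abs, abs_of_nonneg (Real.exp_nonneg _), Real.exp_le_one_iff]
    have : 0 ≤ s * (κ / 2) * g ^ 2 := by positivity
    linarith
  have hi2 : Integrable (fun g : ℝ => 4 * L ^ 4 * s ^ 2 * g ^ 4) (gaussianReal 0 1) :=
    (integrable_pow_gaussianReal 4).const_mul _
  have hi3 : Integrable (fun g : ℝ => 1 + 4 * L ^ 4 * s ^ 2 * g ^ 4) (gaussianReal 0 1) :=
    (integrable_const _).add hi2
  have hi4 : Integrable (fun g : ℝ => 2 * D * (n : ℝ) ^ (-(ε / 2)) *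
      (1 + 4 * L ^ 4 * s ^ 2 * g ^ 4)) (gaussianReal 0 1) := hi3.const_mul _
  have hfin := norm_integral_le_of_norm_le (hi1.add hi4) (ae_of_all _ hpt)
  rw [← hrep, Complex.norm_real] at hfin
  refine ((le_abs_self _).trans hfin).trans ?_
  have e5 := integral_add hi1 hi4
  refine (le_of_eq e5).trans ?_
  rw [integral_const_mul, integral_add (integrable_const _) hi2, integral_const_mul, ← hm]
  have h6 := integral_exp_neg_mul_sq_gaussianReal_le (a := s * (κ / 2)) (by positivity)
  have h7 : √(Real.pi / (s * (κ / 2))) = √(2 * Real.pi / κ) * (√s)⁻¹ := by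
    rw [← Real.sqrt_inv, ← Real.sqrt_mul (by positivity)]
    congr 1
    field_simp
  rw [h7] at h6
  simp only [integral_const, probReal_univ, smul_eq_mul, mul_one]
  have hp : 0 ≤ (n : ℝ) ^ (-(ε / 2)) := Real.rpow_nonneg hn0.le _
  have h8 : 1 + 4 * L ^ 4 * s ^ 2 * m ≤ (1 + 4 * L ^ 4 * m) * s ^ 2 := by nlinarith
  have h9 := mul_le_mul_of_nonneg_left h8 (by positivity : 0 ≤ 2 * D * (n : ℝ) ^ (-(ε / 2)))
  have h10 : 0 ≤ 2 * D * (1 + 4 * L ^ 4 * m) * (√s)⁻¹ := by positivity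
  have h11 : 0 ≤ √(2 * Real.pi / κ) * (s ^ 2 * (n : ℝ) ^ (-(ε / 2))) := by positivity
  linarith

/-! ### A regularized logarithm as a superposition of Gaussians -/

/-- The regularized logarithm `½ log ((|y|² + δ²) / (|y|² + Λ²))`. -/
noncomputable def regLog (δ Λ : ℝ) (y : ℂ) : ℝ :=
  (Real.log (‖y‖ ^ 2 + δ ^ 2) - Real.log (‖y‖ ^ 2 + Λ ^ 2)) / 2

/-- The parameter measure for `regLog`. -/
noncomputable def regLogMeasure (δ Λ : ℝ) : Measure (ℝ × ℝ) :=
  (volume.restrict (Set.Ioc (δ ^ 2) (Λ ^ 2))).prod (volume.restrict (Set.Ioi 0))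

instance (δ Λ : ℝ) : SigmaFinite (regLogMeasure δ Λ) := by
  unfold regLogMeasure; infer_instance

theorem regLogMeasure_ae (δ Λ : ℝ) : ∀ᵐ t ∂(regLogMeasure δ Λ), δ ^ 2 < t.1 ∧ 0 < t.2 := by
  rw [regLogMeasure, Measure.prod_restrict]
  filter_upwards [ae_restrict_mem (measurableSet_Ioc.prod measurableSet_Ioi)] with t ht
  exact ⟨ht.1.1, ht.2⟩

/-- The absolute values change nothing almost everywhere, as the measure lives on positive
parameters. They make the rates nonnegative at every point, so the Laplace comparison applies
without exceptional sets. -/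
theorem integrable_exp_rate_regLogMeasure {δ Λ c r : ℝ} (hδ : 0 < δ) (hc : 0 < c) (hr : 0 ≤ r) :
    Integrable (fun t : ℝ × ℝ => Real.exp (-(c * |t.2| * (r + |t.1|)))) (regLogMeasure δ Λ) := by
  have ha : 0 < δ ^ 2 := by positivity
  have hexp : Integrable (fun s : ℝ => Real.exp (-(c * δ ^ 2) * s))
      (volume.restrict (Set.Ioi 0)) :=
    integrableOn_exp_mul_Ioi (by have : 0 < c * δ ^ 2 := by positivity
                                 linarith) 0
  have hdom : Integrable (fun t : ℝ × ℝ => (1 : ℝ) * Real.exp (-(c * δ ^ 2) * t.2))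
      (regLogMeasure δ Λ) :=
    Integrable.mul_prod (f := fun _ : ℝ => (1 : ℝ)) (integrable_const _) hexp
  refine hdom.mono' (by fun_prop) ?_
  filter_upwards [regLogMeasure_ae δ Λ] with t ht
  rw [Real.norm_eq_abs, abs_of_nonneg (Real.exp_nonneg _), abs_of_pos ht.2,
    abs_of_pos (ha.trans ht.1), one_mul, Real.exp_le_exp]
  have h1 : δ ^ 2 ≤ r + t.1 := by linarith [ht.1]
  have h2 := mul_le_mul_of_nonneg_left h1 (mul_nonneg hc.le ht.2.le)
  linarith

theorem integral_exp_rate_regLogMeasure {δ Λ c r : ℝ} (hδ : 0 < δ) (hδΛ : δ ≤ Λ) (hc : 0 < c)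
    (hr : 0 ≤ r) :
    ∫ t, Real.exp (-(c * |t.2| * (r + |t.1|))) ∂(regLogMeasure δ Λ) =
      (Real.log (r + Λ ^ 2) - Real.log (r + δ ^ 2)) / c := by
  have ha : 0 < δ ^ 2 := by positivity
  have hΛ : 0 < Λ := hδ.trans_le hδΛ
  have hab : δ ^ 2 ≤ Λ ^ 2 := pow_le_pow_left₀ hδ.le hδΛ 2
  have hint := integrable_exp_rate_regLogMeasure (Λ := Λ) hδ hc hr
  rw [regLogMeasure] at hint ⊢
  rw [integral_prod _ hint]
  have h1 : ∫ v in Set.Ioc (δ ^ 2) (Λ ^ 2), ∫ s in Set.Ioi (0 : ℝ),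
      Real.exp (-(c * |s| * (r + |v|))) =
      ∫ v in Set.Ioc (δ ^ 2) (Λ ^ 2), (r + v)⁻¹ * c⁻¹ := by
    refine setIntegral_congr_fun measurableSet_Ioc fun v hv => ?_
    have hv0 : 0 < v := ha.trans hv.1
    have hcv : 0 < c * (r + v) := by positivity
    have h2 : ∫ s in Set.Ioi (0 : ℝ), Real.exp (-(c * |s| * (r + |v|))) =
        ∫ s in Set.Ioi (0 : ℝ), Real.exp (-(c * (r + v)) * s) := by
      refine setIntegral_congr_fun measurableSet_Ioi fun s hs => ?_
      rw [abs_of_pos hs, abs_of_pos hv0]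
      congr 1
      ring
    rw [h2, integral_exp_mul_Ioi (by linarith), mul_zero, Real.exp_zero]
    field_simp
  rw [h1, ← intervalIntegral.integral_of_le hab, intervalIntegral.integral_mul_const,
    intervalIntegral.integral_comp_add_left (fun v => v⁻¹), integral_inv_of_pos (by positivity)
      (by positivity), Real.log_div (by positivity) (by positivity), div_eq_mul_inv]

/-- Half of the exponential decay absorbs the polynomial factor; v ≥ δ² turns the loss into δ^(-4).
-/
theorem one_add_sq_mul_exp_le {δ s v : ℝ} (hδ : 0 < δ) (hδ1 : δ ≤ 1) (hv : δ ^ 2 ≤ v)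
    (hs : 0 ≤ s) :
    (1 + s) ^ 2 * Real.exp (-(s * v)) ≤ 18 * (δ ^ 4)⁻¹ * Real.exp (-(1 / 2 * s * v)) := by
  have hv0 : 0 < v := lt_of_lt_of_le (by positivity) hv
  have hd : 1 ≤ (δ ^ 4)⁻¹ := (one_le_inv₀ (by positivity)).2 (pow_le_one₀ hδ.le hδ1)
  have h1 : (s * v / 2) ^ 2 / 2 ≤ Real.exp (1 / 2 * s * v) := by
    have := Real.quadratic_le_exp_of_nonneg (x := 1 / 2 * s * v) (by positivity)
    nlinarith [mul_nonneg hs hv0.le]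
  have h2 : s ^ 2 ≤ 8 * (δ ^ 4)⁻¹ * Real.exp (1 / 2 * s * v) := by
    have h3 : δ ^ 4 * s ^ 2 ≤ 8 * Real.exp (1 / 2 * s * v) := by
      have : δ ^ 4 ≤ v ^ 2 := by
        calc δ ^ 4 = (δ ^ 2) ^ 2 := by ring
          _ ≤ v ^ 2 := pow_le_pow_left₀ (by positivity) hv 2
      nlinarith [mul_le_mul_of_nonneg_right this (sq_nonneg s)]
    rw [mul_comm (8 : ℝ), mul_assoc, ← div_eq_inv_mul, le_div_iff₀ (by positivity)]
    linarith
  have h4 : 1 ≤ Real.exp (1 / 2 * s * v) := Real.one_le_exp (by positivity)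
  have h5 : (1 + s) ^ 2 ≤ 18 * (δ ^ 4)⁻¹ * Real.exp (1 / 2 * s * v) := by
    have : 1 ≤ (δ ^ 4)⁻¹ * Real.exp (1 / 2 * s * v) := one_le_mul_of_one_le_of_one_le hd h4
    nlinarith [sq_nonneg (1 - s)]
  calc (1 + s) ^ 2 * Real.exp (-(s * v)) ≤
      18 * (δ ^ 4)⁻¹ * Real.exp (1 / 2 * s * v) * Real.exp (-(s * v)) :=
        mul_le_mul_of_nonneg_right h5 (Real.exp_nonneg _)
    _ = _ := by
        rw [mul_assoc, ← Real.exp_add]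
        congr 2
        ring

theorem integrable_sq_mul_exp_regLogMeasure {δ Λ : ℝ} (hδ : 0 < δ) (hδ1 : δ ≤ 1) (hΛ : 1 ≤ Λ) :
    Integrable (fun t : ℝ × ℝ => (1 + |t.2|) ^ 2 * Real.exp (-(|t.2| * |t.1|)))
      (regLogMeasure δ Λ) ∧
    ∫ t, (1 + |t.2|) ^ 2 * Real.exp (-(|t.2| * |t.1|)) ∂(regLogMeasure δ Λ) ≤
      72 * (δ ^ 4)⁻¹ * Real.log (Λ / δ) := by
  have hdom : Integrable (fun t : ℝ × ℝ => 18 * (δ ^ 4)⁻¹ *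
      Real.exp (-(1 / 2 * |t.2| * (0 + |t.1|)))) (regLogMeasure δ Λ) :=
    (integrable_exp_rate_regLogMeasure hδ (by norm_num) le_rfl).const_mul _
  have hle : ∀ᵐ t ∂(regLogMeasure δ Λ), (1 + |t.2|) ^ 2 * Real.exp (-(|t.2| * |t.1|)) ≤
      18 * (δ ^ 4)⁻¹ * Real.exp (-(1 / 2 * |t.2| * (0 + |t.1|))) := by
    filter_upwards [regLogMeasure_ae δ Λ] with t ht
    rw [zero_add]
    exact one_add_sq_mul_exp_le hδ hδ1 (ht.1.le.trans (le_abs_self _)) (abs_nonneg _)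
  have hint : Integrable (fun t : ℝ × ℝ => (1 + |t.2|) ^ 2 * Real.exp (-(|t.2| * |t.1|)))
      (regLogMeasure δ Λ) := by
    refine hdom.mono' (by fun_prop) ?_
    filter_upwards [hle] with t ht
    rwa [Real.norm_eq_abs, abs_of_nonneg (by positivity)]
  refine ⟨hint, (integral_mono_ae hint hdom hle).trans (le_of_eq ?_)⟩
  rw [integral_const_mul, integral_exp_rate_regLogMeasure hδ (hδ1.trans hΛ) (by norm_num) le_rfl,
    zero_add, zero_add, Real.log_pow, Real.log_pow, Real.log_div (by positivity) hδ.ne']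
  push_cast
  ring

theorem regLog_eq_integral {δ Λ : ℝ} (hδ : 0 < δ) (hδ1 : δ ≤ 1) (hΛ : 1 ≤ Λ) (y : ℂ) :
    regLog δ Λ y = (-1 / 2) *
      ∫ t, Real.exp (-(|t.2| * (‖y‖ ^ 2 + |t.1|))) ∂(regLogMeasure δ Λ) := by
  have := integral_exp_rate_regLogMeasure (c := 1) hδ (hδ1.trans hΛ) one_pos (sq_nonneg ‖y‖)
  simp only [one_mul, div_one] at this
  rw [this, regLog]
  ring

/-- A product of regularized logarithms is an integral over parameters (v_i, s_i) of joint Laplace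
transforms of the |y_i|². The comparison error ∏(1 + s_i)² is integrable against the weight ∏
e^(-s_i v_i), and the integral factors over i. -/
theorem exists_regLog_comparison (ι : Type*) [Fintype ι] [Nonempty ι] (N₀ : ℕ) {τ ε L : ℝ}
    (hτ : 0 < τ) (hε₀ : 0 < ε) (hε₁ : ε < 1) (hL : 0 < L) :
    ∃ B : ℝ, 0 < B ∧ ∀ (n : ℕ), 0 < n → ∀ (Ω : Type u) (Ω' : Type v) [MeasurableSpace Ω]
      [MeasurableSpace Ω'] (P : Measure Ω) (P' : Measure Ω') [IsProbabilityMeasure P]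
      [IsProbabilityMeasure P'] (ξ : Fin (n + 1) → Ω → ℂ) (ξ' : Fin (n + 1) → Ω' → ℂ),
      MomentMatching P P' ξ ξ' N₀ τ ε → ∀ A : ι → Fin (n + 1) → ℂ, (∀ i j, ‖A i j‖ ≤ L / √n) →
      ∀ δ Λ : ℝ, 0 < δ → δ ≤ 1 → 1 ≤ Λ →
      |∫ ω, ∏ i, regLog δ Λ (∑ j, ξ j ω * A i j) ∂P -
        ∫ ω, ∏ i, regLog δ Λ (∑ j, ξ' j ω * A i j) ∂P'| ≤
        B * (n : ℝ) ^ (-(ε / 2)) * (72 * (δ ^ 4)⁻¹ * Real.log (Λ / δ)) ^ Fintype.card ι := by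
  obtain ⟨B, hB, hcomp⟩ := exists_laplace_comparison ι N₀ hτ hε₀ hε₁ hL
  refine ⟨B, hB, ?_⟩
  intro n hn Ω Ω' _ _ P P' _ _ ξ ξ' h A hA δ Λ hδ hδ1 hΛ
  set ν := Measure.pi fun _ : ι => regLogMeasure δ Λ with hν
  obtain ⟨hI, hIle⟩ := integrable_sq_mul_exp_regLogMeasure hδ hδ1 hΛ
  have hrep : ∀ y : ι → ℂ, ∏ i, regLog δ Λ (y i) = (-1 / 2) ^ Fintype.card ι *
      ∫ t, Real.exp (-∑ i, |(t i).2| * |(t i).1|) *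
        Real.exp (-∑ i, |(t i).2| * ‖y i‖ ^ 2) ∂ν := by
    intro y
    simp_rw [regLog_eq_integral hδ hδ1 hΛ]
    rw [Finset.prod_mul_distrib, Finset.prod_const, Finset.card_univ, hν,
      ← integral_fintype_prod_eq_prod (fun i (t : ℝ × ℝ) =>
        Real.exp (-(|t.2| * (‖y i‖ ^ 2 + |t.1|))))]
    congr 1
    refine integral_congr_ae (ae_of_all _ fun t => ?_)
    simp only
    rw [← Real.exp_sum, ← Real.exp_add, ← neg_add, ← Finset.sum_add_distrib, Finset.sum_neg_distrib]
    congr 2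
    exact Finset.sum_congr rfl fun _ _ => by ring
  have hdom : Integrable (fun t : ι → ℝ × ℝ =>
      ∏ i, ((1 + |(t i).2|) ^ 2 * Real.exp (-(|(t i).2| * |(t i).1|)))) ν :=
    Integrable.fintype_prod fun _ => hI
  have hexple : ∀ t : ι → ℝ × ℝ, Real.exp (-∑ i, |(t i).2| * |(t i).1|) =
      ∏ i, Real.exp (-(|(t i).2| * |(t i).1|)) := by
    intro t
    rw [← Real.exp_sum, Finset.sum_neg_distrib]
  have hone : ∀ t : ι → ℝ × ℝ, (1 : ℝ) ≤ ∏ i, (1 + |(t i).2|) ^ 2 := fun t =>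
    Finset.prod_induction _ (fun x : ℝ => 1 ≤ x) (fun _ _ => one_le_mul_of_one_le_of_one_le) le_rfl
      fun i _ => by nlinarith [abs_nonneg (t i).2]
  have hweight : Integrable (fun t : ι → ℝ × ℝ => Real.exp (-∑ i, |(t i).2| * |(t i).1|)) ν := by
    refine hdom.mono' (Measurable.aestronglyMeasurable (by fun_prop)) (ae_of_all _ fun t => ?_)
    rw [Real.norm_eq_abs, abs_of_nonneg (Real.exp_nonneg _), Finset.prod_mul_distrib, hexple]
    exact le_mul_of_one_le_left (Finset.prod_nonneg fun _ _ => Real.exp_nonneg _) (hone t)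
  have hbd : ∀ (t : ι → ℝ × ℝ) (y : ι → ℂ), Real.exp (-∑ i, |(t i).2| * ‖y i‖ ^ 2) ≤ 1 := by
    intro t y
    rw [Real.exp_le_one_iff, neg_nonpos]
    exact Finset.sum_nonneg fun _ _ => by positivity
  have hm := h.left.measurable
  have hm' := h.right.measurable
  have hint : Integrable (Function.uncurry fun ω (t : ι → ℝ × ℝ) =>
      Real.exp (-∑ i, |(t i).2| * |(t i).1|) *
        Real.exp (-∑ i, |(t i).2| * ‖∑ j, ξ j ω * A i j‖ ^ 2)) (P.prod ν) := by
    refine (hweight.comp_snd P).mono' (Measurable.aestronglyMeasurable ?_) (ae_of_all _ fun q => ?_)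
    · simp only [Function.uncurry_def]
      fun_prop
    · simp only [Function.uncurry]
      rw [Real.norm_eq_abs, abs_of_nonneg (by positivity)]
      exact mul_le_of_le_one_right (Real.exp_nonneg _) (hbd _ _)
  have hint' : Integrable (Function.uncurry fun ω (t : ι → ℝ × ℝ) =>
      Real.exp (-∑ i, |(t i).2| * |(t i).1|) *
        Real.exp (-∑ i, |(t i).2| * ‖∑ j, ξ' j ω * A i j‖ ^ 2)) (P'.prod ν) := by
    refine (hweight.comp_snd P').mono' (Measurable.aestronglyMeasurable ?_)
      (ae_of_all _ fun q => ?_)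
    · simp only [Function.uncurry_def]
      fun_prop
    · simp only [Function.uncurry]
      rw [Real.norm_eq_abs, abs_of_nonneg (by positivity)]
      exact mul_le_of_le_one_right (Real.exp_nonneg _) (hbd _ _)
  have hir := hint.integral_prod_right
  have hir' := hint'.integral_prod_right
  simp only [Function.uncurry_apply_pair] at hir hir'
  simp_rw [hrep]
  rw [integral_const_mul, integral_const_mul, integral_integral_swap hint,
    integral_integral_swap hint', ← mul_sub, ← integral_sub hir hir', abs_mul]
  have hhalf : |((-1 : ℝ) / 2) ^ Fintype.card ι| ≤ 1 := by
    rw [abs_pow]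
    exact pow_le_one₀ (abs_nonneg _) (by norm_num [abs_le])
  refine (mul_le_of_le_one_left (abs_nonneg _) hhalf).trans ?_
  rw [← Real.norm_eq_abs]
  refine (norm_integral_le_of_norm_le (hdom.const_mul (B * (n : ℝ) ^ (-(ε / 2))))
    (ae_of_all _ fun t => ?_)).trans ?_
  · rw [integral_const_mul, integral_const_mul, ← mul_sub, norm_mul, Real.norm_eq_abs,
      Real.norm_eq_abs, abs_of_nonneg (Real.exp_nonneg _), Finset.prod_mul_distrib, hexple]
    refine (mul_le_mul_of_nonneg_left (hcomp n hn Ω Ω' P P' ξ ξ' h A hA (fun i => |(t i).2|)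
      fun i => abs_nonneg _) (Finset.prod_nonneg fun _ _ => Real.exp_nonneg _)).trans (le_of_eq ?_)
    ring
  · rw [integral_const_mul, hν, integral_fintype_prod_eq_prod (fun _ (t : ℝ × ℝ) =>
      (1 + |t.2|) ^ 2 * Real.exp (-(|t.2| * |t.1|))), Finset.prod_const, Finset.card_univ]
    have hn0 : 0 ≤ (n : ℝ) ^ (-(ε / 2)) := Real.rpow_nonneg (Nat.cast_nonneg _) _
    refine mul_le_mul_of_nonneg_left (pow_le_pow_left₀ (integral_nonneg fun t => ?_) hIle _)
      (by positivity)
    positivity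

/-! ### Non-concentration -/

theorem norm_sq_le_sq_add_rpow {x T ε : ℝ} (hx : 0 ≤ x) (hT : 0 < T) (hε₀ : 0 < ε) :
    x ^ 2 ≤ T ^ 2 + T ^ (-ε) * x ^ (2 + ε) := by
  have h0 : 0 ≤ T ^ (-ε) * x ^ (2 + ε) :=
    mul_nonneg (Real.rpow_nonneg hT.le _) (Real.rpow_nonneg hx _)
  rcases le_total x T with h | h
  · nlinarith
  · have hx0 : 0 < x := hT.trans_le h
    have h1 : x ^ (2 + ε) = x ^ 2 * x ^ ε := by
      rw [Real.rpow_add hx0]; norm_cast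
    have h2 : 1 ≤ T ^ (-ε) * x ^ ε := by
      rw [Real.rpow_neg hT.le, ← div_eq_inv_mul, one_le_div (Real.rpow_pos_of_pos hT _)]
      exact Real.rpow_le_rpow hT.le h hε₀.le
    rw [h1]
    nlinarith [mul_le_mul_of_nonneg_left h2 (sq_nonneg x), sq_nonneg T]

/-- A variable of variance one with bounded `2 + ε` moment does not concentrate. -/
theorem exists_measureReal_closedBall_le {τ ε : ℝ} (hτ : 0 < τ) (hε₀ : 0 < ε) :
    ∃ q : ℝ, 0 < q ∧ q < 1 ∧ ∀ (Ω : Type u) [MeasurableSpace Ω] (P : Measure Ω)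
      [IsProbabilityMeasure P] (X : Ω → ℂ), Measurable X →
      Integrable (fun ω => ‖X ω‖ ^ (2 + ε)) P → ∫ ω, ‖X ω‖ ^ (2 + ε) ∂P ≤ τ →
      ∫ ω, ‖X ω - ∫ ω', X ω' ∂P‖ ^ 2 ∂P = 1 →
      ∀ z, P.real {ω | ‖X ω - z‖ ≤ 1 / 2} ≤ q := by
  -- Truncation level for which the tail of the second moment is at most T^(-ε)τ = 1/8.
  set T : ℝ := (8 * τ) ^ (1 / ε) with hTdef
  have hT : 0 < T := Real.rpow_pos_of_pos (by positivity) _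
  have hTε : T ^ (-ε) * τ = 1 / 8 := by
    rw [hTdef, ← Real.rpow_mul (by positivity)]
    have : 1 / ε * -ε = -1 := by field_simp
    rw [this, Real.rpow_neg_one]
    field_simp
  set Z : ℝ := 3 + 2 * τ with hZ
  have hden : 0 < 4 * (T ^ 2 + Z ^ 2) := by positivity
  have hden1 : 1 < 4 * (T ^ 2 + Z ^ 2) := by nlinarith [sq_nonneg T]
  refine ⟨max (1 / 2) (1 - 1 / (4 * (T ^ 2 + Z ^ 2))), by positivity,
    max_lt (by norm_num) (by have : 0 < 1 / (4 * (T ^ 2 + Z ^ 2)) := by positivity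
                             linarith), ?_⟩
  intro Ω _ P _ X hX hi hτi hv z
  have hL := memLp_two_of_moment hX hε₀ hi
  have hX2 := (memLp_two_iff_integrable_sq_norm hX.aestronglyMeasurable).1 hL
  have hX2le := integral_sq_norm_le_of_moment hX hε₀ hi hτi
  have hSm : MeasurableSet {ω | ‖X ω - z‖ ≤ 1 / 2} :=
    measurableSet_le (hX.sub_const z).norm measurable_const
  -- For |z| > Z, closeness to z forces |X| to be large and Markov gives 1/2. For |z| ≤ Z, the
  -- second moment of X - z is at least 1, while the small disc and the tail contribute at most 1/4
  -- each. The remaining 1/2 must come from the complement of the disc, where the truncated part is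
  -- at most 2(T² + Z²).
  rcases le_or_gt ‖z‖ Z with hz | hz
  · refine le_max_of_le_right ?_
    set S := {ω | ‖X ω - z‖ ≤ 1 / 2} with hS
    set m := ∫ ω', X ω' ∂P with hm
    have hXi : Integrable X P := hL.integrable (by norm_num)
    have hvar : 1 ≤ ∫ ω, ‖X ω - z‖ ^ 2 ∂P := by
      have hpt : ∀ ω, ‖X ω - z‖ ^ 2 = ‖X ω - m‖ ^ 2 +
          (2 * ((X ω - m) * (starRingEnd ℂ) (m - z)).re + ‖m - z‖ ^ 2) := by
        intro ω
        have : X ω - z = (X ω - m) + (m - z) := by ring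
        rw [this, ← Complex.normSq_eq_norm_sq, ← Complex.normSq_eq_norm_sq,
          ← Complex.normSq_eq_norm_sq, Complex.normSq_add]
        ring
      have i1 : Integrable (fun ω => ‖X ω - m‖ ^ 2) P :=
        (memLp_two_iff_integrable_sq_norm (hX.sub_const m).aestronglyMeasurable).1
          (hL.sub (memLp_const m))
      have i2' : Integrable (fun ω => (X ω - m) * (starRingEnd ℂ) (m - z)) P :=
        (hXi.sub (integrable_const m)).mul_const _
      have i2 : Integrable (fun ω => 2 * ((X ω - m) * (starRingEnd ℂ) (m - z)).re) P :=
        i2'.re.const_mul 2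
      have i3 : Integrable (fun ω => 2 * ((X ω - m) * (starRingEnd ℂ) (m - z)).re +
          ‖m - z‖ ^ 2) P := i2.add (integrable_const _)
      have hre : ∫ ω, ((X ω - m) * (starRingEnd ℂ) (m - z)).re ∂P = 0 := by
        have h3 := integral_re i2'
        rw [integral_mul_const, integral_sub hXi (integrable_const _)] at h3
        simpa [← hm] using h3
      simp_rw [hpt]
      rw [integral_add i1 i3, hv, integral_add i2 (integrable_const _), integral_const_mul, hre]
      simp
    have hup : ∀ ω, ‖X ω - z‖ ^ 2 ≤ 1 / 4 + (Sᶜ.indicator (fun _ => 2 * (T ^ 2 + Z ^ 2)) ω +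
        2 * T ^ (-ε) * ‖X ω‖ ^ (2 + ε)) := by
      intro ω
      have hnn : 0 ≤ 2 * T ^ (-ε) * ‖X ω‖ ^ (2 + ε) := by positivity
      by_cases hω : ω ∈ S
      · have : ‖X ω - z‖ ≤ 1 / 2 := hω
        rw [Set.indicator_of_notMem (by simpa using hω)]
        nlinarith [norm_nonneg (X ω - z)]
      · rw [Set.indicator_of_mem (by simpa using hω)]
        have h1 := norm_sub_le (X ω) z
        have h2 := norm_sq_le_sq_add_rpow (norm_nonneg (X ω)) hT hε₀
        have h3 : ‖X ω - z‖ ^ 2 ≤ 2 * ‖X ω‖ ^ 2 + 2 * ‖z‖ ^ 2 := by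
          nlinarith [norm_nonneg (X ω - z), sq_nonneg (‖X ω‖ - ‖z‖), norm_nonneg (X ω),
            norm_nonneg z]
        have h4 : ‖z‖ ^ 2 ≤ Z ^ 2 := by gcongr
        linarith
    have j1 : Integrable (Sᶜ.indicator (fun _ : Ω => 2 * (T ^ 2 + Z ^ 2))) P :=
      (integrable_const _).indicator hSm.compl
    have j2 : Integrable (fun ω => 2 * T ^ (-ε) * ‖X ω‖ ^ (2 + ε)) P := hi.const_mul _
    have j3 : Integrable (fun ω => Sᶜ.indicator (fun _ => 2 * (T ^ 2 + Z ^ 2)) ω +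
        2 * T ^ (-ε) * ‖X ω‖ ^ (2 + ε)) P := j1.add j2
    have hfin := hvar.trans (integral_mono_of_nonneg (ae_of_all _ fun ω => sq_nonneg _)
      ((integrable_const (1 / 4 : ℝ)).add j3) (ae_of_all _ hup))
    have e1 := integral_add (integrable_const (1 / 4 : ℝ)) j3 (μ := P)
    have hfin2 := hfin.trans (le_of_eq e1)
    rw [integral_add j1 j2, integral_const_mul, integral_indicator_const _ hSm.compl,
      probReal_compl_eq_one_sub hSm] at hfin2
    simp only [integral_const, probReal_univ, smul_eq_mul, one_mul] at hfin2
    have h5 : 2 * T ^ (-ε) * ∫ ω, ‖X ω‖ ^ (2 + ε) ∂P ≤ 1 / 4 := by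
      have := mul_le_mul_of_nonneg_left hτi (by positivity : 0 ≤ 2 * T ^ (-ε))
      linarith
    have h6 : 1 / 2 ≤ (1 - P.real S) * (2 * (T ^ 2 + Z ^ 2)) := by linarith
    have h7 : 1 / (4 * (T ^ 2 + Z ^ 2)) ≤ 1 - P.real S := by
      rw [div_le_iff₀ hden]; linarith
    linarith
  · refine le_max_of_le_left ?_
    have hsub : {ω | ‖X ω - z‖ ≤ 1 / 2} ⊆ {ω | (Z - 1 / 2) ^ 2 ≤ ‖X ω‖ ^ 2} := by
      intro ω hω
      have h1 : ‖X ω - z‖ ≤ 1 / 2 := hω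
      have h2 : ‖z‖ ≤ ‖X ω‖ + ‖X ω - z‖ := norm_le_insert _ _
      have h3 : Z - 1 / 2 ≤ ‖X ω‖ := by linarith
      exact pow_le_pow_left₀ (by linarith) h3 2
    have hmk := mul_meas_ge_le_integral_of_nonneg (μ := P) (ae_of_all _ fun ω => sq_nonneg ‖X ω‖)
      hX2 ((Z - 1 / 2) ^ 2)
    have h4 : P.real {ω | ‖X ω - z‖ ≤ 1 / 2} ≤ P.real {ω | (Z - 1 / 2) ^ 2 ≤ ‖X ω‖ ^ 2} :=
      measureReal_mono hsub
    have h5 : 0 ≤ P.real {ω | (Z - 1 / 2) ^ 2 ≤ ‖X ω‖ ^ 2} := measureReal_nonneg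
    have h6 : 2 * (1 + τ) ≤ (Z - 1 / 2) ^ 2 := by nlinarith
    nlinarith

/-- A set whose slices have small diameter has small product measure. -/
theorem measure_pi_le_of_slices {ι : Type*} [Fintype ι] (ν : ι → Measure ℂ)
    [∀ i, IsProbabilityMeasure (ν i)] (p : ι → Prop) [DecidablePred p] {S : Set (ι → ℂ)}
    (hS : MeasurableSet S) {r : ℝ} {q : ENNReal}
    (hq : ∀ i, p i → ∀ z, ν i (Metric.closedBall z r) ≤ q)
    (hslice : ∀ u ∈ S, ∀ v ∈ S, (∀ i, ¬ p i → u i = v i) → ∀ i, p i → ‖u i - v i‖ ≤ r) :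
    Measure.pi ν S ≤ q ^ Fintype.card {i // p i} := by
  have hmp := (measurePreserving_piEquivPiSubtypeProd ν p).symm
  rw [← hmp.measure_preimage hS.nullMeasurableSet]
  set S' := (MeasurableEquiv.piEquivPiSubtypeProd (fun _ => ℂ) p).symm ⁻¹' S with hS'
  have hS'm : MeasurableSet S' := (MeasurableEquiv.measurable _) hS
  rw [Measure.prod_apply_symm hS'm]
  calc _ ≤ ∫⁻ _, q ^ Fintype.card {i // p i} ∂(Measure.pi fun i : {i // ¬ p i} => ν i) := by
        refine lintegral_mono fun y => ?_
        rcases Set.eq_empty_or_nonempty ((fun x => (x, y)) ⁻¹' S') with h | ⟨x₀, hx₀⟩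
        · rw [h]; simp
        -- A nonempty slice lies in the product of the discs centred at the coordinates of any one
        -- of its points.
        · have hsub : (fun x => (x, y)) ⁻¹' S' ⊆
              Set.univ.pi fun i => Metric.closedBall (x₀ i) r := by
            intro x hx i _
            rw [Metric.mem_closedBall, dist_eq_norm]
            have := hslice _ hx _ hx₀ (fun j hj => by
              simp [MeasurableEquiv.piEquivPiSubtypeProd, Equiv.piEquivPiSubtypeProd, hj]) i i.2
            simpa [MeasurableEquiv.piEquivPiSubtypeProd, Equiv.piEquivPiSubtypeProd, i.2] using this
          refine (measure_mono hsub).trans ?_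
          rw [Measure.pi_pi]
          exact Finset.prod_le_pow_card Finset.univ (fun i : {i // p i} =>
            ν i (Metric.closedBall (x₀ i) r)) q fun i _ => hq i.1 i.2 _
    _ = _ := by simp

section Nodes

variable {K : Set ℝ} {μ : Measure ℝ} {w : ℝ → ℝ} {p : ℕ → ℝ[X]}

theorem eval_orthoPoly_ofReal {n : ℕ} (u : Fin (n + 1) → ℂ) (x : ℝ) :
    (orthoPoly p u).eval (x : ℂ) = ∑ j : Fin (n + 1), u j * ((p j).eval x : ℝ) := by
  rw [eval_orthoPoly]
  simp_rw [aeval_complex_ofReal]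

@[fun_prop]
theorem measurable_eval_orthoPoly {α : Type*} [MeasurableSpace α] {n : ℕ}
    {u : α → Fin (n + 1) → ℂ} (hu : ∀ j, Measurable fun t => u t j) {z : α → ℂ}
    (hz : Measurable z) : Measurable fun t => (orthoPoly p (u t)).eval (z t) := by
  simp_rw [eval_orthoPoly]
  refine Finset.measurable_fun_sum _ fun j _ => (hu j).mul ?_
  have : Continuous fun y : ℂ => Polynomial.aeval y (p j) := (p j).continuous_aeval
  exact this.measurable.comp hz

/-- The probability that the random polynomial is small at many nodes. -/
theorem IsAdmissibleMeasure.measureReal_forall_norm_eval_le (h : IsAdmissibleMeasure K μ w p)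
    {Ω : Type*} [MeasurableSpace Ω] {P : Measure Ω} [IsProbabilityMeasure P] {n : ℕ}
    {ξ : Fin (n + 1) → Ω → ℂ} (hm : ∀ i, Measurable (ξ i)) (hind : iIndepFun ξ P) {q : ℝ}
    (hq0 : 0 ≤ q) (hq : ∀ i z, P.real {ω | ‖ξ i ω - z‖ ≤ 1 / 2} ≤ q) {D η ρ x : ℝ} (hρ : 0 < ρ)
    {M : ℕ} (hM : M ≤ n + 1) (hDK : ∀ t ∈ K, ∀ l < M, |t - (x + l * ρ)| ≤ D) (hDρ : ρ ≤ D)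
    (hsmall : M * (2 * η) * (D / ρ) ^ M * (μ.real Set.univ + 1) ≤ 1 / 2) :
    P.real {ω | ∀ l < M, ‖(orthoPoly p fun j => ξ j ω).eval ((x + l * ρ : ℝ) : ℂ)‖ ≤ η} ≤
      q ^ M := by
  set S : Set (Fin (n + 1) → ℂ) :=
    {u | ∀ l < M, ‖(orthoPoly p u).eval ((x + l * ρ : ℝ) : ℂ)‖ ≤ η} with hSdef
  have hS : MeasurableSet S := by
    have : S = ⋂ l : ℕ, ⋂ _ : l < M,
        {u | ‖(orthoPoly p u).eval ((x + l * ρ : ℝ) : ℂ)‖ ≤ η} := by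
      ext u; simp [hSdef]
    rw [this]
    refine MeasurableSet.iInter fun l => MeasurableSet.iInter fun _ => ?_
    exact measurableSet_le (measurable_eval_orthoPoly (fun j => measurable_pi_apply j)
      measurable_const).norm measurable_const
  have hprob : ∀ i, IsProbabilityMeasure (P.map (ξ i)) := fun i =>
    Measure.isProbabilityMeasure_map (hm i).aemeasurable
  have hball : ∀ i : Fin (n + 1), (i : ℕ) < M → ∀ z, P.map (ξ i) (Metric.closedBall z (1 / 2)) ≤
      ENNReal.ofReal q := by
    intro i _ z
    rw [Measure.map_apply (hm i) Metric.isClosed_closedBall.measurableSet]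
    have := hq i z
    rw [measureReal_def] at this
    refine (ENNReal.le_ofReal_iff_toReal_le (measure_ne_top _ _) hq0).2 (le_trans (le_of_eq ?_) this)
    congr 2
    ext ω
    simp [dist_eq_norm]
  -- For two such vectors the difference of the polynomials involves only the first M coefficients
  -- and is at most 2η at M nodes, so interpolation forces these coefficients to agree within 1/2.
  have hslice : ∀ u ∈ S, ∀ v ∈ S, (∀ i : Fin (n + 1), ¬ (i : ℕ) < M → u i = v i) →
      ∀ i : Fin (n + 1), (i : ℕ) < M → ‖u i - v i‖ ≤ 1 / 2 := by
    intro u hu v hv huv i hi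
    set c : ℕ → ℂ := fun j => if hj : j < n + 1 then u ⟨j, hj⟩ - v ⟨j, hj⟩ else 0 with hc
    have hci : ∀ j : Fin (n + 1), c j = u j - v j := by
      intro j
      rw [hc]
      exact dif_pos j.2
    rw [← hci]
    refine (h.norm_coeff_le_of_norm_sum_le hρ hDK hDρ c (η := 2 * η) ?_ hi).trans hsmall
    intro l hl
    have h1 : ∑ j ∈ Finset.range M, c j * ((p j).eval (x + l * ρ) : ℝ) =
        (orthoPoly p u).eval ((x + l * ρ : ℝ) : ℂ) -
          (orthoPoly p v).eval ((x + l * ρ : ℝ) : ℂ) := by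
      rw [eval_orthoPoly_ofReal, eval_orthoPoly_ofReal, ← Finset.sum_sub_distrib]
      simp_rw [← sub_mul, ← hci]
      rw [Fin.sum_univ_eq_sum_range (fun j => c j * ((p j).eval (x + l * ρ) : ℝ)) (n + 1)]
      refine Finset.sum_subset (Finset.range_mono hM) fun j hj hjM => ?_
      have hj' : j < n + 1 := Finset.mem_range.1 hj
      have := hci ⟨j, hj'⟩
      rw [huv ⟨j, hj'⟩ (by simpa using hjM), sub_self] at this
      simp only at this
      rw [this, zero_mul]
    rw [h1]
    refine (norm_sub_le _ _).trans ?_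
    have := hu l hl
    have := hv l hl
    linarith
  have hmain := measure_pi_le_of_slices (fun i => P.map (ξ i)) (fun i => (i : ℕ) < M) hS hball hslice
  rw [← hind.map_fun_eq_pi_map fun i => (hm i).aemeasurable,
    Measure.map_apply (measurable_pi_lambda _ hm) hS, Fintype.card_fin_lt_of_le hM,
    ← ENNReal.ofReal_pow hq0] at hmain
  exact ENNReal.toReal_le_of_le_ofReal (by positivity) hmain

end Nodes

/-! ### The event on which the logarithm is square integrable with a good bound -/

theorem eventually_mul_sq_log_le_rpow (B : ℝ) {θ : ℝ} (hθ : 0 < θ) :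
    ∀ᶠ n : ℕ in Filter.atTop, B * Real.log n ^ 2 ≤ (n : ℝ) ^ θ := by
  have h1 := (isLittleO_log_rpow_rpow_atTop 2 hθ).bound
    (show (0 : ℝ) < (|B| + 1)⁻¹ by positivity)
  filter_upwards [tendsto_natCast_atTop_atTop.eventually h1,
    Filter.eventually_ge_atTop 1] with n hn hn1
  have hn1' : (1 : ℝ) ≤ n := by exact_mod_cast hn1
  have hlog := Real.log_nonneg hn1'
  rw [Real.norm_eq_abs, Real.norm_eq_abs, abs_of_nonneg (Real.rpow_nonneg hlog _),
    abs_of_nonneg (Real.rpow_nonneg (by linarith) _), Real.rpow_two, inv_mul_eq_div,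
    le_div_iff₀ (by positivity)] at hn
  nlinarith [le_abs_self B, sq_nonneg (Real.log n)]

set_option maxHeartbeats 1000000 in
/-- With overwhelming probability `log |F|` is square integrable near a given point, with the
expected bound. -/
theorem IsAdmissibleMeasure.exists_good_event {K : Set ℝ} {μ : Measure ℝ} {w : ℝ → ℝ}
    {p : ℕ → ℝ[X]} (h : IsAdmissibleMeasure K μ w p) {a b d C₀ κ c₁ : ℝ}
    (hLB : LocalBounds p a b d C₀ κ c₁) {τ ε : ℝ} (hτ : 0 < τ) (hε₀ : 0 < ε) {c : ℝ} (hc : 0 < c)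
    (hcd : 65 * c ≤ d) :
    ∃ B : ℝ, 0 < B ∧ ∀ A θ : ℝ, 0 < A → 0 < θ → ∃ n₀ : ℕ, ∀ n : ℕ, n₀ ≤ n →
      ∀ (Ω : Type u) [MeasurableSpace Ω] (P : Measure Ω) [IsProbabilityMeasure P]
        (ξ : Fin (n + 1) → Ω → ℂ), HasBoundedMoments P ξ τ ε → ∀ x ∈ Set.Icc a b,
      ∃ E : Set Ω, MeasurableSet E ∧ P.real Eᶜ ≤ (n : ℝ) ^ (-A) ∧ ∀ ω ∈ E,
        IntegrableOn (fun z => Real.log ‖(orthoPoly p fun j => ξ j ω).eval z‖ ^ 2)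
          (Metric.ball (x : ℂ) (3 * c / n)) ∧
        ∫ z in Metric.ball (x : ℂ) (3 * c / n),
          Real.log ‖(orthoPoly p fun j => ξ j ω).eval z‖ ^ 2 ≤ B * ((n : ℝ) ^ θ) ^ 2 / n ^ 2 := by
  have := h.finite_measure
  obtain ⟨B, hB, hlog⟩ := integral_sq_log_norm_eval_le
  obtain ⟨q, hq0, hq1, hq⟩ := exists_measureReal_closedBall_le.{u} hτ hε₀
  obtain ⟨D₀, hD₀, hDK⟩ := h.exists_subset_closedBall
  have hC₀ := hLB.C₀_pos
  refine ⟨B * (64 * c) ^ 2, by positivity, fun A θ hA hθ => ?_⟩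
  have hlq : Real.log q < 0 := Real.log_neg hq0 hq1
  -- With M ≥ A' log n nodes, q^M ≤ n^(-(A+1)).
  set A' : ℝ := (A + 1) / (-Real.log q) with hA'
  have hA'0 : 0 < A' := div_pos (by linarith) (by linarith)
  set D : ℝ := D₀ + |a| + |b| + c + 1 with hD
  have hDpos : 0 < D := by positivity
  set W := μ.real Set.univ + 1 with hW
  have hW0 : 0 < W := by have : 0 ≤ μ.real Set.univ := measureReal_nonneg
                         linarith
  set Q := (2 + τ) * (C₀ * Real.exp 2) with hQ
  have hQ0 : 0 < Q := by positivity
  -- The interpolation loss (D/ρ)^M is at most n^(3M) = exp(O(log² n)); hence the requirement that T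
  -- = n^θ dominate constant multiples of log² n.
  have hev : ∀ᶠ n : ℕ in Filter.atTop, (3 : ℝ) ≤ n ∧
      (A' + 1) * Real.log n ^ 2 ≤ (n : ℝ) ^ (1 : ℝ) ∧ D / c ≤ n ∧
      (1 + 3 * (A' + 1) + 4 * W) * Real.log n ^ 2 ≤ (n : ℝ) ^ θ ∧
      (2 + (A + 1) + Q) * Real.log n ^ 2 ≤ (n : ℝ) ^ θ := by
    filter_upwards [Filter.eventually_ge_atTop 3,
      eventually_mul_sq_log_le_rpow (A' + 1) one_pos,
      tendsto_natCast_atTop_atTop.eventually_ge_atTop (D / c),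
      eventually_mul_sq_log_le_rpow (1 + 3 * (A' + 1) + 4 * W) hθ,
      eventually_mul_sq_log_le_rpow (2 + (A + 1) + Q) hθ] with n h1 h2 h3 h4 h5
    exact ⟨by exact_mod_cast h1, h2, h3, h4, h5⟩
  obtain ⟨n₀, hn₀⟩ := Filter.eventually_atTop.1 hev
  refine ⟨n₀, fun n hn Ω _ P _ ξ hξ x hx => ?_⟩
  obtain ⟨hn3, hnA, hnD, hnK, hnK2⟩ := hn₀ n hn
  rw [Real.rpow_one] at hnA
  have hn0 : (0 : ℝ) < n := by linarith
  have hnpos : 0 < n := by exact_mod_cast hn0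
  set ll := Real.log n with hll
  have hll1 : 1 ≤ ll := by
    rw [hll, Real.le_log_iff_exp_le hn0]
    exact Real.exp_one_lt_d9.le.trans (by linarith)
  have hll2 : ll ≤ ll ^ 2 := by nlinarith
  have hll3 : 1 ≤ ll ^ 2 := by nlinarith
  have hexpll : Real.exp ll = n := Real.exp_log hn0
  set T := (n : ℝ) ^ θ with hT
  have hT1 : 1 ≤ T := Real.one_le_rpow (by linarith) hθ.le
  set M := ⌈A' * ll⌉₊ with hM
  have hMlow : A' * ll ≤ M := Nat.le_ceil _
  have hMup : (M : ℝ) ≤ (A' + 1) * ll := by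
    have := Nat.ceil_lt_add_one (a := A' * ll) (by positivity)
    rw [← hM] at this
    linarith
  have hM0 : (0 : ℝ) < M := lt_of_lt_of_le (by positivity) hMlow
  have hMpos : 0 < M := by exact_mod_cast hM0
  have hM1 : (1 : ℝ) ≤ M := by exact_mod_cast hMpos
  have hMn : (M : ℝ) ≤ n := by
    refine hMup.trans (le_trans ?_ hnA)
    gcongr
  have hMn' : M ≤ n := by exact_mod_cast hMn
  -- With this spacing all M nodes stay within c/n of x.
  set ρ := c / (n * M) with hρ
  have hρ0 : 0 < ρ := by positivity
  have hlρ : ∀ l < M, (l : ℝ) * ρ ≤ c / n := by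
    intro l hl
    have h1 : (l : ℝ) ≤ M := by exact_mod_cast hl.le
    calc (l : ℝ) * ρ ≤ M * ρ := by gcongr
      _ = c / n := by rw [hρ]; field_simp
  have hcn : c / n ≤ c := div_le_self hc.le (by linarith)
  set η := Real.exp (-T) with hη
  have hnode : P.real {ω | ∀ l < M,
      ‖(orthoPoly p fun j => ξ j ω).eval ((x + l * ρ : ℝ) : ℂ)‖ ≤ η} ≤ q ^ M := by
    refine h.measureReal_forall_norm_eval_le hξ.measurable hξ.indep hq0.le
      (fun i z => hq Ω P (ξ i) (hξ.measurable i) (hξ.moment_integrable i) (hξ.moment_le i)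
        (hξ.unit_variance i) z) hρ0 (by omega) (D := D) ?_ ?_ ?_
    · intro t ht l hl
      have h1 := hDK t ht
      have h2 := hlρ l hl
      have h3 : 0 ≤ (l : ℝ) * ρ := by positivity
      have h4 := abs_le.1 h1
      have h5 := neg_abs_le a
      have h6 := le_abs_self b
      have h7 := abs_nonneg a
      have h8 := abs_nonneg b
      rw [abs_le]
      constructor <;> linarith [hx.1, hx.2, h4.1, h4.2]
    · have : ρ ≤ c := by
        rw [hρ]
        exact div_le_self hc.le (by nlinarith)
      have h7 := abs_nonneg a
      have h8 := abs_nonneg b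
      linarith
    · have h1 : D / ρ ≤ (n : ℝ) ^ 3 := by
        have : D / ρ = D / c * n * M := by rw [hρ]; field_simp
        rw [this]
        calc D / c * n * M ≤ n * n * n := by gcongr
          _ = (n : ℝ) ^ 3 := by ring
      have h2 : (D / ρ) ^ M ≤ Real.exp (3 * (A' + 1) * ll ^ 2) := by
        calc (D / ρ) ^ M ≤ ((n : ℝ) ^ 3) ^ M := pow_le_pow_left₀ (by positivity) h1 M
          _ = Real.exp (M * (3 * ll)) := by
            rw [← hexpll, ← Real.exp_nat_mul, ← Real.exp_nat_mul]; norm_num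
          _ ≤ _ := by
            rw [Real.exp_le_exp]
            nlinarith
      have h3 : (M : ℝ) ≤ Real.exp (1 * ll ^ 2) := by
        refine hMn.trans ?_
        rw [← hexpll, Real.exp_le_exp]
        linarith
      have h4 : 4 * W ≤ Real.exp (4 * W * ll ^ 2) := by
        have := Real.add_one_le_exp (4 * W * ll ^ 2)
        nlinarith
      have h5 : Real.exp (1 * ll ^ 2) * Real.exp (3 * (A' + 1) * ll ^ 2) *
          Real.exp (4 * W * ll ^ 2) * η ≤ 1 := by
        rw [hη, ← Real.exp_add, ← Real.exp_add, ← Real.exp_add, Real.exp_le_one_iff]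
        linarith
      have h6 : (M : ℝ) * (D / ρ) ^ M * (4 * W) * η ≤ 1 := by
        refine le_trans ?_ h5
        have hη0 : 0 ≤ η := (Real.exp_pos _).le
        have h7 : 0 ≤ (D / ρ) ^ M := by positivity
        gcongr
      linarith
  have hqM : q ^ M ≤ (n : ℝ) ^ (-(A + 1)) := by
    rw [← Real.rpow_natCast, Real.rpow_def_of_pos hq0, Real.rpow_def_of_pos hn0, Real.exp_le_exp]
    have h1 : Real.log q * M ≤ Real.log q * (A' * ll) :=
      mul_le_mul_of_nonpos_left hMlow hlq.le
    have h2 : Real.log q * (A' * ll) = ll * -(A + 1) := by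
      rw [hA']
      field_simp [hlq.ne]
    linarith
  have hsum_meas : Measurable fun ω => ∑ j, ‖ξ j ω‖ :=
    Finset.measurable_fun_sum _ fun j _ => (hξ.measurable j).norm
  set G₁ := {ω | ∀ l < M, ‖(orthoPoly p fun j => ξ j ω).eval ((x + l * ρ : ℝ) : ℂ)‖ ≤ η} with hG₁
  set U := Real.exp T / (C₀ * Real.exp 2) with hU
  have hU0 : 0 < U := by positivity
  set G₂ := {ω | U ≤ ∑ j, ‖ξ j ω‖} with hG₂
  have hG₁m : MeasurableSet G₁ := by
    have : G₁ = ⋂ l : ℕ, ⋂ _ : l < M,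
        {ω | ‖(orthoPoly p fun j => ξ j ω).eval ((x + l * ρ : ℝ) : ℂ)‖ ≤ η} := by
      ext u; simp [hG₁]
    rw [this]
    refine MeasurableSet.iInter fun l => MeasurableSet.iInter fun _ => ?_
    exact measurableSet_le (measurable_eval_orthoPoly hξ.measurable
      measurable_const).norm measurable_const
  have hG₂m : MeasurableSet G₂ := measurableSet_le measurable_const hsum_meas
  -- Markov for ∑|ξ_j|. Its mean is O(n), negligible against e^T.
  have hmark : P.real G₂ ≤ (n : ℝ) ^ (-(A + 1)) := by
    have hi : ∀ j, Integrable (fun ω => ‖ξ j ω‖) P := fun j =>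
      ((memLp_two_of_moment (hξ.measurable j) hε₀ (hξ.moment_integrable j)).integrable
        (by norm_num)).norm
    have h1 := mul_meas_ge_le_integral_of_nonneg (μ := P) (f := fun ω => ∑ j, ‖ξ j ω‖)
      (ae_of_all _ fun ω => Finset.sum_nonneg fun j _ => norm_nonneg _)
      (integrable_finsetSum _ fun j _ => hi j) U
    rw [integral_finsetSum _ fun j _ => hi j] at h1
    have h2 : ∑ j, ∫ ω, ‖ξ j ω‖ ∂P ≤ ((n : ℝ) + 1) * (2 + τ) := by
      have := Finset.sum_le_card_nsmul Finset.univ (fun j => ∫ ω, ‖ξ j ω‖ ∂P) (2 + τ)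
        fun j _ => integral_norm_le_of_moment (hξ.measurable j) hε₀ (hξ.moment_integrable j)
          (hξ.moment_le j)
      rw [nsmul_eq_mul, Finset.card_univ, Fintype.card_fin] at this
      push_cast at this
      exact this
    have h3 : P.real G₂ ≤ ((n : ℝ) + 1) * Q * Real.exp (-T) := by
      have h4 : P.real G₂ ≤ ((n : ℝ) + 1) * (2 + τ) / U := by
        rw [le_div_iff₀ hU0, mul_comm]
        exact h1.trans h2
      refine h4.trans (le_of_eq ?_)
      rw [hU, hQ, Real.exp_neg]
      field_simp
    refine h3.trans ?_
    have h5 : (n : ℝ) + 1 ≤ Real.exp (2 * ll ^ 2) := by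
      calc (n : ℝ) + 1 ≤ n * n := by nlinarith
        _ = Real.exp (ll + ll) := by rw [Real.exp_add, hexpll]
        _ ≤ _ := by rw [Real.exp_le_exp]; linarith
    have h6 : Q ≤ Real.exp (Q * ll ^ 2) := by
      have := Real.add_one_le_exp (Q * ll ^ 2)
      nlinarith
    rw [Real.rpow_def_of_pos hn0]
    calc ((n : ℝ) + 1) * Q * Real.exp (-T) ≤
        Real.exp (2 * ll ^ 2) * Real.exp (Q * ll ^ 2) * Real.exp (-T) := by gcongr
      _ ≤ _ := by
        rw [← Real.exp_add, ← Real.exp_add, Real.exp_le_exp]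
        nlinarith
  refine ⟨(G₁ ∪ G₂)ᶜ, (hG₁m.union hG₂m).compl, ?_, ?_⟩
  · rw [compl_compl]
    refine (measureReal_union_le _ _).trans ((add_le_add (hnode.trans hqM) hmark).trans ?_)
    have h1 : (n : ℝ) ^ (-A) = (n : ℝ) ^ (-(A + 1)) * n := by
      rw [← Real.rpow_add_one hn0.ne']
      congr 1
      ring
    rw [h1]
    have : 0 ≤ (n : ℝ) ^ (-(A + 1)) := Real.rpow_nonneg hn0.le _
    nlinarith
  · intro ω hω
    rw [Set.mem_compl_iff, Set.mem_union, not_or] at hω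
    obtain ⟨hω1, hω2⟩ := hω
    simp only [hG₁, Set.mem_ofPred_eq, not_forall, not_le] at hω1
    simp only [hG₂, Set.mem_ofPred_eq, not_le] at hω2
    obtain ⟨l, hl, hlow⟩ := hω1
    set y : ℂ := ((x + l * ρ : ℝ) : ℂ) with hy
    have hyx : ‖y - x‖ ≤ c / n := by
      have : y - x = ((l * ρ : ℝ) : ℂ) := by rw [hy]; push_cast; ring
      rw [this, Complex.norm_real, Real.norm_eq_abs, abs_of_nonneg (by positivity)]
      exact hlρ l hl
    -- The concentric disc of one sixteenth the radius is 4c/n about the good node, and contains the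
    -- disc 3c/n about x. The full disc lies within 65c/n ≤ d/n of x, where the p_j are bounded.
    have hR : 0 < 64 * c / n := by positivity
    obtain ⟨hI1, hI2⟩ := hlog (orthoPoly p fun j => ξ j ω) T hT1 y (64 * c / n) hR (by
      intro z hz
      rw [Metric.mem_closedBall, dist_eq_norm] at hz
      have hzx : ‖z - x‖ ≤ 1 * d / n := by
        calc ‖z - x‖ ≤ ‖z - y‖ + ‖y - x‖ := norm_sub_le_norm_sub_add_norm_sub _ _ _
          _ ≤ 64 * c / n + c / n := add_le_add hz hyx
          _ = 65 * c / n := by ring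
          _ ≤ 1 * d / n := by rw [one_mul]; gcongr
      rw [eval_orthoPoly]
      calc _ ≤ ∑ j : Fin (n + 1), ‖ξ j ω‖ * (C₀ * Real.exp 2) := by
            refine norm_sum_le_of_le _ fun j _ => ?_
            rw [norm_mul]
            have := hLB.upper n hnpos j (Nat.lt_succ_iff.1 j.2) x hx 1 z hzx
            rw [mul_one] at this
            gcongr
        _ = (∑ j, ‖ξ j ω‖) * (C₀ * Real.exp 2) := by rw [Finset.sum_mul]
        _ ≤ U * (C₀ * Real.exp 2) := by gcongr
        _ = Real.exp T := by rw [hU]; field_simp) hlow.le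
    have hsub : Metric.ball (x : ℂ) (3 * c / n) ⊆ Metric.ball y (64 * c / n / 16) := by
      refine Metric.ball_subset_ball' ?_
      rw [dist_comm, dist_eq_norm]
      have : 64 * c / n / 16 = 3 * c / n + c / n := by ring
      rw [this]
      linarith
    refine ⟨hI1.mono_set hsub, (setIntegral_mono_set hI1 (ae_of_all _ fun z => sq_nonneg _)
      hsub.eventuallyLE).trans (hI2.trans (le_of_eq ?_))⟩
    field_simp

/-! ### Replacing the logarithm by the regularized one -/

theorem abs_prod_sub_prod_le {ι : Type*} [DecidableEq ι] (s : Finset ι) {x y m D : ι → ℝ}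
    (hx : ∀ i ∈ s, |x i| ≤ m i) (hy : ∀ i ∈ s, |y i| ≤ m i) (hD : ∀ i ∈ s, |x i - y i| ≤ D i) :
    |∏ i ∈ s, x i - ∏ i ∈ s, y i| ≤ ∑ i ∈ s, ∏ j ∈ s, if j = i then D j else m j := by
  induction s using Finset.induction_on with
  | empty => simp
  | insert a s ha ih =>
    have hx' := fun i (hi : i ∈ s) => hx i (Finset.mem_insert_of_mem hi)
    have hy' := fun i (hi : i ∈ s) => hy i (Finset.mem_insert_of_mem hi)
    have ih := ih hx' hy' fun i hi => hD i (Finset.mem_insert_of_mem hi)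
    rw [Finset.sum_insert ha, Finset.prod_insert ha, Finset.prod_insert ha, Finset.prod_insert ha,
      if_pos rfl]
    have h1 : ∏ j ∈ s, (if j = a then D j else m j) = ∏ j ∈ s, m j :=
      Finset.prod_congr rfl fun j hj => if_neg (by rintro rfl; exact ha hj)
    have h2 : ∑ i ∈ s, ∏ j ∈ insert a s, (if j = i then D j else m j) =
        m a * ∑ i ∈ s, ∏ j ∈ s, (if j = i then D j else m j) := by
      rw [Finset.mul_sum]
      refine Finset.sum_congr rfl fun i hi => ?_
      rw [Finset.prod_insert ha, if_neg (by rintro rfl; exact ha hi)]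
    rw [h1, h2]
    have h3 : x a * ∏ i ∈ s, x i - y a * ∏ i ∈ s, y i =
        (x a - y a) * ∏ i ∈ s, x i + y a * (∏ i ∈ s, x i - ∏ i ∈ s, y i) := by ring
    rw [h3]
    have hxa := hD a (Finset.mem_insert_self _ _)
    have hya := hy a (Finset.mem_insert_self _ _)
    refine (abs_add_le _ _).trans (add_le_add ?_ ?_)
    · rw [abs_mul, Finset.abs_prod]
      exact mul_le_mul hxa (Finset.prod_le_prod (fun _ _ => abs_nonneg _) hx')
        (Finset.prod_nonneg fun _ _ => abs_nonneg _) ((abs_nonneg _).trans hxa)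
    · rw [abs_mul]
      exact mul_le_mul hya ih (abs_nonneg _) ((abs_nonneg _).trans hya)

/-- Telescoping exchanges one factor at a time. Each resulting bound is a product of one-variable
functions, so Fubini gives one integral of D and at most S for each remaining variable. -/
theorem norm_integral_prod_smul_sub_le {ι : Type*} [Fintype ι] {U : ι → Set ℂ}
    (hU : ∀ i, MeasurableSet (U i)) {Ψ : (ι → ℂ) → ℂ} {Q : ℝ} (hQ : ∀ w, ‖Ψ w‖ ≤ Q)
    (hΨ : ∀ w, (∃ i, w i ∉ U i) → Ψ w = 0) {ℓ h m D : ι → ℂ → ℝ}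
    (hℓ : ∀ i, ∀ z ∈ U i, |ℓ i z| ≤ m i z) (hh : ∀ i, ∀ z ∈ U i, |h i z| ≤ m i z)
    (hD : ∀ i, ∀ z ∈ U i, |ℓ i z - h i z| ≤ D i z) (hmi : ∀ i, IntegrableOn (m i) (U i))
    (hDi : ∀ i, IntegrableOn (D i) (U i)) {S : ℝ} (hS : ∀ i, ∫ z in U i, m i z ≤ S)
    (I₁ : Integrable fun w => (∏ i, ℓ i (w i)) • Ψ w)
    (I₂ : Integrable fun w => (∏ i, h i (w i)) • Ψ w) :
    ‖(∫ w, (∏ i, ℓ i (w i)) • Ψ w) - ∫ w, (∏ i, h i (w i)) • Ψ w‖ ≤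
      Q * (S ^ (Fintype.card ι - 1) * ∑ i, ∫ z in U i, D i z) := by
  classical
  have hQ0 : 0 ≤ Q := (norm_nonneg _).trans (hQ 0)
  set M : ι → ℂ → ℝ := fun i => (U i).indicator (m i) with hM
  set DD : ι → ℂ → ℝ := fun i => (U i).indicator (D i) with hDD
  have hM0 : ∀ i z, 0 ≤ M i z := fun i z =>
    Set.indicator_nonneg (fun z hz => (abs_nonneg _).trans (hℓ i z hz)) z
  have hD0 : ∀ i z, 0 ≤ DD i z := fun i z =>
    Set.indicator_nonneg (fun z hz => (abs_nonneg _).trans (hD i z hz)) z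
  have hMI : ∀ i, Integrable (M i) := fun i => (integrable_indicator_iff (hU i)).2 (hmi i)
  have hDI : ∀ i, Integrable (DD i) := fun i => (integrable_indicator_iff (hU i)).2 (hDi i)
  have hprodI : ∀ i, Integrable fun w : ι → ℂ =>
      ∏ j, (if j = i then DD j else M j) (w j) := fun i => by
    rw [volume_pi]
    refine Integrable.fintype_prod fun j => ?_
    split_ifs
    · exact hDI j
    · exact hMI j
  have hbound : ∀ w : ι → ℂ, ‖(∏ i, ℓ i (w i)) • Ψ w - (∏ i, h i (w i)) • Ψ w‖ ≤
      Q * ∑ i, ∏ j, (if j = i then DD j else M j) (w j) := by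
    intro w
    by_cases hw : ∃ i, w i ∉ U i
    · rw [hΨ w hw]
      simp only [smul_zero, sub_zero, norm_zero]
      refine mul_nonneg hQ0 (Finset.sum_nonneg fun i _ => Finset.prod_nonneg fun j _ => ?_)
      split_ifs
      · exact hD0 j _
      · exact hM0 j _
    · push Not at hw
      rw [← sub_smul, norm_smul, Real.norm_eq_abs, mul_comm]
      refine mul_le_mul (hQ w) ?_ (abs_nonneg _) hQ0
      refine (abs_prod_sub_prod_le Finset.univ (m := fun i => m i (w i))
        (D := fun i => D i (w i)) (fun i _ => hℓ i _ (hw i)) (fun i _ => hh i _ (hw i))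
        fun i _ => hD i _ (hw i)).trans (le_of_eq ?_)
      refine Finset.sum_congr rfl fun i _ => Finset.prod_congr rfl fun j _ => ?_
      split_ifs
      · simp only [hDD]; rw [Set.indicator_of_mem (hw j)]
      · simp only [hM]; rw [Set.indicator_of_mem (hw j)]
  rw [← integral_sub I₁ I₂]
  refine (norm_integral_le_of_norm_le ((integrable_finsetSum _ fun i _ => hprodI i).const_mul Q)
    (ae_of_all _ hbound)).trans ?_
  rw [integral_const_mul, integral_finsetSum _ fun i _ => hprodI i]
  refine mul_le_mul_of_nonneg_left ?_ hQ0
  rw [Finset.mul_sum]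
  refine Finset.sum_le_sum fun i _ => ?_
  rw [volume_pi, integral_fintype_prod_eq_prod (fun j => if j = i then DD j else M j),
    ← Finset.mul_prod_erase _ _ (Finset.mem_univ i), if_pos rfl, mul_comm]
  have hDe : ∫ z, DD i z = ∫ z in U i, D i z := integral_indicator (hU i)
  rw [hDe]
  have hD0' : 0 ≤ ∫ z in U i, D i z := by
    rw [← hDe]; exact integral_nonneg (hD0 i)
  refine mul_le_mul_of_nonneg_right ?_ hD0'
  have h1 : ∏ j ∈ Finset.univ.erase i, ∫ z, (if j = i then DD j else M j) z ≤
      ∏ _j ∈ Finset.univ.erase i, S := by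
    refine Finset.prod_le_prod (fun j hj => ?_) fun j hj => ?_
    · rw [if_neg (Finset.ne_of_mem_erase hj)]
      exact integral_nonneg (hM0 j)
    · rw [if_neg (Finset.ne_of_mem_erase hj), hM]
      simp only
      rw [integral_indicator (hU j)]
      exact hS j
  refine h1.trans (le_of_eq ?_)
  rw [Finset.prod_const, Finset.card_erase_of_mem (Finset.mem_univ i), Finset.card_univ]

@[fun_prop]
theorem continuous_regLog {δ Λ : ℝ} (hδ : 0 < δ) (hΛ : 0 < Λ) : Continuous (regLog δ Λ) := by
  unfold regLog
  have h1 : ∀ y : ℂ, ‖y‖ ^ 2 + δ ^ 2 ≠ 0 := fun y => by positivity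
  have h2 : ∀ y : ℂ, ‖y‖ ^ 2 + Λ ^ 2 ≠ 0 := fun y => by positivity
  exact ((Continuous.log (by fun_prop) h1).sub (Continuous.log (by fun_prop) h2)).div_const 2

theorem abs_regLog_le {δ Λ : ℝ} (hδ : 0 < δ) (hδΛ : δ ≤ Λ) (y : ℂ) :
    |regLog δ Λ y| ≤ Real.log (Λ / δ) := by
  have hΛ : 0 < Λ := hδ.trans_le hδΛ
  have h0 := sq_nonneg ‖y‖
  have hsq : δ ^ 2 ≤ Λ ^ 2 := pow_le_pow_left₀ hδ.le hδΛ 2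
  have h1 : Real.log (‖y‖ ^ 2 + δ ^ 2) ≤ Real.log (‖y‖ ^ 2 + Λ ^ 2) :=
    Real.log_le_log (by positivity) (by linarith)
  have h2 : Real.log (‖y‖ ^ 2 + Λ ^ 2) ≤
      Real.log (‖y‖ ^ 2 + δ ^ 2) + (2 * Real.log Λ - 2 * Real.log δ) := by
    have h3 : ‖y‖ ^ 2 + Λ ^ 2 ≤ (‖y‖ ^ 2 + δ ^ 2) * (Λ ^ 2 / δ ^ 2) := by
      have h4 : (‖y‖ ^ 2 + δ ^ 2) * (Λ ^ 2 / δ ^ 2) = ‖y‖ ^ 2 * (Λ ^ 2 / δ ^ 2) + Λ ^ 2 := by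
        field_simp
      have h5 : 1 ≤ Λ ^ 2 / δ ^ 2 := (one_le_div (by positivity)).2 hsq
      rw [h4]
      nlinarith
    have h6 := Real.log_le_log (by positivity) h3
    rw [Real.log_mul (by positivity) (by positivity), Real.log_div (by positivity) (by positivity),
      Real.log_pow, Real.log_pow] at h6
    exact_mod_cast h6
  rw [regLog, Real.log_div hΛ.ne' hδ.ne', abs_le]
  constructor <;> linarith

/-- Pointwise comparison of the logarithm with its regularization. -/
theorem abs_log_sub_regLog_le {δ Λ A : ℝ} (hδ : 0 < δ) (hδ1 : δ ≤ 1) (hΛ : 1 ≤ Λ)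
    (hA0 : 0 < A) (hA : Real.log (Λ / δ) ≤ A) (y : ℂ) :
    |Real.log (‖y‖ / Λ) - regLog δ Λ y| ≤
      (‖y‖ ^ 2 / Λ ^ 2 + δ + 3 * A * Real.exp (-(1 / δ * ‖y‖ ^ 2))) +
        (1 + 2 * |Real.log ‖y‖|) ^ 2 / A := by
  have hΛ0 : 0 < Λ := by linarith
  have hX0 : 0 ≤ (1 + 2 * |Real.log ‖y‖|) ^ 2 / A := by positivity
  by_cases hy : y = 0
  · subst hy
    have h1 := abs_regLog_le hδ (hδ1.trans hΛ) 0
    simp only [norm_zero, zero_div, Real.log_zero, zero_sub, abs_neg]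
    have h2 : Real.exp (-(1 / δ * 0 ^ 2)) = 1 := by simp
    rw [h2]
    have h3 : (0 : ℝ) ≤ 0 ^ 2 / Λ ^ 2 := by positivity
    have h4 : 0 ≤ (1 + 2 * |(0 : ℝ)|) ^ 2 / A := by positivity
    linarith
  · have hy0 : 0 < ‖y‖ := norm_pos_iff.2 hy
    set r := ‖y‖ ^ 2 with hr
    have hr0 : 0 < r := by positivity
    have hlogr : Real.log r = 2 * Real.log ‖y‖ := by rw [hr, Real.log_pow]; norm_num
    have e1 : Real.log (‖y‖ / Λ) - regLog δ Λ y =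
        (Real.log (1 + r / Λ ^ 2) - Real.log (1 + δ ^ 2 / r)) / 2 := by
      have h1 : 1 + r / Λ ^ 2 = (r + Λ ^ 2) / Λ ^ 2 := by field_simp; ring
      have h2 : 1 + δ ^ 2 / r = (r + δ ^ 2) / r := by field_simp
      rw [h1, h2, Real.log_div (by positivity) (by positivity),
        Real.log_div (by positivity) (by positivity), Real.log_div (by positivity) (by positivity),
        regLog, hlogr, Real.log_pow]
      push_cast
      ring
    have hB : 0 ≤ r / Λ ^ 2 := by positivity
    have hb0 : 0 ≤ Real.log (1 + r / Λ ^ 2) := Real.log_nonneg (by linarith)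
    have hb1 : Real.log (1 + r / Λ ^ 2) ≤ r / Λ ^ 2 := by
      have := Real.log_le_sub_one_of_pos (x := 1 + r / Λ ^ 2) (by linarith)
      linarith
    have hC : 0 ≤ δ ^ 2 / r := by positivity
    have hc0 : 0 ≤ Real.log (1 + δ ^ 2 / r) := Real.log_nonneg (by linarith)
    have hE0 := Real.exp_pos (-(1 / δ * r))
    have hc1 : Real.log (1 + δ ^ 2 / r) ≤ δ + 3 * A * Real.exp (-(1 / δ * r)) +
        (1 + 2 * |Real.log ‖y‖|) ^ 2 / A := by
      -- For |y|² ≥ δ the term is at most δ²/r ≤ δ. For |y|² < δ it is at most X = 1 + 2|log|y||,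
      -- and X ≤ A + X²/A separates a bounded part from one controlled in L². There 3 exp(-|y|²/δ) ≥
      -- 1 plays the role of the indicator.
      rcases le_or_gt δ r with h | h
      · have h1 := Real.log_le_sub_one_of_pos (x := 1 + δ ^ 2 / r) (by linarith)
        have h2 : δ ^ 2 / r ≤ δ := by
          rw [div_le_iff₀ hr0]; nlinarith
        have h3 : 0 ≤ 3 * A * Real.exp (-(1 / δ * r)) := by positivity
        linarith
      · have h1 : Real.log (1 + δ ^ 2 / r) ≤ Real.log (2 / r) := by
          refine Real.log_le_log (by linarith) ?_
          rw [le_div_iff₀ hr0]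
          have : (1 + δ ^ 2 / r) * r = r + δ ^ 2 := by field_simp
          rw [this]
          nlinarith
        rw [Real.log_div two_ne_zero hr0.ne', hlogr] at h1
        have h2 := Real.log_two_lt_d9
        have h3 := neg_abs_le (Real.log ‖y‖)
        set X := 1 + 2 * |Real.log ‖y‖| with hX
        have h4 : X ≤ A + X ^ 2 / A := by
          have : X * A ≤ (A + X ^ 2 / A) * A := by
            have : (A + X ^ 2 / A) * A = A ^ 2 + X ^ 2 := by field_simp
            rw [this]
            nlinarith [sq_nonneg (A - X), sq_nonneg (A + X)]
          exact le_of_mul_le_mul_right this hA0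
        have h5 : 1 ≤ 3 * Real.exp (-(1 / δ * r)) := by
          have h6 : Real.exp (-1) ≤ Real.exp (-(1 / δ * r)) := by
            rw [Real.exp_le_exp, neg_le_neg_iff, one_div, inv_mul_le_iff₀ hδ]
            linarith
          have h7 : 1 ≤ 3 * Real.exp (-1) := by
            rw [Real.exp_neg, ← div_eq_mul_inv, one_le_div (Real.exp_pos _)]
            exact Real.exp_one_lt_d9.le.trans (by norm_num)
          linarith
        have h6 := mul_le_mul_of_nonneg_left h5 hA0.le
        linarith
    rw [e1, abs_le]
    have h3 : 0 ≤ 3 * A * Real.exp (-(1 / δ * r)) := by positivity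
    constructor <;> linarith

/-- The part of the error of the regularization that is estimated in mean. -/
noncomputable def regLogError (δ Λ A : ℝ) (y : ℂ) : ℝ :=
  ‖y‖ ^ 2 / Λ ^ 2 + δ + 3 * A * Real.exp (-(1 / δ * ‖y‖ ^ 2))

@[fun_prop]
theorem continuous_regLogError (δ Λ A : ℝ) : Continuous (regLogError δ Λ A) := by
  unfold regLogError; fun_prop

theorem regLogError_nonneg {δ Λ A : ℝ} (hδ : 0 ≤ δ) (hA : 0 ≤ A) (y : ℂ) :
    0 ≤ regLogError δ Λ A y := by
  unfold regLogError; positivity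

theorem measureReal_ball_complex (z : ℂ) {r : ℝ} (hr : 0 ≤ r) :
    (volume : Measure ℂ).real (Metric.ball z r) = Real.pi * r ^ 2 := by
  rw [measureReal_def, Complex.volume_ball]
  simp [hr, mul_comm]

theorem locallyIntegrable_log_norm_eval_div (F : ℂ[X]) {s : ℝ} (hs : 0 < s) :
    LocallyIntegrable fun z => Real.log (‖F.eval z‖ / s) := by
  have := locallyIntegrable_log_norm_eval (Polynomial.C ((s : ℂ)⁻¹) * F)
  refine this.congr (ae_of_all _ fun z => ?_)
  simp [abs_of_pos hs, div_eq_inv_mul]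

/-- Deterministic replacement for one polynomial. Both logarithms are dominated by |log|F|| + t, and
their difference by the error to be averaged plus a multiple of (log²|F| + t²)/A. The hypothesis 5
log n ≤ t absorbs the normalization log(√n n²) = (5/2) log n. -/
theorem norm_integral_log_sub_regLog_le {k : ℕ} {n : ℕ} (hn : 0 < n)
    {F : ℂ[X]} {x : Fin k → ℂ} {r B t δ A Q : ℝ} (hr : 0 ≤ r) (hB : 0 ≤ B) (ht : 1 ≤ t)
    (hlog : 5 * Real.log n ≤ t) (hδ : 0 < δ) (hδ1 : δ ≤ 1)
    (hδt : Real.log ((n : ℝ) ^ 2 / δ) ≤ t) (htA : t ≤ A)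
    (hI : ∀ i, IntegrableOn (fun z => Real.log ‖F.eval z‖ ^ 2) (Metric.ball (x i) (r / n)))
    (hIle : ∀ i, ∫ z in Metric.ball (x i) (r / n), Real.log ‖F.eval z‖ ^ 2 ≤ B * t ^ 2 / n ^ 2)
    {Ψ : (Fin k → ℂ) → ℂ} (hΨc : Continuous Ψ) (hΨs : HasCompactSupport Ψ) (hQ : ∀ w, ‖Ψ w‖ ≤ Q)
    (hΨ : ∀ w, (∃ i, w i ∉ Metric.ball (x i) (r / n)) → Ψ w = 0) :
    ‖(∫ w, (∏ i, Real.log (‖F.eval (w i)‖ / (√n * (n : ℝ) ^ 2))) • Ψ w) -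
      ∫ w, (∏ i, regLog δ ((n : ℝ) ^ 2) (F.eval (w i) / (√n : ℝ))) • Ψ w‖ ≤
      Q * (((B + 2 * (Real.pi * r ^ 2)) * t / n ^ 2) ^ (k - 1) *
        ∑ i, ((∫ z in Metric.ball (x i) (r / n),
          regLogError δ ((n : ℝ) ^ 2) A (F.eval z / (√n : ℝ))) +
          8 * (B + Real.pi * r ^ 2) * t ^ 2 / (A * n ^ 2))) := by
  have hn0 : (0 : ℝ) < n := by exact_mod_cast hn
  have hn1 : (1 : ℝ) ≤ n := by exact_mod_cast hn
  have ht0 : 0 < t := by linarith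
  have hA0 : 0 < A := by linarith
  have hll : 0 ≤ Real.log n := Real.log_nonneg hn1
  have hΛ : (1 : ℝ) ≤ (n : ℝ) ^ 2 := one_le_pow₀ hn1
  have hsn : 0 < √(n : ℝ) := Real.sqrt_pos.2 hn0
  set U : Fin k → Set ℂ := fun i => Metric.ball (x i) (r / n) with hU
  have hUm : ∀ i, MeasurableSet (U i) := fun i => measurableSet_ball
  have hUfin : ∀ i, volume (U i) ≠ ⊤ := fun i => measure_ball_lt_top.ne
  have hVU : ∀ i, (volume : Measure ℂ).real (U i) = Real.pi * r ^ 2 / n ^ 2 := fun i => by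
    rw [hU, measureReal_ball_complex _ (by positivity)]
    ring
  set m : ℂ → ℝ := fun z => |Real.log ‖F.eval z‖| + t with hm
  set D : ℂ → ℝ := fun z => regLogError δ ((n : ℝ) ^ 2) A (F.eval z / (√n : ℝ)) +
    8 * (Real.log ‖F.eval z‖ ^ 2 + t ^ 2) / A with hD
  have hFm : Measurable fun z => F.eval z := F.continuous.measurable
  have hconst : ∀ (i) (a : ℝ), IntegrableOn (fun _ : ℂ => a) (U i) := fun i a =>
    integrableOn_const (hUfin i)
  have hconstI : ∀ (i) (a : ℝ), ∫ _ in U i, a = Real.pi * r ^ 2 / n ^ 2 * a := fun i a => by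
    rw [setIntegral_const, hVU, smul_eq_mul]
  have hdiv : ∀ z, |Real.log (‖F.eval z‖ / (√n * (n : ℝ) ^ 2))| ≤
      |Real.log ‖F.eval z‖| + 5 / 2 * Real.log n := by
    intro z
    by_cases hz : F.eval z = 0
    · rw [hz]
      simp
      positivity
    · rw [Real.log_div (norm_ne_zero_iff.2 hz) (by positivity),
        Real.log_mul hsn.ne' (by positivity), Real.log_sqrt hn0.le, Real.log_pow]
      refine (abs_sub _ _).trans (add_le_add le_rfl (le_of_eq ?_))
      rw [abs_of_nonneg (by positivity)]
      push_cast
      ring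
  have hdiv' : ∀ z, |Real.log ‖F.eval z / (√n : ℝ)‖| ≤
      |Real.log ‖F.eval z‖| + 1 / 2 * Real.log n := by
    intro z
    rw [norm_div, Complex.norm_real, Real.norm_eq_abs, abs_of_pos hsn]
    by_cases hz : F.eval z = 0
    · rw [hz]
      simp
      positivity
    · rw [Real.log_div (norm_ne_zero_iff.2 hz) hsn.ne', Real.log_sqrt hn0.le]
      refine (abs_sub _ _).trans (add_le_add le_rfl (le_of_eq ?_))
      rw [abs_of_nonneg (by positivity)]
      ring
  have hℓ : ∀ z, |Real.log (‖F.eval z‖ / (√n * (n : ℝ) ^ 2))| ≤ m z := fun z =>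
    (hdiv z).trans (by simp only [hm]; linarith)
  have hh : ∀ z, |regLog δ ((n : ℝ) ^ 2) (F.eval z / (√n : ℝ))| ≤ m z := fun z =>
    ((abs_regLog_le hδ (hδ1.trans hΛ) _).trans hδt).trans
      (by simp only [hm]; linarith [abs_nonneg (Real.log ‖F.eval z‖)])
  have hDle : ∀ z, |Real.log (‖F.eval z‖ / (√n * (n : ℝ) ^ 2)) -
      regLog δ ((n : ℝ) ^ 2) (F.eval z / (√n : ℝ))| ≤ D z := by
    intro z
    have h1 := abs_log_sub_regLog_le hδ hδ1 hΛ hA0 (hδt.trans htA) (F.eval z / (√n : ℝ))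
    have h2 : ‖F.eval z / (√n : ℝ)‖ / (n : ℝ) ^ 2 = ‖F.eval z‖ / (√n * (n : ℝ) ^ 2) := by
      rw [norm_div, Complex.norm_real, Real.norm_eq_abs, abs_of_pos hsn, div_div]
    rw [h2] at h1
    refine h1.trans ?_
    simp only [hD, regLogError]
    have h3 : (1 + 2 * |Real.log ‖F.eval z / (√n : ℝ)‖|) ^ 2 ≤
        8 * (Real.log ‖F.eval z‖ ^ 2 + t ^ 2) := by
      have h4 : 1 + 2 * |Real.log ‖F.eval z / (√n : ℝ)‖| ≤ 2 * (|Real.log ‖F.eval z‖| + t) := by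
        have := hdiv' z
        linarith
      have h5 := pow_le_pow_left₀ (by positivity) h4 2
      rw [← sq_abs (Real.log ‖F.eval z‖)]
      nlinarith [sq_nonneg (|Real.log ‖F.eval z‖| - t)]
    have h6 : (1 + 2 * |Real.log ‖F.eval z / (√n : ℝ)‖|) ^ 2 / A ≤
        8 * (Real.log ‖F.eval z‖ ^ 2 + t ^ 2) / A := by gcongr
    linarith
  -- The inequality |x| ≤ x²/t + t turns the L² bound of order t²/n² into an L¹ bound of order t/n².
  have hmle : ∀ z, m z ≤ Real.log ‖F.eval z‖ ^ 2 / t + 2 * t := by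
    intro z
    simp only [hm]
    have h1 : |Real.log ‖F.eval z‖| ≤ Real.log ‖F.eval z‖ ^ 2 / t + t := by
      have : |Real.log ‖F.eval z‖| * t ≤ (Real.log ‖F.eval z‖ ^ 2 / t + t) * t := by
        have h2 : (Real.log ‖F.eval z‖ ^ 2 / t + t) * t = Real.log ‖F.eval z‖ ^ 2 + t ^ 2 := by
          field_simp
        rw [h2, ← sq_abs (Real.log ‖F.eval z‖)]
        nlinarith [sq_nonneg (|Real.log ‖F.eval z‖| - t), sq_nonneg (|Real.log ‖F.eval z‖| + t)]
      exact le_of_mul_le_mul_right this ht0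
    linarith
  have hmI2 : ∀ i, IntegrableOn (fun z => Real.log ‖F.eval z‖ ^ 2 / t + 2 * t) (U i) := fun i =>
    ((hI i).div_const t).add (hconst i _)
  have hmI : ∀ i, IntegrableOn m (U i) := by
    intro i
    refine (hmI2 i).mono' (Measurable.aestronglyMeasurable (by fun_prop)) (ae_of_all _ fun z => ?_)
    rw [Real.norm_eq_abs, abs_of_nonneg (by positivity)]
    exact hmle z
  have hmS : ∀ i, ∫ z in U i, m z ≤ (B + 2 * (Real.pi * r ^ 2)) * t / n ^ 2 := by
    intro i
    refine (integral_mono (hmI i) (hmI2 i) hmle).trans ?_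
    rw [integral_add ((hI i).div_const t) (hconst i _), integral_div, hconstI]
    have h1 : (∫ z in U i, Real.log ‖F.eval z‖ ^ 2) / t ≤ B * t ^ 2 / n ^ 2 / t :=
      div_le_div_of_nonneg_right (hIle i) ht0.le
    have h2 : B * t ^ 2 / n ^ 2 / t = B * t / n ^ 2 := by field_simp
    rw [h2] at h1
    refine (add_le_add h1 le_rfl).trans (le_of_eq ?_)
    ring
  have hEI : ∀ i, IntegrableOn
      (fun z => regLogError δ ((n : ℝ) ^ 2) A (F.eval z / (√n : ℝ))) (U i) := by
    intro i
    have hcont : Continuous fun z => regLogError δ ((n : ℝ) ^ 2) A (F.eval z / (√n : ℝ)) := by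
      have := F.continuous
      fun_prop
    exact (hcont.continuousOn.integrableOn_compact
      (isCompact_closedBall (x i) (r / n))).mono_set Metric.ball_subset_closedBall
  have hD2 : ∀ i, IntegrableOn
      (fun z => 8 * (Real.log ‖F.eval z‖ ^ 2 + t ^ 2) / A) (U i) := fun i =>
    (((hI i).add (hconst i _)).const_mul 8).div_const A
  have hDI : ∀ i, IntegrableOn D (U i) := fun i => (hEI i).add (hD2 i)
  have hDS : ∀ i, ∫ z in U i, D z ≤
      (∫ z in U i, regLogError δ ((n : ℝ) ^ 2) A (F.eval z / (√n : ℝ))) +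
        8 * (B + Real.pi * r ^ 2) * t ^ 2 / (A * n ^ 2) := by
    intro i
    rw [integral_add (hEI i) (hD2 i), integral_div, integral_const_mul,
      integral_add (hI i) (hconst i _), hconstI]
    refine add_le_add le_rfl ?_
    have h1 : (∫ z in U i, Real.log ‖F.eval z‖ ^ 2) + Real.pi * r ^ 2 / n ^ 2 * t ^ 2 ≤
        (B + Real.pi * r ^ 2) * t ^ 2 / n ^ 2 := by
      refine (add_le_add (hIle i) le_rfl).trans (le_of_eq ?_)
      ring
    calc _ ≤ 8 * ((B + Real.pi * r ^ 2) * t ^ 2 / n ^ 2) / A := by gcongr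
      _ = _ := by field_simp
  have hI₁ : Integrable fun w : Fin k → ℂ =>
      (∏ i, Real.log (‖F.eval (w i)‖ / (√n * (n : ℝ) ^ 2))) • Ψ w :=
    LocallyIntegrable.integrable_prod_smul (a := fun _ z =>
      Real.log (‖F.eval z‖ / (√n * (n : ℝ) ^ 2)))
      (fun _ => locallyIntegrable_log_norm_eval_div F (by positivity)) hΨc hΨs
  have hI₂ : Integrable fun w : Fin k → ℂ =>
      (∏ i, regLog δ ((n : ℝ) ^ 2) (F.eval (w i) / (√n : ℝ))) • Ψ w := by
    refine LocallyIntegrable.integrable_prod_smul (a := fun _ z =>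
      regLog δ ((n : ℝ) ^ 2) (F.eval z / (√n : ℝ))) (fun _ => ?_) hΨc hΨs
    have := F.continuous
    have h2 := continuous_regLog hδ (by linarith : (0 : ℝ) < (n : ℝ) ^ 2)
    exact (h2.comp (this.div_const _)).locallyIntegrable
  have hfin := norm_integral_prod_smul_sub_le hUm hQ hΨ (ℓ := fun _ z =>
    Real.log (‖F.eval z‖ / (√n * (n : ℝ) ^ 2))) (h := fun _ z =>
    regLog δ ((n : ℝ) ^ 2) (F.eval z / (√n : ℝ))) (m := fun _ => m) (D := fun _ => D)
    (fun i z _ => hℓ z) (fun i z _ => hh z) (fun i z _ => hDle z) hmI hDI hmS hI₁ hI₂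
  rw [Fintype.card_fin] at hfin
  refine hfin.trans (mul_le_mul_of_nonneg_left (mul_le_mul_of_nonneg_left
    (Finset.sum_le_sum fun i _ => hDS i) (by positivity)) ((norm_nonneg _).trans (hQ 0)))

/-! ### The expected cost of the regularization -/

/-- Plain Cauchy–Schwarz without independence. The resulting second moment O(n) is harmless after
division by Λ² = n⁴. -/
theorem norm_sum_mul_sq_le {n : ℕ} (hn : 0 < n) {L : ℝ} {A u : Fin (n + 1) → ℂ}
    (hA : ∀ j, ‖A j‖ ≤ L / √n) :
    ‖∑ j, u j * A j‖ ^ 2 ≤ 2 * L ^ 2 * ∑ j, ‖u j‖ ^ 2 := by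
  have hn0 : (0 : ℝ) < n := by exact_mod_cast hn
  have hn1 : (1 : ℝ) ≤ n := by exact_mod_cast hn
  have h1 : ‖∑ j, u j * A j‖ ^ 2 ≤ (∑ j, ‖u j * A j‖) ^ 2 :=
    pow_le_pow_left₀ (norm_nonneg _) (norm_sum_le _ _) 2
  have h2 := sq_sum_le_card_mul_sum_sq (s := Finset.univ) (f := fun j => ‖u j * A j‖)
  rw [Finset.card_univ, Fintype.card_fin] at h2
  have h3 : ∑ j, ‖u j * A j‖ ^ 2 ≤ ∑ j, ‖u j‖ ^ 2 * (L ^ 2 / n) := by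
    refine Finset.sum_le_sum fun j _ => ?_
    rw [norm_mul, mul_pow]
    refine mul_le_mul_of_nonneg_left ?_ (sq_nonneg _)
    calc ‖A j‖ ^ 2 ≤ (L / √n) ^ 2 := pow_le_pow_left₀ (norm_nonneg _) (hA j) 2
      _ = L ^ 2 / n := by rw [div_pow, Real.sq_sqrt hn0.le]
  rw [← Finset.sum_mul] at h3
  have h4 : ((n + 1 : ℕ) : ℝ) * (L ^ 2 / n) ≤ 2 * L ^ 2 := by
    push_cast
    rw [← mul_div_assoc, div_le_iff₀ hn0]
    nlinarith [sq_nonneg L]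
  have h5 : 0 ≤ ∑ j, ‖u j‖ ^ 2 := Finset.sum_nonneg fun _ _ => sq_nonneg _
  calc _ ≤ ((n + 1 : ℕ) : ℝ) * ∑ j, ‖u j * A j‖ ^ 2 := h1.trans h2
    _ ≤ ((n + 1 : ℕ) : ℝ) * ((∑ j, ‖u j‖ ^ 2) * (L ^ 2 / n)) := by gcongr
    _ = (((n + 1 : ℕ) : ℝ) * (L ^ 2 / n)) * ∑ j, ‖u j‖ ^ 2 := by ring
    _ ≤ _ := by gcongr

theorem HasBoundedMoments.integrable_sum_sq {Ω : Type*} [MeasurableSpace Ω] {P : Measure Ω}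
    [IsProbabilityMeasure P] {n : ℕ} {ξ : Fin (n + 1) → Ω → ℂ} {τ ε : ℝ}
    (h : HasBoundedMoments P ξ τ ε) (hε₀ : 0 < ε) :
    Integrable (fun ω => ∑ j, ‖ξ j ω‖ ^ 2) P ∧
      ∫ ω, ∑ j, ‖ξ j ω‖ ^ 2 ∂P ≤ ((n : ℝ) + 1) * (1 + τ) := by
  have hi : ∀ j, Integrable (fun ω => ‖ξ j ω‖ ^ 2) P := fun j =>
    (memLp_two_iff_integrable_sq_norm (h.measurable j).aestronglyMeasurable).1
      (memLp_two_of_moment (h.measurable j) hε₀ (h.moment_integrable j))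
  refine ⟨integrable_finsetSum _ fun j _ => hi j, ?_⟩
  rw [integral_finsetSum _ fun j _ => hi j]
  have := Finset.sum_le_card_nsmul Finset.univ (fun j => ∫ ω, ‖ξ j ω‖ ^ 2 ∂P) (1 + τ)
    fun j _ => integral_sq_norm_le_of_moment (h.measurable j) hε₀ (h.moment_integrable j)
      (h.moment_le j)
  rw [nsmul_eq_mul, Finset.card_univ, Fintype.card_fin] at this
  push_cast at this
  exact this

theorem regLogError_le {δ Λ A : ℝ} (hδ : 0 < δ) (hA : 0 ≤ A) (hΛ : 1 ≤ Λ) (y : ℂ) :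
    regLogError δ Λ A y ≤ ‖y‖ ^ 2 + (δ + 3 * A) := by
  unfold regLogError
  have h1 : ‖y‖ ^ 2 / Λ ^ 2 ≤ ‖y‖ ^ 2 := div_le_self (sq_nonneg _) (one_le_pow₀ hΛ)
  have h2 : Real.exp (-(1 / δ * ‖y‖ ^ 2)) ≤ 1 := by
    rw [Real.exp_le_one_iff, neg_nonpos]; positivity
  have h3 := mul_le_mul_of_nonneg_left h2 (by positivity : 0 ≤ 3 * A)
  linarith

theorem eval_orthoPoly_div (p : ℕ → ℝ[X]) {n : ℕ} (u : Fin (n + 1) → ℂ) (z : ℂ) :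
    (orthoPoly p u).eval z / (√n : ℝ) =
      ∑ j : Fin (n + 1), u j * (Polynomial.aeval z (p j) / (√n : ℝ)) := by
  rw [eval_orthoPoly, Finset.sum_div]
  exact Finset.sum_congr rfl fun _ _ => by rw [mul_div_assoc]

section LocalCoefficients

variable {p : ℕ → ℝ[X]} {a b d C₀ κ c₁ : ℝ}

theorem LocalBounds.norm_coeff_le (hLB : LocalBounds p a b d C₀ κ c₁) {n : ℕ} (hn : 0 < n)
    {x : ℝ} (hx : x ∈ Set.Icc a b) {z : ℂ} (hz : ‖z - x‖ ≤ d / n) (j : Fin (n + 1)) :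
    ‖Polynomial.aeval z (p j) / ((√n : ℝ) : ℂ)‖ ≤ C₀ * Real.exp 2 / √n := by
  have h1 := hLB.upper n hn j (Nat.lt_succ_iff.1 j.2) x hx 1 z (by rwa [one_mul])
  rw [mul_one] at h1
  rw [norm_div, Complex.norm_real, Real.norm_eq_abs, abs_of_nonneg (Real.sqrt_nonneg _)]
  gcongr

theorem LocalBounds.le_sum_sq_coeff (hLB : LocalBounds p a b d C₀ κ c₁) {n : ℕ} (hn : 0 < n)
    {x : ℝ} (hx : x ∈ Set.Icc a b) {z : ℂ} (hz : ‖z - x‖ ≤ c₁ / n) :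
    κ ≤ ∑ j : Fin (n + 1), ‖Polynomial.aeval z (p j) / ((√n : ℝ) : ℂ)‖ ^ 2 := by
  have hn0 : (0 : ℝ) < n := by exact_mod_cast hn
  have h1 := hLB.lower n hn x hx z hz
  rw [Fin.sum_univ_eq_sum_range (fun j => ‖Polynomial.aeval z (p j) / ((√n : ℝ) : ℂ)‖ ^ 2) (n + 1)]
  simp_rw [norm_div, Complex.norm_real, Real.norm_eq_abs, abs_of_nonneg (Real.sqrt_nonneg (n : ℝ)),
    div_pow, Real.sq_sqrt hn0.le]
  rw [← Finset.sum_div, le_div_iff₀ hn0]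
  exact h1

end LocalCoefficients

/-- The mean of the local error of the regularization. -/
theorem exists_integral_regLogError_le {p : ℕ → ℝ[X]} {a b d C₀ κ c₁ : ℝ}
    (hLB : LocalBounds p a b d C₀ κ c₁) {τ ε : ℝ} (hτ : 0 < τ) (hε₀ : 0 < ε) (hε₁ : ε < 1)
    {r : ℝ} (hr : 0 ≤ r) (hrd : r ≤ d) (hrc : r ≤ c₁) :
    ∃ B : ℝ, 0 < B ∧ ∀ (n : ℕ), 0 < n → ∀ (Ω : Type u) [MeasurableSpace Ω]
      (P : Measure Ω) [IsProbabilityMeasure P] (ξ : Fin (n + 1) → Ω → ℂ),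
      HasBoundedMoments P ξ τ ε → ∀ x ∈ Set.Icc a b, ∀ δ A : ℝ, 0 < δ → δ ≤ 1 → 0 ≤ A →
      Integrable (fun ω => ∫ z in Metric.ball (x : ℂ) (r / n), regLogError δ ((n : ℝ) ^ 2) A
        ((orthoPoly p fun j => ξ j ω).eval z / (√n : ℝ))) P ∧
      ∫ ω, (∫ z in Metric.ball (x : ℂ) (r / n), regLogError δ ((n : ℝ) ^ 2) A
        ((orthoPoly p fun j => ξ j ω).eval z / (√n : ℝ))) ∂P ≤
        Real.pi * r ^ 2 / n ^ 2 *
          (B * (1 / n + δ + A * (√δ + (δ ^ 2)⁻¹ * (n : ℝ) ^ (-(ε / 2))))) := by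
  have hC₀ := hLB.C₀_pos
  set L := C₀ * Real.exp 2 with hL
  have hL0 : 0 < L := by positivity
  obtain ⟨B₂, hB₂, hsb⟩ := exists_small_ball.{u} hτ hε₀ hε₁ hL0 hLB.κ_pos
  refine ⟨4 * L ^ 2 * (1 + τ) + 1 + 3 * B₂, by positivity, ?_⟩
  intro n hn Ω _ P _ ξ hξ x hx δ A hδ hδ1 hA
  have hn0 : (0 : ℝ) < n := by exact_mod_cast hn
  have hn1 : (1 : ℝ) ≤ n := by exact_mod_cast hn
  set U := Metric.ball (x : ℂ) (r / n) with hU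
  have hVU : (volume : Measure ℂ).real U = Real.pi * r ^ 2 / n ^ 2 := by
    rw [hU, measureReal_ball_complex _ (by positivity)]
    ring
  have : IsFiniteMeasure (volume.restrict U) := ⟨by
    rw [Measure.restrict_apply_univ]; exact measure_ball_lt_top⟩
  obtain ⟨hsqI, hsqle⟩ := hξ.integrable_sum_sq hε₀
  set f : Ω → ℂ → ℂ := fun ω z => (orthoPoly p fun j => ξ j ω).eval z / (√n : ℝ) with hf
  have hfeq : ∀ ω z, f ω z = ∑ j, ξ j ω * (Polynomial.aeval z (p j) / (√n : ℝ)) := fun ω z =>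
    eval_orthoPoly_div p _ z
  have hUz : ∀ z ∈ U, ‖z - x‖ ≤ r / n := fun z hz => by
    rw [hU, Metric.mem_ball, dist_eq_norm] at hz
    exact hz.le
  have hcoef : ∀ z ∈ U, ∀ j : Fin (n + 1),
      ‖Polynomial.aeval z (p j) / ((√n : ℝ) : ℂ)‖ ≤ L / √n := fun z hz j =>
    hLB.norm_coeff_le hn hx ((hUz z hz).trans (by gcongr)) j
  have hfsq : ∀ z ∈ U, ∀ ω, ‖f ω z‖ ^ 2 ≤ 2 * L ^ 2 * ∑ j, ‖ξ j ω‖ ^ 2 := fun z hz ω => by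
    rw [hfeq]
    exact norm_sum_mul_sq_le hn (hcoef z hz)
  have hfm : Measurable (Function.uncurry f) := by
    simp only [Function.uncurry_def, hf]
    exact (measurable_eval_orthoPoly (fun j => (hξ.measurable j).comp measurable_fst)
      measurable_snd).div_const _
  have hfm1 : ∀ z, Measurable fun ω => f ω z := fun z => hfm.comp measurable_prodMk_right
  have herrc := continuous_regLogError δ ((n : ℝ) ^ 2) A
  have hdomI : Integrable (fun ω => 2 * L ^ 2 * ∑ j, ‖ξ j ω‖ ^ 2 + (δ + 3 * A)) P :=
    (hsqI.const_mul _).add (integrable_const _)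
  have hint : Integrable (Function.uncurry fun ω z => regLogError δ ((n : ℝ) ^ 2) A (f ω z))
      (P.prod (volume.restrict U)) := by
    refine (hdomI.comp_fst (volume.restrict U)).mono'
      (herrc.measurable.comp hfm).aestronglyMeasurable ?_
    filter_upwards [Measure.quasiMeasurePreserving_snd.ae (ae_restrict_mem measurableSet_ball)]
      with q hq
    simp only [Function.uncurry]
    rw [Real.norm_eq_abs, abs_of_nonneg (regLogError_nonneg hδ.le hA _)]
    refine (regLogError_le hδ hA (one_le_pow₀ hn1) _).trans ?_
    linarith [hfsq q.2 hq q.1]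
  refine ⟨hint.integral_prod_left, ?_⟩
  have hswap := integral_integral_swap hint
  refine (le_of_eq hswap).trans ?_
  have hpt : ∀ z ∈ U, ∫ ω, regLogError δ ((n : ℝ) ^ 2) A (f ω z) ∂P ≤
      (4 * L ^ 2 * (1 + τ) + 1 + 3 * B₂) *
        (1 / n + δ + A * (√δ + (δ ^ 2)⁻¹ * (n : ℝ) ^ (-(ε / 2)))) := by
    intro z hz
    have i1 : Integrable (fun ω => ‖f ω z‖ ^ 2) P := by
      refine (hsqI.const_mul (2 * L ^ 2)).mono' ((hfm1 z).norm.pow_const 2).aestronglyMeasurable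
        (ae_of_all _ fun ω => ?_)
      rw [Real.norm_eq_abs, abs_of_nonneg (by positivity)]
      exact hfsq z hz ω
    have i2 : Integrable (fun ω => Real.exp (-(1 / δ * ‖f ω z‖ ^ 2))) P := by
      have := hfm1 z
      refine Integrable.of_bound (Measurable.aestronglyMeasurable (by fun_prop)) 1
        (ae_of_all _ fun ω => ?_)
      rw [Real.norm_eq_abs, abs_of_nonneg (Real.exp_nonneg _), Real.exp_le_one_iff, neg_nonpos]
      positivity
    have hm1 : ∫ ω, ‖f ω z‖ ^ 2 ∂P ≤ 4 * L ^ 2 * (1 + τ) * n := by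
      calc ∫ ω, ‖f ω z‖ ^ 2 ∂P ≤ ∫ ω, 2 * L ^ 2 * ∑ j, ‖ξ j ω‖ ^ 2 ∂P :=
            integral_mono i1 (hsqI.const_mul _) (hfsq z hz)
        _ = 2 * L ^ 2 * ∫ ω, ∑ j, ‖ξ j ω‖ ^ 2 ∂P := integral_const_mul _ _
        _ ≤ 2 * L ^ 2 * (((n : ℝ) + 1) * (1 + τ)) := by gcongr
        _ ≤ 2 * L ^ 2 * ((2 * n) * (1 + τ)) := by gcongr; linarith
        _ = _ := by ring
    -- The small ball estimate at s = 1/δ; its hypothesis on ∑|A_j|² is the lower bound for the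
    -- kernel near x.
    have hm2 : ∫ ω, Real.exp (-(1 / δ * ‖f ω z‖ ^ 2)) ∂P ≤
        B₂ * (√δ + (δ ^ 2)⁻¹ * (n : ℝ) ^ (-(ε / 2))) := by
      have h1 := hsb n hn Ω P ξ hξ (fun j => Polynomial.aeval z (p j) / ((√n : ℝ) : ℂ))
        (hcoef z hz) (hLB.le_sum_sq_coeff hn hx ((hUz z hz).trans (by gcongr))) (1 / δ)
        ((one_le_div hδ).2 hδ1)
      have h2 : (√(1 / δ))⁻¹ = √δ := by rw [one_div, Real.sqrt_inv, inv_inv]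
      have h3 : (1 / δ) ^ 2 = (δ ^ 2)⁻¹ := by rw [one_div, inv_pow]
      rw [h2, h3] at h1
      simp_rw [hfeq]
      exact h1
    simp only [regLogError]
    have i3 : Integrable (fun ω => ‖f ω z‖ ^ 2 / ((n : ℝ) ^ 2) ^ 2 + δ) P :=
      (i1.div_const _).add (integrable_const _)
    rw [integral_add i3 (i2.const_mul _), integral_add (i1.div_const _) (integrable_const _),
      integral_div, integral_const_mul]
    simp only [integral_const, probReal_univ, smul_eq_mul, one_mul]
    have h4 : (∫ ω, ‖f ω z‖ ^ 2 ∂P) / ((n : ℝ) ^ 2) ^ 2 ≤ 4 * L ^ 2 * (1 + τ) * (1 / n) := by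
      rw [div_le_iff₀ (by positivity)]
      refine hm1.trans ?_
      have h6 : 4 * L ^ 2 * (1 + τ) * (1 / n) * ((n : ℝ) ^ 2) ^ 2 =
          4 * L ^ 2 * (1 + τ) * (n : ℝ) ^ 3 := by field_simp
      rw [h6]
      have h7 : (n : ℝ) ≤ (n : ℝ) ^ 3 := le_self_pow₀ hn1 (by norm_num)
      gcongr
    have h5 : 3 * A * ∫ ω, Real.exp (-(1 / δ * ‖f ω z‖ ^ 2)) ∂P ≤
        3 * A * (B₂ * (√δ + (δ ^ 2)⁻¹ * (n : ℝ) ^ (-(ε / 2)))) := by gcongr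
    set w₁ := (1 : ℝ) / n with hw₁
    set w₂ := A * (√δ + (δ ^ 2)⁻¹ * (n : ℝ) ^ (-(ε / 2))) with hw₂
    have hw1 : 0 ≤ w₁ := by positivity
    have hw2 : 0 ≤ w₂ := by positivity
    have h6 : 3 * A * (B₂ * (√δ + (δ ^ 2)⁻¹ * (n : ℝ) ^ (-(ε / 2)))) = 3 * B₂ * w₂ := by
      rw [hw₂]; ring
    have hK : 0 ≤ 4 * L ^ 2 * (1 + τ) := by positivity
    nlinarith [mul_nonneg hK hδ.le, mul_nonneg hK hw2, mul_nonneg hB₂.le hδ.le,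
      mul_nonneg hB₂.le hw1]
  calc _ ≤ ∫ z in U, (4 * L ^ 2 * (1 + τ) + 1 + 3 * B₂) *
        (1 / n + δ + A * (√δ + (δ ^ 2)⁻¹ * (n : ℝ) ^ (-(ε / 2)))) :=
        setIntegral_mono_on hint.integral_prod_right (integrable_const _) measurableSet_ball hpt
    _ = _ := by rw [setIntegral_const, hVU, smul_eq_mul]

theorem integral_norm_le_of_support {k : ℕ} {n : ℕ} {x : Fin k → ℂ} {r Q : ℝ}
    (hr : 0 ≤ r) {Ψ : (Fin k → ℂ) → ℂ} (hQ : ∀ w, ‖Ψ w‖ ≤ Q)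
    (hΨ : ∀ w, (∃ i, w i ∉ Metric.ball (x i) (r / n)) → Ψ w = 0) :
    ∫ w, ‖Ψ w‖ ≤ Q * (Real.pi * r ^ 2 / n ^ 2) ^ k := by
  have hQ0 : 0 ≤ Q := (norm_nonneg _).trans (hQ 0)
  set S : Set (Fin k → ℂ) := Set.univ.pi fun i => Metric.ball (x i) (r / n) with hS
  have h1 : ∫ w in S, ‖Ψ w‖ = ∫ w, ‖Ψ w‖ := by
    refine setIntegral_eq_integral_of_forall_compl_eq_zero fun w hw => ?_
    rw [hΨ w, norm_zero]
    simpa [hS] using hw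
  have hvol : volume S = ∏ i, volume (Metric.ball (x i) (r / n)) := by
    rw [hS, volume_pi, Measure.pi_pi]
  have hfin : volume S < ⊤ := by
    rw [hvol]
    exact ENNReal.prod_lt_top fun i _ => measure_ball_lt_top
  have h2 := norm_setIntegral_le_of_norm_le_const (f := fun w => ‖Ψ w‖) (C := Q) hfin
    fun w _ => by rw [norm_norm]; exact hQ w
  rw [h1, Real.norm_eq_abs, measureReal_def, hvol, ENNReal.toReal_prod] at h2
  refine (le_abs_self _).trans (h2.trans (le_of_eq ?_))
  have h3 : ∀ i, (volume (Metric.ball (x i) (r / n))).toReal = Real.pi * r ^ 2 / n ^ 2 := by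
    intro i
    rw [← measureReal_def, measureReal_ball_complex _ (by positivity)]
    ring
  simp_rw [h3]
  rw [Finset.prod_const, Finset.card_univ, Fintype.card_fin]

theorem pow_mul_inv_pow_le {t : ℝ} (ht : 1 ≤ t) {a b : ℕ} (hab : a + 1 ≤ b) :
    t ^ a * (t ^ b)⁻¹ ≤ t⁻¹ := by
  have ht0 : 0 < t := by linarith
  rw [← div_eq_mul_inv, div_le_iff₀ (by positivity), ← div_eq_inv_mul, le_div_iff₀ ht0, ← pow_succ]
  exact pow_le_pow_right₀ ht hab

/-- Bookkeeping of the powers of `n` in the estimate for a single coefficient vector. -/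
theorem total_error_le {j : ℕ} {n t B₁ B₂ V C : ℝ} (ht : 1 ≤ t) (hB₁ : 0 ≤ B₁) (hB₂ : 0 ≤ B₂)
    (hV : 0 ≤ V) (hC : 0 ≤ C) (hn : t ^ (100 * (j + 1) ^ 2) ≤ n) :
    (C * n ^ (2 * (j + 1))) * (((B₁ + 2 * V) * t / n ^ 2) ^ j * ((j + 1 : ℕ) *
      (V / n ^ 2 * (B₂ * (1 / n + (t ^ (4 * (j + 1) + 8))⁻¹ + t ^ (j + 1 + 3) *
        ((t ^ (2 * (j + 1) + 4))⁻¹ + ((t ^ (4 * (j + 1) + 8))⁻¹ ^ 2)⁻¹ *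
          (t ^ (50 * (j + 1) ^ 2))⁻¹))) + 8 * (B₁ + V) * t ^ 2 / (t ^ (j + 1 + 3) * n ^ 2)))) +
      (j + 1 : ℕ) * ((n ^ (j + 2))⁻¹ * (C * n ^ (j + 1) +
        t ^ (j + 1) * (C * n ^ (2 * (j + 1)) * (V / n ^ 2) ^ (j + 1)))) ≤
      (C * (B₁ + 2 * V) ^ j * (j + 1 : ℕ) * (4 * V * B₂ + 8 * (B₁ + V)) +
        (j + 1 : ℕ) * C * (1 + V ^ (j + 1))) * t⁻¹ := by
  have ht0 : 0 < t := by linarith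
  have htn : t ≤ n := le_trans (by
    calc t = t ^ 1 := (pow_one t).symm
      _ ≤ _ := pow_le_pow_right₀ ht (Nat.succ_le_of_lt (by positivity))) hn
  have hn0 : 0 < n := by linarith
  -- With k = j + 1 the powers of t encode 1/δ = t^(4k+8), δ^(-1/2) = t^(2k+4), the truncation A =
  -- t^(k+3) and n^(ε/2) = t^(50k²). Each term, even after the factor t^j from the other variables,
  -- keeps a factor t⁻¹.
  have e1 : t ^ j * (1 / n) ≤ t⁻¹ := by
    rw [mul_one_div, div_le_iff₀ hn0, ← div_eq_inv_mul, le_div_iff₀ ht0, ← pow_succ]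
    exact (pow_le_pow_right₀ ht (by nlinarith)).trans hn
  have e2 : t ^ j * (t ^ (4 * (j + 1) + 8))⁻¹ ≤ t⁻¹ := pow_mul_inv_pow_le ht (by omega)
  have e3 : t ^ j * (t ^ (j + 1 + 3) * (t ^ (2 * (j + 1) + 4))⁻¹) ≤ t⁻¹ := by
    rw [← mul_assoc, ← pow_add]
    exact pow_mul_inv_pow_le ht (by omega)
  have e4 : t ^ j * (t ^ (j + 1 + 3) * (((t ^ (4 * (j + 1) + 8))⁻¹ ^ 2)⁻¹ *
      (t ^ (50 * (j + 1) ^ 2))⁻¹)) ≤ t⁻¹ := by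
    rw [inv_pow, inv_inv, ← pow_mul, ← mul_assoc, ← mul_assoc, ← pow_add, ← pow_add]
    exact pow_mul_inv_pow_le ht (by nlinarith)
  have e5 : t ^ j * (t ^ 2 * (t ^ (j + 1 + 3))⁻¹) ≤ t⁻¹ := by
    rw [← mul_assoc, ← pow_add]
    exact pow_mul_inv_pow_le ht (by omega)
  have e6 : n⁻¹ ≤ t⁻¹ := inv_anti₀ ht0 htn
  have e7 : (n ^ (j + 2))⁻¹ * t ^ (j + 1) ≤ t⁻¹ := by
    refine le_trans ?_ e6
    have : t ^ (j + 1) ≤ n ^ (j + 1) := pow_le_pow_left₀ ht0.le htn _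
    calc (n ^ (j + 2))⁻¹ * t ^ (j + 1) ≤ (n ^ (j + 2))⁻¹ * n ^ (j + 1) := by gcongr
      _ = n⁻¹ := by field_simp; ring
  have h1 : (C * n ^ (2 * (j + 1))) * (((B₁ + 2 * V) * t / n ^ 2) ^ j * ((j + 1 : ℕ) *
      (V / n ^ 2 * (B₂ * (1 / n + (t ^ (4 * (j + 1) + 8))⁻¹ + t ^ (j + 1 + 3) *
        ((t ^ (2 * (j + 1) + 4))⁻¹ + ((t ^ (4 * (j + 1) + 8))⁻¹ ^ 2)⁻¹ *
          (t ^ (50 * (j + 1) ^ 2))⁻¹))) + 8 * (B₁ + V) * t ^ 2 / (t ^ (j + 1 + 3) * n ^ 2)))) =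
      (C * (B₁ + 2 * V) ^ j * (j + 1 : ℕ)) * (V * B₂ * (t ^ j * (1 / n) +
        t ^ j * (t ^ (4 * (j + 1) + 8))⁻¹ + t ^ j * (t ^ (j + 1 + 3) * (t ^ (2 * (j + 1) + 4))⁻¹) +
        t ^ j * (t ^ (j + 1 + 3) * (((t ^ (4 * (j + 1) + 8))⁻¹ ^ 2)⁻¹ *
          (t ^ (50 * (j + 1) ^ 2))⁻¹))) + 8 * (B₁ + V) * (t ^ j * (t ^ 2 * (t ^ (j + 1 + 3))⁻¹))) := by
    have e8 : n ^ (2 * (j + 1)) = (n ^ 2) ^ j * n ^ 2 := by rw [pow_mul, pow_succ]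
    have e9 : 8 * (B₁ + V) * t ^ 2 / (t ^ (j + 1 + 3) * n ^ 2) =
        8 * (B₁ + V) * (t ^ 2 * (t ^ (j + 1 + 3))⁻¹) / n ^ 2 := by
      field_simp
    rw [e8, e9, div_pow, mul_pow]
    generalize ((t ^ (4 * (j + 1) + 8))⁻¹ ^ 2)⁻¹ * (t ^ (50 * (j + 1) ^ 2))⁻¹ = X₁
    generalize (t ^ (4 * (j + 1) + 8))⁻¹ = X₂
    generalize (t ^ (2 * (j + 1) + 4))⁻¹ = X₃
    generalize t ^ 2 * (t ^ (j + 1 + 3))⁻¹ = X₄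
    generalize t ^ (j + 1 + 3) = X₅
    have hnj : (n ^ 2) ^ j ≠ 0 := by positivity
    generalize (n ^ 2) ^ j = X₆ at hnj
    field_simp
    ring
  have h2 : (j + 1 : ℕ) * ((n ^ (j + 2))⁻¹ * (C * n ^ (j + 1) +
        t ^ (j + 1) * (C * n ^ (2 * (j + 1)) * (V / n ^ 2) ^ (j + 1)))) =
      (j + 1 : ℕ) * C * (n⁻¹ + V ^ (j + 1) * ((n ^ (j + 2))⁻¹ * t ^ (j + 1))) := by
    have e8 : n ^ (2 * (j + 1)) * (V / n ^ 2) ^ (j + 1) = V ^ (j + 1) := by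
      rw [div_pow, pow_mul]
      field_simp
    have e9 : (n ^ (j + 2))⁻¹ * n ^ (j + 1) = n⁻¹ := by
      field_simp
      ring
    rw [mul_assoc C, e8, ← e9]
    ring
  rw [h1, h2, add_mul]
  refine add_le_add ?_ ?_
  · rw [mul_assoc (C * (B₁ + 2 * V) ^ j * (j + 1 : ℕ))]
    refine mul_le_mul_of_nonneg_left ?_ (by positivity)
    have h3 := mul_le_mul_of_nonneg_left (add_le_add (add_le_add (add_le_add e1 e2) e3) e4)
      (mul_nonneg hV hB₂)
    have h4 := mul_le_mul_of_nonneg_left e5 (by positivity : 0 ≤ 8 * (B₁ + V))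
    refine (add_le_add h3 h4).trans (le_of_eq ?_)
    ring
  · rw [mul_assoc ((j + 1 : ℕ) * C)]
    refine mul_le_mul_of_nonneg_left ?_ (by positivity)
    have h3 := mul_le_mul_of_nonneg_left e7 (pow_nonneg hV (j + 1))
    linarith

theorem aestronglyMeasurable_integral_prod_log {Ω : Type*} [MeasurableSpace Ω] {P : Measure Ω}
    [IsProbabilityMeasure P] {k n : ℕ} {p : ℕ → ℝ[X]} {ξ : Fin (n + 1) → Ω → ℂ}
    (hm : ∀ j, Measurable (ξ j)) {h : ℂ → ℝ} (hh : Measurable h) {Ψ : (Fin k → ℂ) → ℂ}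
    (hΨ : Continuous Ψ) :
    AEStronglyMeasurable
      (fun ω => ∫ w, (∏ i, h ((orthoPoly p fun j => ξ j ω).eval (w i))) • Ψ w) P := by
  refine (StronglyMeasurable.integral_prod_right (f := fun ω (w : Fin k → ℂ) =>
    (∏ i, h ((orthoPoly p fun j => ξ j ω).eval (w i))) • Ψ w)
    (Measurable.stronglyMeasurable ?_)).aestronglyMeasurable
  simp only [Function.uncurry_def]
  refine Measurable.smul (Finset.measurable_fun_prod _ fun i _ => hh.comp ?_)
    (hΨ.measurable.comp measurable_snd)
  exact measurable_eval_orthoPoly (fun j => (hm j).comp measurable_fst)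
    ((measurable_pi_apply i).comp measurable_snd)

theorem norm_integral_prod_regLog_le {k n : ℕ} {δ Λ t Q r : ℝ} (hδ : 0 < δ) (hδΛ : δ ≤ Λ)
    (hδt : Real.log (Λ / δ) ≤ t) (hr : 0 ≤ r) {x : Fin k → ℂ} {Ψ : (Fin k → ℂ) → ℂ}
    (hΨc : Continuous Ψ) (hΨs : HasCompactSupport Ψ) (hQ : ∀ w, ‖Ψ w‖ ≤ Q)
    (hΨ : ∀ w, (∃ i, w i ∉ Metric.ball (x i) (r / n)) → Ψ w = 0) (y : (Fin k → ℂ) → Fin k → ℂ) :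
    ‖∫ w, (∏ i, regLog δ Λ (y w i)) • Ψ w‖ ≤ t ^ k * (Q * (Real.pi * r ^ 2 / n ^ 2) ^ k) := by
  have ht : 0 ≤ t := (abs_nonneg _).trans ((abs_regLog_le hδ hδΛ 0).trans hδt)
  calc _ ≤ ∫ w, t ^ k * ‖Ψ w‖ := by
        refine norm_integral_le_of_norm_le
          ((hΨc.integrable_of_hasCompactSupport hΨs).norm.const_mul _) (ae_of_all _ fun w => ?_)
        rw [norm_smul, Real.norm_eq_abs, Finset.abs_prod]
        refine mul_le_mul_of_nonneg_right ?_ (norm_nonneg _)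
        refine (Finset.prod_le_prod (fun _ _ => abs_nonneg _) fun i _ =>
          (abs_regLog_le hδ hδΛ (y w i)).trans hδt).trans (le_of_eq ?_)
        rw [Finset.prod_const, Finset.card_univ, Fintype.card_fin]
    _ = t ^ k * ∫ w, ‖Ψ w‖ := integral_const_mul _ _
    _ ≤ _ := by
        gcongr
        exact integral_norm_le_of_support hr hQ hΨ

set_option maxHeartbeats 1000000 in
/-- Replacing the logarithm by the regularized one for a single coefficient vector. -/
theorem IsAdmissibleMeasure.exists_norm_integral_log_sub_regLog_le {K : Set ℝ} {μ : Measure ℝ}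
    {w : ℝ → ℝ} {p : ℕ → ℝ[X]} (h : IsAdmissibleMeasure K μ w p) {a b d C₀ κ c₁ : ℝ}
    (hLB : LocalBounds p a b d C₀ κ c₁) {τ ε : ℝ} (hτ : 0 < τ) (hε₀ : 0 < ε) (hε₁ : ε < 1) {c : ℝ}
    (hc : 0 < c) (hcd : 65 * c ≤ d) (hcc : 3 * c ≤ c₁) {k : ℕ} (hk : 0 < k) {C θ : ℝ} (hC : 0 < C)
    (hθ : θ = ε / (100 * k ^ 2)) :
    ∃ (B : ℝ) (n₀ : ℕ), 0 < B ∧ 3 ≤ n₀ ∧ ∀ n : ℕ, n₀ ≤ n →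
      Real.log ((n : ℝ) ^ 2 / (((n : ℝ) ^ θ) ^ (4 * k + 8))⁻¹) ≤ (n : ℝ) ^ θ ∧
      ∀ (Ω : Type u) [MeasurableSpace Ω] (P : Measure Ω) [IsProbabilityMeasure P]
        (ξ : Fin (n + 1) → Ω → ℂ), HasBoundedMoments P ξ τ ε →
      ∀ (x : Fin k → ℝ), (∀ i, x i ∈ Set.Icc a b) → ∀ Ψ : (Fin k → ℂ) → ℂ, Continuous Ψ →
      HasCompactSupport Ψ → (∀ w, ‖Ψ w‖ ≤ C * (n : ℝ) ^ (2 * k)) →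
      (∀ w, (∃ i, w i ∉ Metric.ball (x i : ℂ) (3 * c / n)) → Ψ w = 0) →
      (∀ ω, ‖∫ w, (∏ i, Real.log (‖(orthoPoly p fun j => ξ j ω).eval (w i)‖ /
        (√n * (n : ℝ) ^ 2))) • Ψ w‖ ≤ C * (n : ℝ) ^ k) →
      ‖(∫ ω, ∫ w, (∏ i, Real.log (‖(orthoPoly p fun j => ξ j ω).eval (w i)‖ /
          (√n * (n : ℝ) ^ 2))) • Ψ w ∂volume ∂P) -
        ∫ ω, ∫ w, (∏ i, regLog (((n : ℝ) ^ θ) ^ (4 * k + 8))⁻¹ ((n : ℝ) ^ 2)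
          ((orthoPoly p fun j => ξ j ω).eval (w i) / (√n : ℝ))) • Ψ w ∂volume ∂P‖ ≤
        B * ((n : ℝ) ^ θ)⁻¹ := by
  obtain ⟨B₁, hB₁, hgood⟩ := h.exists_good_event.{u} hLB hτ hε₀ hc hcd
  have hcpos : (0 : ℝ) ≤ 3 * c := by linarith
  obtain ⟨B₂, hB₂, herr⟩ := exists_integral_regLogError_le.{u} hLB hτ hε₀ hε₁ hcpos
    (by linarith) hcc
  have hk1 : (1 : ℝ) ≤ k := by exact_mod_cast hk
  have hθ0 : 0 < θ := by rw [hθ]; positivity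
  have hθk : θ * (100 * (k : ℝ) ^ 2) = ε := by rw [hθ]; field_simp
  -- The failure probability n^(-k-1) beats the deterministic size O(n^k) of the integral on the bad
  -- event.
  obtain ⟨n₁, hgood⟩ := hgood (k + 1) θ (by positivity) hθ0
  obtain ⟨n₂, hn₂⟩ := Filter.eventually_atTop.1 (eventually_mul_sq_log_le_rpow 5 hθ0)
  set V := Real.pi * (3 * c) ^ 2 with hV
  have hV0 : 0 < V := by positivity
  obtain ⟨j, rfl⟩ : ∃ j, k = j + 1 := ⟨k - 1, by omega⟩
  refine ⟨C * (B₁ + 2 * V) ^ j * (j + 1 : ℕ) * (4 * V * B₂ + 8 * (B₁ + V)) +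
        (j + 1 : ℕ) * C * (1 + V ^ (j + 1)), max 3 (max n₁ n₂), by positivity, le_max_left _ _, ?_⟩
  intro n hn
  have hn3 : 3 ≤ n := (le_max_left _ _).trans hn
  have hnn₁ : n₁ ≤ n := ((le_max_left _ _).trans (le_max_right _ _)).trans hn
  have hnn₂ : n₂ ≤ n := ((le_max_right _ _).trans (le_max_right _ _)).trans hn
  have hnpos : 0 < n := by omega
  have hn3' : (3 : ℝ) ≤ n := by exact_mod_cast hn3
  have hn0 : (0 : ℝ) < n := by linarith
  have hn1 : (1 : ℝ) ≤ n := by linarith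
  have hlog := hn₂ n hnn₂
  set t := (n : ℝ) ^ θ with ht
  have ht1 : 1 ≤ t := Real.one_le_rpow hn1 hθ0.le
  have ht0 : 0 < t := by linarith
  have hll1 : 1 ≤ Real.log n := by
    rw [Real.le_log_iff_exp_le hn0]
    exact Real.exp_one_lt_d9.le.trans (by linarith)
  have hlog5 : 5 * Real.log n ≤ t := by nlinarith
  set δ := (t ^ (4 * (j + 1) + 8))⁻¹ with hδdef
  have hδ : 0 < δ := by positivity
  have hδ1 : δ ≤ 1 := inv_le_one_of_one_le₀ (one_le_pow₀ ht1)
  have hlogt : Real.log t = θ * Real.log n := Real.log_rpow hn0 _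
  have hδt : Real.log ((n : ℝ) ^ 2 / δ) ≤ t := by
    rw [hδdef, div_inv_eq_mul, Real.log_mul (by positivity) (by positivity), Real.log_pow,
      Real.log_pow, hlogt]
    have h1 : ((4 * (j + 1) + 8 : ℕ) : ℝ) * θ ≤ 1 := by
      push_cast at hθk hk1 ⊢
      nlinarith [mul_nonneg hθ0.le (by positivity : (0 : ℝ) ≤ j),
        mul_nonneg hθ0.le (by positivity : (0 : ℝ) ≤ (j : ℝ) ^ 2)]
    have h2 := mul_le_mul_of_nonneg_right h1 (by linarith : 0 ≤ Real.log n)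
    push_cast at h2 ⊢
    nlinarith
  refine ⟨hδt, ?_⟩
  intro Ω _ P _ ξ hξ x hx Ψ hΨc hΨs hQ hΨ hVbd
  -- Large enough that t^j · t²/A is small, and small enough that t^j · A√δ is small.
  set A := t ^ (j + 1 + 3) with hA
  have htA : t ≤ A := le_self_pow₀ ht1 (by omega)
  have hA0 : 0 ≤ A := by positivity
  choose E hEm hEP hE using fun i => hgood n hnn₁ Ω P ξ hξ (x i) (hx i)
  set Q := C * (n : ℝ) ^ (2 * (j + 1)) with hQdef
  set v : Ω → ℂ := fun ω => ∫ w : Fin (j + 1) → ℂ,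
    (∏ i, Real.log (‖(orthoPoly p fun j => ξ j ω).eval (w i)‖ /
        (√n * (n : ℝ) ^ 2))) • Ψ w with hv
  set vh : Ω → ℂ := fun ω => ∫ w : Fin (j + 1) → ℂ, (∏ i, regLog δ ((n : ℝ) ^ 2)
          ((orthoPoly p fun j => ξ j ω).eval (w i) / (√n : ℝ))) • Ψ w with hvh
  have hδΛ : δ ≤ (n : ℝ) ^ 2 := hδ1.trans (one_le_pow₀ hn1)
  have hvm : AEStronglyMeasurable v P := aestronglyMeasurable_integral_prod_log
    (h := fun z => Real.log (‖z‖ / (√n * (n : ℝ) ^ 2))) hξ.measurable (by fun_prop) hΨc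
  have hvhm : AEStronglyMeasurable vh P := aestronglyMeasurable_integral_prod_log
    (h := fun z => regLog δ ((n : ℝ) ^ 2) (z / (√n : ℝ))) hξ.measurable
    ((continuous_regLog hδ (by positivity)).measurable.comp (measurable_id.div_const _)) hΨc
  have hvhle : ∀ ω, ‖vh ω‖ ≤ t ^ (j + 1) * (Q * (V / n ^ 2) ^ (j + 1)) := fun ω =>
    norm_integral_prod_regLog_le hδ hδΛ hδt hcpos hΨc hΨs hQ hΨ
      fun w i => (orthoPoly p fun j => ξ j ω).eval (w i) / (√n : ℝ)
  have hvI : Integrable v P := Integrable.of_bound hvm _ (ae_of_all _ hVbd)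
  have hvhI : Integrable vh P := Integrable.of_bound hvhm _ (ae_of_all _ hvhle)
  set Y : Fin (j + 1) → Ω → ℝ := fun i ω => ∫ z in Metric.ball (x i : ℂ) (3 * c / n),
    regLogError δ ((n : ℝ) ^ 2) A ((orthoPoly p fun j => ξ j ω).eval z / (√n : ℝ)) with hY
  have hY0 : ∀ i ω, 0 ≤ Y i ω := fun i ω =>
    integral_nonneg fun z => regLogError_nonneg hδ.le hA0 _
  have hYI := fun i => herr n hnpos Ω P ξ hξ (x i) (hx i) δ A hδ hδ1 hA0
  set e := 8 * (B₁ + V) * t ^ 2 / (A * n ^ 2) with he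
  have he0 : 0 ≤ e := by positivity
  set S := ((B₁ + 2 * V) * t / n ^ 2) ^ j with hS
  have hS0 : 0 ≤ S := by positivity
  have hQ0 : 0 ≤ Q := by positivity
  set bad := C * (n : ℝ) ^ (j + 1) + t ^ (j + 1) * (Q * (V / n ^ 2) ^ (j + 1)) with hbad
  have hbad0 : 0 ≤ bad := by positivity
  have hpt : ∀ ω, ‖v ω - vh ω‖ ≤ Q * (S * ∑ i, (Y i ω + e)) +
      ∑ i, (E i)ᶜ.indicator (fun _ => bad) ω := by
    intro ω
    have hsum0 : 0 ≤ ∑ i, (Y i ω + e) := Finset.sum_nonneg fun i _ => add_nonneg (hY0 i ω) he0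
    have hmain0 : 0 ≤ Q * (S * ∑ i, (Y i ω + e)) := mul_nonneg hQ0 (mul_nonneg hS0 hsum0)
    have hind0 : ∀ i, 0 ≤ (E i)ᶜ.indicator (fun _ => bad) ω := fun i =>
      Set.indicator_nonneg (fun _ _ => hbad0) ω
    -- On the intersection of the k good events the deterministic replacement applies; elsewhere
    -- both integrals are bounded trivially by `bad`.
    by_cases hω : ∀ i, ω ∈ E i
    · refine le_add_of_le_of_nonneg ?_ (Finset.sum_nonneg fun i _ => hind0 i)
      exact norm_integral_log_sub_regLog_le hnpos hcpos hB₁.le ht1 hlog5 hδ hδ1 hδt htA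
        (fun i => (hE i ω (hω i)).1) (fun i => (hE i ω (hω i)).2) hΨc hΨs hQ hΨ
    · push Not at hω
      obtain ⟨i, hi⟩ := hω
      refine le_add_of_nonneg_of_le hmain0 ?_
      refine le_trans ?_ (Finset.single_le_sum (f := fun i => (E i)ᶜ.indicator (fun _ => bad) ω)
        (fun i _ => hind0 i) (Finset.mem_univ i))
      rw [Set.indicator_of_mem (Set.mem_compl hi)]
      exact (norm_sub_le _ _).trans (add_le_add (hVbd ω) (hvhle ω))
  have hYeI : ∀ i, Integrable (fun ω => Y i ω + e) P := fun i => (hYI i).1.add (integrable_const _)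
  have hI1 : Integrable (fun ω => Q * (S * ∑ i, (Y i ω + e))) P :=
    ((integrable_finsetSum _ fun i _ => hYeI i).const_mul S).const_mul Q
  have hI2 : ∀ i, Integrable ((E i)ᶜ.indicator (fun _ : Ω => bad)) P := fun i =>
    (integrable_const _).indicator (hEm i).compl
  have hI3 : Integrable (fun ω => ∑ i, (E i)ᶜ.indicator (fun _ : Ω => bad) ω) P :=
    integrable_finsetSum _ fun i _ => hI2 i
  have hint : ‖(∫ ω, v ω ∂P) - ∫ ω, vh ω ∂P‖ ≤
      ∫ ω, (Q * (S * ∑ i, (Y i ω + e)) + ∑ i, (E i)ᶜ.indicator (fun _ : Ω => bad) ω) ∂P := by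
    rw [← integral_sub hvI hvhI]
    exact norm_integral_le_of_norm_le (hI1.add hI3) (ae_of_all _ hpt)
  refine hint.trans ?_
  rw [integral_add hI1 hI3, integral_const_mul, integral_const_mul,
    integral_finsetSum _ fun i _ => hYeI i, integral_finsetSum _ fun i _ => hI2 i]
  have hsqrt : √δ = (t ^ (2 * (j + 1) + 4))⁻¹ := by
    rw [hδdef, Real.sqrt_inv]
    congr 1
    rw [show t ^ (4 * (j + 1) + 8) = (t ^ (2 * (j + 1) + 4)) ^ 2 by ring]
    exact Real.sqrt_sq (by positivity)
  have heps : (n : ℝ) ^ (-(ε / 2)) = (t ^ (50 * (j + 1) ^ 2))⁻¹ := by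
    rw [Real.rpow_neg hn0.le, ht, ← Real.rpow_natCast, ← Real.rpow_mul hn0.le]
    congr 2
    rw [← hθk]
    push_cast
    ring
  have htn : t ^ (100 * (j + 1) ^ 2) ≤ n := by
    rw [ht, ← Real.rpow_natCast, ← Real.rpow_mul hn0.le]
    have h1 : θ * ((100 * (j + 1) ^ 2 : ℕ) : ℝ) = ε := by
      rw [← hθk]
      push_cast
      ring
    rw [h1]
    calc (n : ℝ) ^ ε ≤ (n : ℝ) ^ (1 : ℝ) := Real.rpow_le_rpow_of_exponent_le hn1 hε₁.le
      _ = n := Real.rpow_one _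
  have hsumY : ∑ i, ∫ ω, (Y i ω + e) ∂P ≤ ((j + 1 : ℕ) : ℝ) *
      (V / n ^ 2 * (B₂ * (1 / n + δ + A * ((t ^ (2 * (j + 1) + 4))⁻¹ + (δ ^ 2)⁻¹ *
          (t ^ (50 * (j + 1) ^ 2))⁻¹))) + e) := by
    have := Finset.sum_le_card_nsmul Finset.univ (fun i => ∫ ω, (Y i ω + e) ∂P)
      (V / n ^ 2 * (B₂ * (1 / n + δ + A * ((t ^ (2 * (j + 1) + 4))⁻¹ + (δ ^ 2)⁻¹ *
          (t ^ (50 * (j + 1) ^ 2))⁻¹))) + e) fun i _ => by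
        rw [integral_add (hYI i).1 (integrable_const _)]
        simp only [integral_const, probReal_univ, smul_eq_mul, one_mul]
        have h1 := (hYI i).2
        rw [hsqrt, heps] at h1
        exact add_le_add h1 le_rfl
    rwa [nsmul_eq_mul, Finset.card_univ, Fintype.card_fin] at this
  have hsumE : ∑ i, ∫ ω, (E i)ᶜ.indicator (fun _ => bad) ω ∂P ≤ ((j + 1 : ℕ) : ℝ) *
      (((n : ℝ) ^ (j + 2))⁻¹ * bad) := by
    have := Finset.sum_le_card_nsmul Finset.univ
      (fun i => ∫ ω, (E i)ᶜ.indicator (fun _ => bad) ω ∂P) (((n : ℝ) ^ (j + 2))⁻¹ * bad)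
      fun i _ => by
        rw [integral_indicator_const _ (hEm i).compl, smul_eq_mul]
        refine mul_le_mul_of_nonneg_right ((hEP i).trans (le_of_eq ?_)) hbad0
        rw [Real.rpow_neg hn0.le]
        congr 1
        rw [← Real.rpow_natCast]
        congr 1
        push_cast
        ring
    rwa [nsmul_eq_mul, Finset.card_univ, Fintype.card_fin] at this
  refine (add_le_add (mul_le_mul_of_nonneg_left (mul_le_mul_of_nonneg_left hsumY hS0) hQ0)
    hsumE).trans ?_
  exact total_error_le ht1 hB₁.le hB₂.le hV0.le hC.le htn

/-! ### Test functions, integrability and the final comparison -/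

/-- Fubini, so that the two expectations can be compared at each fixed w. -/
theorem integral_integral_prod_regLog_eq {Ω : Type*} [MeasurableSpace Ω] {P : Measure Ω}
    [IsProbabilityMeasure P] {k n : ℕ} {p : ℕ → ℝ[X]} {ξ : Fin (n + 1) → Ω → ℂ}
    (hm : ∀ j, Measurable (ξ j)) {δ Λ : ℝ} (hδ : 0 < δ) (hδΛ : δ ≤ Λ) {Ψ : (Fin k → ℂ) → ℂ}
    (hΨc : Continuous Ψ) (hΨs : HasCompactSupport Ψ) (s : ℂ) :
    Integrable (fun w : Fin k → ℂ =>
      (∫ ω, ∏ i, regLog δ Λ ((orthoPoly p fun j => ξ j ω).eval (w i) / s) ∂P) • Ψ w) ∧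
    ∫ ω, ∫ w, (∏ i, regLog δ Λ ((orthoPoly p fun j => ξ j ω).eval (w i) / s)) • Ψ w ∂volume ∂P =
      ∫ w, (∫ ω, ∏ i, regLog δ Λ ((orthoPoly p fun j => ξ j ω).eval (w i) / s) ∂P) • Ψ w := by
  have hint : Integrable (Function.uncurry fun ω (w : Fin k → ℂ) =>
      (∏ i, regLog δ Λ ((orthoPoly p fun j => ξ j ω).eval (w i) / s)) • Ψ w)
      (P.prod volume) := by
    refine (((hΨc.integrable_of_hasCompactSupport hΨs).norm.const_mul
      (Real.log (Λ / δ) ^ k)).comp_snd P).mono' (Measurable.aestronglyMeasurable ?_)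
      (ae_of_all _ fun q => ?_)
    · simp only [Function.uncurry_def]
      refine Measurable.smul (Finset.measurable_fun_prod _ fun i _ =>
        (continuous_regLog hδ (hδ.trans_le hδΛ)).measurable.comp ?_)
        (hΨc.measurable.comp measurable_snd)
      exact (measurable_eval_orthoPoly (fun j => (hm j).comp measurable_fst)
        ((measurable_pi_apply i).comp measurable_snd)).div_const s
    · simp only [Function.uncurry]
      rw [norm_smul, Real.norm_eq_abs, Finset.abs_prod]
      refine mul_le_mul_of_nonneg_right ?_ (norm_nonneg _)
      refine (Finset.prod_le_prod (fun _ _ => abs_nonneg _) fun i _ =>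
        abs_regLog_le hδ hδΛ _).trans (le_of_eq ?_)
      rw [Finset.prod_const, Finset.card_univ, Fintype.card_fin]
  have h1 := hint.integral_prod_right
  have h2 := integral_integral_swap hint
  simp only [Function.uncurry_apply_pair] at h1
  simp_rw [integral_smul_const] at h1 h2
  exact ⟨h1, h2⟩

theorem natDegree_orthoPoly_le {p : ℕ → ℝ[X]} (hp : ∀ n, (p n).degree = n) {n : ℕ}
    (u : Fin (n + 1) → ℂ) : (orthoPoly p u).natDegree ≤ n := by
  refine Polynomial.natDegree_sum_le_of_forall_le _ _ fun j _ => ?_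
  refine (Polynomial.natDegree_C_mul_le _ _).trans (Polynomial.natDegree_map_le.trans ?_)
  rw [Polynomial.natDegree_eq_of_degree_eq_some (hp j)]
  exact Nat.lt_succ_iff.1 j.2

/-- The localized Laplacian of a test function supported near the interval. -/
theorem coordLaplacian_test_function {k n : ℕ} (hn : 0 < n) {C c : ℝ} (hc : 0 < c)
    {x : Fin k → ℝ} {z : Fin k → ℂ} (hz : ∀ i, ‖z i - x i‖ < c / n) {G : (Fin k → ℂ) → ℂ}
    (hsupp : Function.support G ⊆ Set.univ.pi fun i => Metric.ball (z i) (c / n))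
    (hG : ContDiff ℝ ((2 * k : ℕ) : WithTop ℕ∞) G)
    (hbd : ∀ y, ‖iteratedFDeriv ℝ (2 * k) G y‖ ≤ C * (n : ℝ) ^ (2 * k)) :
    HasCompactSupport G ∧ Continuous (coordLaplacian (List.finRange k) G) ∧
      HasCompactSupport (coordLaplacian (List.finRange k) G) ∧
      (∀ w, ‖coordLaplacian (List.finRange k) G w‖ ≤ 2 ^ k * C * (n : ℝ) ^ (2 * k)) ∧
      ∀ w, (∃ i, w i ∉ Metric.ball (x i : ℂ) (3 * c / n)) →
        coordLaplacian (List.finRange k) G w = 0 := by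
  have hn0 : (0 : ℝ) < n := by exact_mod_cast hn
  set T : Set (Fin k → ℂ) := Set.univ.pi fun i => Metric.closedBall (z i) (c / n) with hT
  have hTc : IsCompact T := isCompact_univ_pi fun i => isCompact_closedBall _ _
  have hts : tsupport G ⊆ T := closure_minimal
    (hsupp.trans (Set.pi_mono fun i _ => Metric.ball_subset_closedBall)) hTc.isClosed
  have hcs : HasCompactSupport G := hTc.of_isClosed_subset (isClosed_tsupport G) hts
  have hts' := (tsupport_coordLaplacian_subset (List.finRange k) G).trans hts
  refine ⟨hcs, ?_, hTc.of_isClosed_subset (isClosed_tsupport _) hts', fun w => ?_, ?_⟩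
  · have : ContDiff ℝ ((0 : ℕ) : WithTop ℕ∞) (coordLaplacian (List.finRange k) G) :=
      ContDiff.coordLaplacian (m := 0) _ (by simpa using hG)
    exact this.continuous
  · refine (norm_coordLaplacian_finRange_le hG w).trans ?_
    rw [mul_assoc]
    exact mul_le_mul_of_nonneg_left (hbd w) (by positivity)
  · rintro w ⟨i, hi⟩
    by_contra hne
    have hw := hts' (subset_tsupport _ hne) i (Set.mem_univ i)
    rw [Metric.mem_closedBall, dist_eq_norm] at hw
    refine hi ?_
    rw [Metric.mem_ball, dist_eq_norm]
    have h1 := norm_sub_le_norm_sub_add_norm_sub (w i) (z i) (x i)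
    have h2 := hz i
    have h3 : 3 * c / n = c / n + c / n + c / n := by ring
    have h4 : 0 < c / n := by positivity
    linarith

theorem integrable_rootTupleSum_orthoPoly {Ω : Type*} [MeasurableSpace Ω] {P : Measure Ω}
    [IsProbabilityMeasure P] {k n : ℕ} (hk : 0 < k) {p : ℕ → ℝ[X]} (hp : ∀ n, (p n).degree = n)
    {ξ : Fin (n + 1) → Ω → ℂ} (hm : ∀ j, Measurable (ξ j)) {G : (Fin k → ℂ) → ℂ}
    (hG : ContDiff ℝ ((2 * k : ℕ) : WithTop ℕ∞) G) (hcs : HasCompactSupport G)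
    (hΔ : Continuous (coordLaplacian (List.finRange k) G)) {C : ℝ} (hC : ∀ y, ‖G y‖ ≤ C) :
    (∀ ω, ‖rootTupleSum G (orthoPoly p fun j => ξ j ω)‖ ≤ (n : ℝ) ^ k * C) ∧
      Integrable (fun ω => rootTupleSum G (orthoPoly p fun j => ξ j ω)) P := by
  have hC0 : 0 ≤ C := (norm_nonneg _).trans (hC 0)
  have hb : ∀ ω, ‖rootTupleSum G (orthoPoly p fun j => ξ j ω)‖ ≤ (n : ℝ) ^ k * C := fun ω => by
    refine (norm_rootTupleSum_le hC _).trans ?_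
    have : ((orthoPoly p fun j => ξ j ω).natDegree : ℝ) ≤ n := by
      exact_mod_cast natDegree_orthoPoly_le hp _
    gcongr
  refine ⟨hb, Integrable.of_bound ?_ _ (ae_of_all _ hb)⟩
  -- Measurability in ω is not visible from the roots but is clear from the integral formula.
  simp_rw [rootTupleSum_eq_integral hk hG hcs _ one_pos]
  have hmeas := aestronglyMeasurable_integral_prod_log (P := P) (p := p)
    (h := fun z => Real.log (‖z‖ / 1)) hm (by fun_prop) hΔ
  exact hmeas.const_smul ((2 * Real.pi) ^ k : ℝ)⁻¹

set_option maxHeartbeats 1000000 in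
theorem theorem2p1
    (K : Set ℝ) (μ : Measure ℝ) (w : ℝ → ℝ) (p : ℕ → ℝ[X])
    (hμ : IsAdmissibleMeasure K μ w p)
    (N₀ : ℕ) (τ ε : ℝ) (hτ : 0 < τ) (hε₀ : 0 < ε) (hε₁ : ε < 1)
    (k : ℕ) (hk : 0 < k) (C : ℝ) (hC : 0 < C)
    (a b : ℝ) (hab : a ≤ b) (hI : Set.Icc a b ⊆ interior K) :
    ∃ C' c : ℝ, 0 < C' ∧ 0 < c ∧
      ∀ (n : ℕ), 0 < n →
      ∀ (Ω : Type u) (Ω' : Type v) [MeasurableSpace Ω] [MeasurableSpace Ω']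
        (P : Measure Ω) (P' : Measure Ω') [IsProbabilityMeasure P] [IsProbabilityMeasure P']
        (ξ : Fin (n + 1) → Ω → ℂ) (ξ' : Fin (n + 1) → Ω' → ℂ),
        MomentMatching P P' ξ ξ' N₀ τ ε →
      ∀ (z : Fin k → ℂ),
        (∀ i, z i ∈ Complex.ofReal '' Set.Icc a b + Metric.ball (0 : ℂ) (c / n)) →
      ∀ (G : (Fin k → ℂ) → ℂ),
        Function.support G ⊆ Set.univ.pi (fun i => Metric.ball (z i) (c / n)) →
        ContDiff ℝ ((2 * k + 4 : ℕ) : WithTop ℕ∞) G →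
        (∀ m : ℕ, m ≤ 2 * k + 4 → ∀ x, ‖iteratedFDeriv ℝ m G x‖ ≤ C * (n : ℝ) ^ m) →
        Integrable (fun ω => rootTupleSum G (orthoPoly p (fun j => ξ j ω))) P ∧
        Integrable (fun ω => rootTupleSum G (orthoPoly p (fun j => ξ' j ω))) P' ∧
        ‖(∫ ω, rootTupleSum G (orthoPoly p (fun j => ξ j ω)) ∂P) -
            ∫ ω, rootTupleSum G (orthoPoly p (fun j => ξ' j ω)) ∂P'‖ ≤ C' * (n : ℝ) ^ (-c) := by
  obtain ⟨d, C₀, κ, c₁, hLB⟩ := hμ.exists_localBounds hab hI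
  have hdeg := hμ.orthonormal_polynomials.degree_eq
  have hd := hLB.d_pos
  have hc₁ := hLB.c₁_pos
  have hC₀ := hLB.C₀_pos
  have hk1 : (1 : ℝ) ≤ k := by exact_mod_cast hk
  have : Nonempty (Fin k) := ⟨⟨0, hk⟩⟩
  -- With t = n^θ the available gain n^(-ε/2) is t^(-50k²), and all losses are smaller powers of t.
  set θ : ℝ := ε / (100 * k ^ 2) with hθ
  have hθ0 : 0 < θ := by positivity
  have hθk : θ * (100 * (k : ℝ) ^ 2) = ε := by rw [hθ]; field_simp
  have hθ1 : θ ≤ 1 := by nlinarith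
  -- The same c is both the localization radius and the final exponent: the first two bounds serve
  -- the local estimates, and c ≤ θ gives t⁻¹ ≤ n^(-c).
  set c := min (min (d / 65) (c₁ / 3)) θ with hcdef
  have hc : 0 < c := lt_min (lt_min (by positivity) (by positivity)) hθ0
  have hcd : 65 * c ≤ d := by
    have : c ≤ d / 65 := (min_le_left _ _).trans (min_le_left _ _)
    linarith
  have hcc : 3 * c ≤ c₁ := by
    have : c ≤ c₁ / 3 := (min_le_left _ _).trans (min_le_right _ _)
    linarith
  have hcθ : c ≤ θ := min_le_right _ _
  set L := C₀ * Real.exp 2 with hL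
  have hL0 : 0 < L := by positivity
  set C₂ := (2 * Real.pi) ^ k * C with hC₂
  have hpi := Real.pi_gt_three
  have hC₂0 : 0 < C₂ := by positivity
  obtain ⟨B₃, hB₃, hcomp⟩ := exists_regLog_comparison (Fin k) N₀ hτ hε₀ hε₁ hL0
  obtain ⟨B, n₁, hB, hn₁, hmain⟩ :=
    hμ.exists_norm_integral_log_sub_regLog_le.{u} hLB hτ hε₀ hε₁ hc hcd hcc hk hC₂0 hθ
  -- A second instance, because the two probability spaces may live in different universes.
  obtain ⟨B', n₂, hB', hn₂, hmain'⟩ :=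
    hμ.exists_norm_integral_log_sub_regLog_le.{v} hLB hτ hε₀ hε₁ hc hcd hcc hk hC₂0 hθ
  set V := Real.pi * (3 * c) ^ 2 with hV
  have hV0 : 0 < V := by positivity
  set n₀ := max n₁ n₂ with hn₀
  set B₄ := B₃ * 72 ^ k * C₂ * V ^ k with hB₄
  have hB₄0 : 0 < B₄ := by positivity
  refine ⟨B + B' + B₄ + 2 * (n₀ : ℝ) ^ (k + 1) * C, c, by positivity, hc, ?_⟩
  intro n hn Ω Ω' _ _ P P' _ _ ξ ξ' hξ z hz G hsupp hG hbd
  have hn0 : (0 : ℝ) < n := by exact_mod_cast hn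
  have hn1 : (1 : ℝ) ≤ n := by exact_mod_cast hn
  have hx : ∀ i, ∃ x ∈ Set.Icc a b, ‖z i - (x : ℂ)‖ < c / n := by
    intro i
    obtain ⟨_, ⟨x, hx, rfl⟩, y, hy, hxy⟩ := hz i
    refine ⟨x, hx, ?_⟩
    have : z i - x = y := by rw [← hxy]; simp
    rw [this]
    simpa using hy
  choose x hxI hxz using hx
  have hG2 : ContDiff ℝ ((2 * k : ℕ) : WithTop ℕ∞) G := hG.of_le (by
    exact_mod_cast (by omega : 2 * k ≤ 2 * k + 4))
  obtain ⟨hcs, hΔ, hΔs, hΔle, hΔ0⟩ := coordLaplacian_test_function hn hc hxz hsupp hG2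
    (hbd (2 * k) (by omega))
  have hGC : ∀ y, ‖G y‖ ≤ C := fun y => by
    have := hbd 0 (by omega) y
    rwa [norm_iteratedFDeriv_zero, pow_zero, mul_one] at this
  obtain ⟨hb, hint⟩ := integrable_rootTupleSum_orthoPoly (P := P) hk hdeg hξ.left.measurable
    hG2 hcs hΔ hGC
  obtain ⟨hb', hint'⟩ := integrable_rootTupleSum_orthoPoly (P := P') hk hdeg hξ.right.measurable
    hG2 hcs hΔ hGC
  refine ⟨hint, hint', ?_⟩
  have hnc : 0 < (n : ℝ) ^ (-c) := Real.rpow_pos_of_pos hn0 _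
  -- For n < n₀ both expectations are at most n^k C, and n^(-c) ≥ 1/n ≥ 1/n₀ because c ≤ θ ≤ 1; this
  -- accounts for the term 2 n₀^(k+1) C.
  rcases lt_or_ge n n₀ with hlt | hge
  · have h1 := norm_integral_le_of_norm_le_const (μ := P) (ae_of_all _ hb)
    have h2 := norm_integral_le_of_norm_le_const (μ := P') (ae_of_all _ hb')
    rw [probReal_univ, mul_one] at h1 h2
    have hnn : (n : ℝ) ≤ n₀ := by exact_mod_cast hlt.le
    have h3 : 1 ≤ n₀ * (n : ℝ) ^ (-c) := by
      calc (1 : ℝ) = n * (n : ℝ) ^ (-1 : ℝ) := by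
            rw [Real.rpow_neg_one, mul_inv_cancel₀ hn0.ne']
        _ ≤ n₀ * (n : ℝ) ^ (-c) := by
            refine mul_le_mul hnn ?_ (Real.rpow_nonneg hn0.le _) (Nat.cast_nonneg _)
            exact Real.rpow_le_rpow_of_exponent_le hn1 (by linarith)
    have h4 : (n : ℝ) ^ k * C ≤ (n₀ : ℝ) ^ k * C * (n₀ * (n : ℝ) ^ (-c)) := by
      have h5 : (n : ℝ) ^ k * C ≤ (n₀ : ℝ) ^ k * C := by gcongr
      exact h5.trans (le_mul_of_one_le_right (by positivity) h3)
    have h6 : 0 ≤ (B + B' + B₄) * (n : ℝ) ^ (-c) := by positivity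
    refine (norm_sub_le _ _).trans ?_
    have h7 : (B + B' + B₄ + 2 * (n₀ : ℝ) ^ (k + 1) * C) * (n : ℝ) ^ (-c) =
        (B + B' + B₄) * (n : ℝ) ^ (-c) + 2 * ((n₀ : ℝ) ^ k * C * (n₀ * (n : ℝ) ^ (-c))) := by
      ring
    rw [h7]
    linarith
  · obtain ⟨hδt, hmain⟩ := hmain n ((le_max_left _ _).trans hge)
    obtain ⟨-, hmain'⟩ := hmain' n ((le_max_right _ _).trans hge)
    set t := (n : ℝ) ^ θ with ht
    have ht1 : 1 ≤ t := Real.one_le_rpow hn1 hθ0.le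
    have ht0 : 0 < t := by linarith
    set δ := (t ^ (4 * k + 8))⁻¹ with hδdef
    have hδ : 0 < δ := by positivity
    have hδ1 : δ ≤ 1 := inv_le_one_of_one_le₀ (one_le_pow₀ ht1)
    have hΛ : (1 : ℝ) ≤ (n : ℝ) ^ 2 := one_le_pow₀ hn1
    have hδΛ : δ ≤ (n : ℝ) ^ 2 := hδ1.trans hΛ
    set Ψ := coordLaplacian (List.finRange k) G with hΨ
    have hsn : 0 < √(n : ℝ) * (n : ℝ) ^ 2 := by
      have := Real.sqrt_pos.2 hn0
      positivity
    have hpk : 1 ≤ (2 * Real.pi) ^ k := one_le_pow₀ (by linarith)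
    have hΨQ : ∀ w, ‖Ψ w‖ ≤ C₂ * (n : ℝ) ^ (2 * k) := fun w => by
      refine (hΔle w).trans ?_
      have : (2 : ℝ) ^ k ≤ (2 * Real.pi) ^ k := pow_le_pow_left₀ (by norm_num) (by linarith) k
      rw [hC₂]
      gcongr
    -- The scale s = √n·n² makes log(|F|/s) equal to log(|y|/Λ) for y = F/√n and Λ = n² when F ≠ 0.
    have hrep := fun F : ℂ[X] => rootTupleSum_eq_integral hk hG2 hcs F hsn
    have hbV : ∀ F : ℂ[X], ‖rootTupleSum G F‖ ≤ (n : ℝ) ^ k * C →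
        ‖∫ w, (∏ i, Real.log (‖F.eval (w i)‖ / (√n * (n : ℝ) ^ 2))) • Ψ w‖ ≤
          C₂ * (n : ℝ) ^ k := by
      intro F hF
      rw [hrep, norm_smul, Real.norm_eq_abs, abs_of_nonneg (by positivity),
        inv_mul_le_iff₀ (by positivity)] at hF
      refine hF.trans (le_of_eq ?_)
      rw [hC₂]
      ring
    have hA := hmain Ω P ξ hξ.left x hxI Ψ hΔ hΔs hΨQ hΔ0 fun ω => hbV _ (hb ω)
    have hA' := hmain' Ω' P' ξ' hξ.right x hxI Ψ hΔ hΔs hΨQ hΔ0 fun ω => hbV _ (hb' ω)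
    obtain ⟨hJ, hJe⟩ := integral_integral_prod_regLog_eq (P := P) (p := p) hξ.left.measurable hδ hδΛ
      hΔ hΔs ((√n : ℝ) : ℂ)
    obtain ⟨hJ', hJe'⟩ := integral_integral_prod_regLog_eq (P := P') (p := p) hξ.right.measurable hδ
      hδΛ hΔ hΔs ((√n : ℝ) : ℂ)
    have hmid : ‖(∫ ω, ∫ w, (∏ i, regLog δ ((n : ℝ) ^ 2)
          ((orthoPoly p fun j => ξ j ω).eval (w i) / (√n : ℝ))) • Ψ w ∂volume ∂P) -
        ∫ ω, ∫ w, (∏ i, regLog δ ((n : ℝ) ^ 2)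
          ((orthoPoly p fun j => ξ' j ω).eval (w i) / (√n : ℝ))) • Ψ w ∂volume ∂P'‖ ≤
        B₄ * t⁻¹ := by
      rw [hJe, hJe', ← integral_sub hJ hJ']
      set η := B₃ * (n : ℝ) ^ (-(ε / 2)) *
        (72 * (δ ^ 4)⁻¹ * Real.log ((n : ℝ) ^ 2 / δ)) ^ k with hη
      have hlogpos : 0 ≤ Real.log ((n : ℝ) ^ 2 / δ) :=
        Real.log_nonneg ((one_le_div hδ).2 hδΛ)
      have hpt : ∀ w, ‖(∫ ω, ∏ i, regLog δ ((n : ℝ) ^ 2)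
            ((orthoPoly p fun j => ξ j ω).eval (w i) / (√n : ℝ)) ∂P) • Ψ w -
          (∫ ω, ∏ i, regLog δ ((n : ℝ) ^ 2)
            ((orthoPoly p fun j => ξ' j ω).eval (w i) / (√n : ℝ)) ∂P') • Ψ w‖ ≤ η * ‖Ψ w‖ := by
        intro w
        by_cases hw : ∃ i, w i ∉ Metric.ball (x i : ℂ) (3 * c / n)
        · rw [hΔ0 w hw]
          simp
        · push Not at hw
          rw [← sub_smul, norm_smul, Real.norm_eq_abs]
          refine mul_le_mul_of_nonneg_right ?_ (norm_nonneg _)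
          simp_rw [eval_orthoPoly_div]
          have := hcomp n hn Ω Ω' P P' ξ ξ' hξ
            (fun i j => Polynomial.aeval (w i) (p j) / ((√n : ℝ) : ℂ)) (fun i j => by
              refine hLB.norm_coeff_le hn (hxI i) ?_ j
              have h1 := hw i
              rw [Metric.mem_ball, dist_eq_norm] at h1
              refine h1.le.trans ?_
              gcongr
              linarith) δ ((n : ℝ) ^ 2) hδ hδ1 hΛ
          rwa [Fintype.card_fin] at this
      refine (norm_integral_le_of_norm_le ((hΔ.integrable_of_hasCompactSupport hΔs).norm.const_mul η)
        (ae_of_all _ hpt)).trans ?_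
      rw [integral_const_mul]
      have hη0 : 0 ≤ η := by positivity
      refine (mul_le_mul_of_nonneg_left (integral_norm_le_of_support (by positivity) hΨQ hΔ0)
        hη0).trans ?_
      have heps : (n : ℝ) ^ (-(ε / 2)) = (t ^ (50 * k ^ 2))⁻¹ := by
        rw [Real.rpow_neg hn0.le, ht, ← Real.rpow_natCast, ← Real.rpow_mul hn0.le]
        congr 2
        rw [← hθk]
        push_cast
        ring
      -- Each variable loses δ^(-4) log(Λ/δ) ≤ t^(16k+33), and (16k + 33)k + 1 ≤ 50k².
      have h1 : η ≤ B₃ * 72 ^ k * t⁻¹ := by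
        have h2 : (72 * (δ ^ 4)⁻¹ * Real.log ((n : ℝ) ^ 2 / δ)) ^ k ≤
            72 ^ k * t ^ ((16 * k + 33) * k) := by
          calc _ ≤ (72 * (δ ^ 4)⁻¹ * t) ^ k := by gcongr
            _ = 72 ^ k * t ^ ((16 * k + 33) * k) := by
              rw [hδdef, inv_pow, inv_inv, ← pow_mul, mul_assoc, ← pow_succ, mul_pow, ← pow_mul]
              congr 2
              ring
        have h3 : t ^ ((16 * k + 33) * k) * (t ^ (50 * k ^ 2))⁻¹ ≤ t⁻¹ :=
          pow_mul_inv_pow_le ht1 (by nlinarith)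
        calc η ≤ B₃ * (t ^ (50 * k ^ 2))⁻¹ * (72 ^ k * t ^ ((16 * k + 33) * k)) := by
              rw [hη, heps]; gcongr
          _ = B₃ * 72 ^ k * (t ^ ((16 * k + 33) * k) * (t ^ (50 * k ^ 2))⁻¹) := by ring
          _ ≤ _ := by gcongr
      have h4 : C₂ * (n : ℝ) ^ (2 * k) * (Real.pi * (3 * c) ^ 2 / (n : ℝ) ^ 2) ^ k =
          C₂ * V ^ k := by
        rw [← hV, div_pow, pow_mul]
        field_simp
      rw [h4]
      calc η * (C₂ * V ^ k) ≤ (B₃ * 72 ^ k * t⁻¹) * (C₂ * V ^ k) := by gcongr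
        _ = _ := by rw [hB₄]; ring
    have htc : t⁻¹ ≤ (n : ℝ) ^ (-c) := by
      rw [ht, ← Real.rpow_neg hn0.le]
      exact Real.rpow_le_rpow_of_exponent_le hn1 (by linarith)
    simp_rw [hrep]
    rw [integral_smul, integral_smul, ← smul_sub, norm_smul, Real.norm_eq_abs,
      abs_of_nonneg (by positivity)]
    refine (mul_le_of_le_one_left (norm_nonneg _) (inv_le_one_of_one_le₀ hpk)).trans ?_
    have htri : ∀ u₁ u₂ u₃ u₄ : ℂ, ‖u₁ - u₂‖ ≤ ‖u₁ - u₃‖ + ‖u₃ - u₄‖ + ‖u₂ - u₄‖ := by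
      intro u₁ u₂ u₃ u₄
      rw [norm_sub_rev u₂ u₄]
      refine (norm_sub_le_norm_sub_add_norm_sub u₁ u₄ u₂).trans (add_le_add ?_ le_rfl)
      exact norm_sub_le_norm_sub_add_norm_sub u₁ u₃ u₄
    refine (htri _ _ _ _).trans ((add_le_add (add_le_add hA hmid) hA').trans ?_)
    have h5 : B * t⁻¹ + B₄ * t⁻¹ + B' * t⁻¹ ≤ (B + B' + B₄) * (n : ℝ) ^ (-c) := by
      have : B * t⁻¹ + B₄ * t⁻¹ + B' * t⁻¹ = (B + B' + B₄) * t⁻¹ := by ring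
      rw [this]
      gcongr
    refine h5.trans (mul_le_mul_of_nonneg_right ?_ hnc.le)
    have : 0 ≤ 2 * (n₀ : ℝ) ^ (k + 1) * C := by positivity
    linarith
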